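/- Work over $\mathbb{R}$ with $\mathbb{Z}$-graded vector spaces. For a graded vector space $V$ let $(\mathsf{s}V)^k = V^{k+1}$ and $(\mathsf{u}V)^k = V^{k-1}$; both are $V$ with a shifted grading. All differentials have degree $+1$. **Categories.** $\mathsf{DGA}$ is the category of unital differential graded algebras and unital morphisms, $\mathsf{DGLA}$ that of differential graded Lie algebras, and $\mathsf{DGCC}_a$ that of co-unital, co-augmented, graded cocommutative differential graded coalgebras, with morphisms preserving all the structure. Let $\mathsf{S}(V)=\bigoplus_{k\ge 0}\mathsf{S}^k(V)$ be the symmetric coalgebra of $V$: it is spanned by the graded commutative words $x_1\cdots x_k$, with $$\Delta(x_1\cdots x_k)=\sum_{I\sqcup J=\{1,\dots,k\}}\pm\, x_I\otimes x_J$$ (Koszul signs), co-unit and co-augmentation given by $\mathsf{S}^0(V)=\mathbb{R}$. An $L_\infty$-algebra is a graded vector space $\mathfrak{g}$ with a linear map $l=\sum_{k\ge 1} l_k:\mathsf{S}(\mathsf{s}\mathfrak{g})\to\mathsf{s}\mathfrak{g}$ of degree $1$, $l(1)=0$, such that the unique coderivation $\delta_{\mathfrak{g}}$ of $\mathsf{S}(\mathsf{s}\mathfrak{g})$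 with corestriction $l$ has square zero. Then $\mathsf{CE}(\mathfrak{g}):=(\mathsf{S}(\mathsf{s}\mathfrak{g}),\delta_{\mathfrak{g}},\Delta)$ is an object of $\mathsf{DGCC}_a$, and a morphism of $L_\infty$-algebras $\mathfrak{g}\to\mathfrak{h}$ is by definition a morphism $\mathsf{CE}(\mathfrak{g})\to\mathsf{CE}(\mathfrak{h})$ in $\mathsf{DGCC}_a$. This gives the category $\mathsf{L}_\infty$ and the functor $\mathsf{CE}:\mathsf{L}_\infty\to\mathsf{DGCC}_a$. **Functors.** * $\mathsf{L}:\mathsf{DGCC}_a\to\mathsf{DGLA}$ sends $C$ to the free graded Lie algebra on $\mathsf{u}\overline{C}$, where $\overline{C}$ is the kernel of the co-unit; that is, to the graded Lie subalgebra of the tensor algebra $\mathsf{T}(\mathsf{u}\overline{C})$ generated by $\mathsf{u}\overline{C}$. Its differential is the Lie derivation with $\delta(\mathsf{u}x)=\mathsf{u}\,dx-\sum_i(-1)^{|x_i|}\,\mathsf{u}x_i\otimes\mathsf{u}y_i$ if $\overline{\Delta}(x)=\Delta x-x\otimes 1-1\otimes x=\sum_i x_i\otimes y_i$. * $\mathbb{U}:\mathsf{DGLA}\to\mathsf{DGA}$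 is the universal enveloping algebra: $\mathbb{U}(\mathfrak{g})$ is the quotient of $\mathsf{T}\mathfrak{g}$ by the two-sided ideal generated by the elements $x\otimes y-(-1)^{|x||y|}y\otimes x-[x,y]$, with the induced differential. * $\Sigma:\mathsf{DGA}\to\mathsf{DGLA}$ sends $A$ to the complex $A$ with the graded commutator $[x,y]=xy-(-1)^{|x||y|}yx$. * $\iota:\mathsf{DGLA}\to\mathsf{L}_\infty$ is the inclusion: $l_1(\mathsf{s}x)=-\mathsf{s}\,dx$, $l_2(\mathsf{s}x\cdot\mathsf{s}y)=(-1)^{|\mathsf{s}x|}\,\mathsf{s}[x,y]$, $l_k=0$ for $k\ge 3$; a morphism $f$ is sent to $\mathsf{S}(\mathsf{s}f)$. **Proposition.** The functor $\mathbb{U}_\infty:=\mathbb{U}\circ\mathsf{L}\circ\mathsf{CE}:\mathsf{L}_\infty\to\mathsf{DGA}$ is left adjoint to the forgetful functor $\Sigma_\infty:=\iota\circ\Sigma:\mathsf{DGA}\to\mathsf{L}_\infty$. In other words, there are bijections $$\mathrm{Hom}_{\mathsf{DGA}}(\mathbb{U}_\infty(\mathfrak{g}),A)\;\cong\;\mathrm{Hom}_{\mathsf{L}_\infty}(\mathfrak{g},\Sigma_\infty(A)),$$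 natural in the $L_\infty$-algebra $\mathfrak{g}$ and the differential graded algebra $A$. -/

import Mathlib

open scoped TensorProduct DirectSum
open CategoryTheory

universe u

namespace LInf

noncomputable section

/-! ### Signs and graded vector spaces -/

/-- The sign `(-1)^n`, as a real number. -/
def sgn (n : ℤ) : ℝ := (-1 : ℝ) ^ n

theorem sgn_add (m n : ℤ) : sgn (m + n) = sgn m * sgn n :=
  zpow_add₀ (by norm_num) m n

theorem sgn_zero : sgn 0 = 1 := zpow_zero _

theorem sgn_one : sgn 1 = -1 := zpow_one _

theorem sgn_mul_self (n : ℤ) : sgn n * sgn n = 1 := by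
  rw [← sgn_add, sgn, Even.neg_one_zpow ⟨n, rfl⟩]

theorem sgn_add_one (n : ℤ) : sgn (n + 1) = -sgn n := by
  rw [sgn_add, sgn_one, mul_neg_one]

theorem sgn_sub_one (n : ℤ) : sgn (n - 1) = -sgn n := by
  have := sgn_add_one (n - 1)
  rw [sub_add_cancel] at this
  rw [this, neg_neg]

theorem sgn_eq (n : ℤ) : (Even n ∧ sgn n = 1) ∨ (Odd n ∧ sgn n = -1) := by
  rcases Int.even_or_odd n with h | h
  · exact Or.inl ⟨h, h.neg_one_zpow⟩
  · exact Or.inr ⟨h, h.neg_one_zpow⟩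

theorem sgn_even {n : ℤ} (h : Even n) : sgn n = 1 := h.neg_one_zpow

theorem sgn_odd {n : ℤ} (h : Odd n) : sgn n = -1 := h.neg_one_zpow

theorem uzpow_smul {M : Type*} [AddCommGroup M] [Module ℝ M] (n : ℤ) (x : M) :
    ((-1 : ℤˣ) ^ n) • x = sgn n • x := by
  rcases Int.even_or_odd n with h | h
  · rw [sgn_even h, h.neg_one_zpow, one_smul, one_smul]
  · rw [sgn_odd h, h.neg_one_zpow, Units.neg_smul, one_smul, neg_one_smul]

section Graded

variable {V W X : Type*} [AddCommGroup V] [Module ℝ V] [AddCommGroup W] [Module ℝ W]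
  [AddCommGroup X] [Module ℝ X]

theorem hom_ext_deg (𝒱 : ℤ → Submodule ℝ V) [DirectSum.Decomposition 𝒱] {f g : V →ₗ[ℝ] X}
    (h : ∀ n x, x ∈ 𝒱 n → f x = g x) : f = g :=
  DirectSum.decompose_lhom_ext 𝒱 fun n => LinearMap.ext fun x => h n x x.2

theorem tensor_ext_deg (𝒱 : ℤ → Submodule ℝ V) [DirectSum.Decomposition 𝒱]
    (𝒲 : ℤ → Submodule ℝ W) [DirectSum.Decomposition 𝒲] {f g : V ⊗[ℝ] W →ₗ[ℝ] X}
    (h : ∀ i j x y, x ∈ 𝒱 i → y ∈ 𝒲 j → f (x ⊗ₜ y) = g (x ⊗ₜ y)) : f = g := by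
  apply TensorProduct.ext
  apply hom_ext_deg 𝒱
  intro i x hx
  apply hom_ext_deg 𝒲
  intro j y hy
  exact h i j x y hx hy

/-- Induction on homogeneous elements. -/
theorem deg_induction (𝒱 : ℤ → Submodule ℝ V) [DirectSum.Decomposition 𝒱] (P : V → Prop)
    (h0 : P 0) (hadd : ∀ x y, P x → P y → P (x + y)) (hd : ∀ n x, x ∈ 𝒱 n → P x) (x : V) : P x :=
  DirectSum.Decomposition.inductionOn 𝒱 (motive := P) h0 (fun {n} m => hd n m m.2)
    (fun m m' h h' => hadd m m' h h') x

/-- The degree involution `x ↦ (-1)^{|x|} x`. -/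
def parity (𝒱 : ℤ → Submodule ℝ V) [DirectSum.Decomposition 𝒱] : V →ₗ[ℝ] V :=
  DirectSum.toModule ℝ ℤ V (fun n => sgn n • (𝒱 n).subtype) ∘ₗ
    (DirectSum.decomposeLinearEquiv 𝒱).toLinearMap

theorem parity_apply (𝒱 : ℤ → Submodule ℝ V) [DirectSum.Decomposition 𝒱] {n : ℤ} {x : V}
    (hx : x ∈ 𝒱 n) : parity 𝒱 x = sgn n • x := by
  simp only [parity, LinearMap.comp_apply, LinearEquiv.coe_coe,
    DirectSum.decomposeLinearEquiv_apply, DirectSum.decompose_of_mem 𝒱 hx]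
  rw [← DirectSum.lof_eq_of ℝ, DirectSum.toModule_lof]
  rfl

theorem parity_parity (𝒱 : ℤ → Submodule ℝ V) [DirectSum.Decomposition 𝒱] (x : V) :
    parity 𝒱 (parity 𝒱 x) = x := by
  suffices parity 𝒱 ∘ₗ parity 𝒱 = LinearMap.id from LinearMap.congr_fun this x
  apply hom_ext_deg 𝒱
  intro n x hx
  simp [parity_apply 𝒱 hx, smul_smul, sgn_mul_self]

theorem map_parity {𝒱 : ℤ → Submodule ℝ V} [DirectSum.Decomposition 𝒱]
    {𝒲 : ℤ → Submodule ℝ W} [DirectSum.Decomposition 𝒲] (f : V →ₗ[ℝ] W)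
    (hf : ∀ n x, x ∈ 𝒱 n → f x ∈ 𝒲 n) (x : V) : f (parity 𝒱 x) = parity 𝒲 (f x) := by
  suffices f ∘ₗ parity 𝒱 = parity 𝒲 ∘ₗ f from LinearMap.congr_fun this x
  apply hom_ext_deg 𝒱
  intro n x hx
  simp [parity_apply 𝒱 hx, parity_apply 𝒲 (hf n x hx)]

theorem map_parity_succ {𝒱 : ℤ → Submodule ℝ V} [DirectSum.Decomposition 𝒱]
    {𝒲 : ℤ → Submodule ℝ W} [DirectSum.Decomposition 𝒲] (f : V →ₗ[ℝ] W)
    (hf : ∀ n x, x ∈ 𝒱 n → f x ∈ 𝒲 (n + 1)) (x : V) :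
    f (parity 𝒱 x) = -parity 𝒲 (f x) := by
  suffices f ∘ₗ parity 𝒱 = -(parity 𝒲 ∘ₗ f) from LinearMap.congr_fun this x
  apply hom_ext_deg 𝒱
  intro n x hx
  simp [parity_apply 𝒱 hx, parity_apply 𝒲 (hf n x hx), sgn_add_one]

theorem parity_mem (𝒱 : ℤ → Submodule ℝ V) [DirectSum.Decomposition 𝒱] {n : ℤ} {x : V}
    (hx : x ∈ 𝒱 n) : parity 𝒱 x ∈ 𝒱 n := by
  rw [parity_apply 𝒱 hx]
  exact Submodule.smul_mem _ _ hx

/-- The signed flip `x ⊗ y ↦ (-1)^{|x||y|} y ⊗ x` (see `gradedSwap_tmul`). -/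
def gradedSwap (𝒱 : ℤ → Submodule ℝ V) [DirectSum.Decomposition 𝒱] :
    V ⊗[ℝ] V →ₗ[ℝ] V ⊗[ℝ] V :=
  (TensorProduct.comm ℝ V V).toLinearMap ∘ₗ
    ((1 / 2 : ℝ) • (LinearMap.id + TensorProduct.map (parity 𝒱) LinearMap.id
      + TensorProduct.map LinearMap.id (parity 𝒱)
      - TensorProduct.map (parity 𝒱) (parity 𝒱)))

theorem gradedSwap_tmul (𝒱 : ℤ → Submodule ℝ V) [DirectSum.Decomposition 𝒱] {i j : ℤ} {x y : V}
    (hx : x ∈ 𝒱 i) (hy : y ∈ 𝒱 j) :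
    gradedSwap 𝒱 (x ⊗ₜ[ℝ] y) = sgn (i * j) • (y ⊗ₜ[ℝ] x) := by
  simp only [gradedSwap, LinearMap.comp_apply, LinearMap.smul_apply, LinearMap.add_apply,
    LinearMap.sub_apply, TensorProduct.map_tmul, LinearMap.id_apply, parity_apply 𝒱 hx,
    parity_apply 𝒱 hy, map_smul, map_add, map_sub, LinearEquiv.coe_coe,
    TensorProduct.comm_tmul, ← TensorProduct.smul_tmul', TensorProduct.tmul_smul, smul_smul]
  rcases sgn_eq i with ⟨hi, hi'⟩ | ⟨hi, hi'⟩ <;> rcases sgn_eq j with ⟨hj, hj'⟩ | ⟨hj, hj'⟩ <;>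
  rw [hi', hj']
  · rw [sgn_even (hi.mul_right j)]; module
  · rw [sgn_even (hi.mul_right j)]; module
  · rw [sgn_even (hj.mul_left i)]; module
  · rw [sgn_odd (hi.mul hj)]; module

theorem gradedSwap_map {𝒱 : ℤ → Submodule ℝ V} [DirectSum.Decomposition 𝒱]
    {𝒲 : ℤ → Submodule ℝ W} [DirectSum.Decomposition 𝒲] (f g : V →ₗ[ℝ] W)
    (hf : ∀ n x, x ∈ 𝒱 n → f x ∈ 𝒲 n) (hg : ∀ n x, x ∈ 𝒱 n → g x ∈ 𝒲 n) (t : V ⊗[ℝ] V) :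
    gradedSwap 𝒲 (TensorProduct.map f g t) = TensorProduct.map g f (gradedSwap 𝒱 t) := by
  suffices gradedSwap 𝒲 ∘ₗ TensorProduct.map f g = TensorProduct.map g f ∘ₗ gradedSwap 𝒱 from
    LinearMap.congr_fun this t
  apply tensor_ext_deg 𝒱 𝒱
  intro i j x y hx hy
  simp [gradedSwap_tmul 𝒱 hx hy, gradedSwap_tmul 𝒲 (hf i x hx) (hg j y hy)]

/-- The degree `n` part of the tensor product of two graded vector spaces. -/
def tensorDeg (𝒱 : ℤ → Submodule ℝ V) (𝒲 : ℤ → Submodule ℝ W) (n : ℤ) :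
    Submodule ℝ (V ⊗[ℝ] W) :=
  Submodule.span ℝ {t | ∃ i j x y, i + j = n ∧ x ∈ 𝒱 i ∧ y ∈ 𝒲 j ∧ t = x ⊗ₜ[ℝ] y}

theorem tmul_mem_tensorDeg {𝒱 : ℤ → Submodule ℝ V} {𝒲 : ℤ → Submodule ℝ W} {i j n : ℤ} {x : V}
    {y : W} (h : i + j = n) (hx : x ∈ 𝒱 i) (hy : y ∈ 𝒲 j) : x ⊗ₜ[ℝ] y ∈ tensorDeg 𝒱 𝒲 n :=
  Submodule.subset_span ⟨i, j, x, y, h, hx, hy, rfl⟩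

theorem map_mem_of_tensorDeg {𝒱 : ℤ → Submodule ℝ V} {𝒲 : ℤ → Submodule ℝ W} {n : ℤ}
    (P : Submodule ℝ X) (f : V ⊗[ℝ] W →ₗ[ℝ] X)
    (hf : ∀ i j x y, i + j = n → x ∈ 𝒱 i → y ∈ 𝒲 j → f (x ⊗ₜ y) ∈ P) {t : V ⊗[ℝ] W}
    (ht : t ∈ tensorDeg 𝒱 𝒲 n) : f t ∈ P := by
  have : tensorDeg 𝒱 𝒲 n ≤ P.comap f := by
    refine Submodule.span_le.2 ?_
    rintro _ ⟨i, j, x, y, h, hx, hy, rfl⟩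
    exact hf i j x y h hx hy
  exact this ht

/-- The graded vector space `V[k]` with `V[k]^n = V^{n+k}`. -/
def shiftDeg (k : ℤ) (𝒱 : ℤ → Submodule ℝ V) : ℤ → Submodule ℝ V := fun n => 𝒱 (n + k)

/-- The suspension `(s V)^n = V^{n+1}`; the map `s` is the identity of the underlying space. -/
abbrev susp (𝒱 : ℤ → Submodule ℝ V) : ℤ → Submodule ℝ V := shiftDeg 1 𝒱

/-- The desuspension `(u V)^n = V^{n-1}`; the map `u` is the identity of the underlying space. -/
abbrev desusp (𝒱 : ℤ → Submodule ℝ V) : ℤ → Submodule ℝ V := shiftDeg (-1) 𝒱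

instance shiftDegDecomposition (k : ℤ) (𝒱 : ℤ → Submodule ℝ V) [DirectSum.Decomposition 𝒱] :
    DirectSum.Decomposition (shiftDeg k 𝒱) := by
  refine DirectSum.IsInternal.chooseDecomposition _ ?_
  have h := (DirectSum.isInternal_submodule_iff_iSupIndep_and_iSup_eq_top 𝒱).1
    (DirectSum.Decomposition.isInternal 𝒱)
  refine (DirectSum.isInternal_submodule_iff_iSupIndep_and_iSup_eq_top _).2
    ⟨h.1.comp (add_left_injective k), ?_⟩
  rw [← h.2]
  exact (Equiv.addRight k).iSup_comp (g := 𝒱)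

theorem parity_shift_one (𝒱 : ℤ → Submodule ℝ V) [DirectSum.Decomposition 𝒱] (x : V) :
    parity (shiftDeg 1 𝒱) x = -parity 𝒱 x := by
  suffices parity (shiftDeg 1 𝒱) = -parity 𝒱 from LinearMap.congr_fun this x
  apply hom_ext_deg (shiftDeg 1 𝒱)
  intro n x hx
  rw [parity_apply _ hx, LinearMap.neg_apply, parity_apply 𝒱 (n := n + 1) hx, sgn_add_one]
  module

theorem parity_shift_neg_one (𝒱 : ℤ → Submodule ℝ V) [DirectSum.Decomposition 𝒱] (x : V) :
    parity (shiftDeg (-1) 𝒱) x = -parity 𝒱 x := by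
  suffices parity (shiftDeg (-1) 𝒱) = -parity 𝒱 from LinearMap.congr_fun this x
  apply hom_ext_deg (shiftDeg (-1) 𝒱)
  intro n x hx
  rw [parity_apply _ hx, LinearMap.neg_apply, parity_apply 𝒱 (n := n + -1) hx,
    ← sub_eq_add_neg, sgn_sub_one]
  module

/-- The grading induced on a subspace. -/
def subDeg (𝒱 : ℤ → Submodule ℝ V) (P : Submodule ℝ V) : ℤ → Submodule ℝ P :=
  fun n => (𝒱 n).comap P.subtype

/-- A subspace containing the homogeneous components of its elements is graded. -/
@[reducible] def subDecomposition (𝒱 : ℤ → Submodule ℝ V) [DirectSum.Decomposition 𝒱] (P : Submodule ℝ V)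
    (hP : ∀ x ∈ P, ∀ n, (DirectSum.decompose 𝒱 x n : V) ∈ P) :
    DirectSum.Decomposition (subDeg 𝒱 P) := by
  refine DirectSum.IsInternal.chooseDecomposition _ ?_
  have h := (DirectSum.isInternal_submodule_iff_iSupIndep_and_iSup_eq_top 𝒱).1
    (DirectSum.Decomposition.isInternal 𝒱)
  refine (DirectSum.isInternal_submodule_iff_iSupIndep_and_iSup_eq_top _).2 ⟨?_, ?_⟩
  · intro i
    rw [Submodule.disjoint_def]
    intro x hx hx'
    refine Subtype.ext ((Submodule.disjoint_def.1 (h.1 i)) x hx ?_)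
    have : (⨆ j, ⨆ (_ : j ≠ i), subDeg 𝒱 P j) ≤ (⨆ j, ⨆ (_ : j ≠ i), 𝒱 j).comap P.subtype :=
      iSup₂_le fun j hj y hy => (le_iSup₂_of_le (f := fun j (_ : j ≠ i) => 𝒱 j) j hj le_rfl) hy
    exact this hx'
  · classical
    rw [eq_top_iff]
    rintro x -
    have hx := DirectSum.sum_support_decompose 𝒱 (x : V)
    have : x = ∑ i ∈ (DirectSum.decompose 𝒱 (x : V)).support,
        (⟨DirectSum.decompose 𝒱 (x : V) i, hP x x.2 i⟩ : P) := by
      apply Subtype.ext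
      rw [AddSubmonoidClass.coe_finsetSum]
      exact hx.symm
    rw [this]
    refine Submodule.sum_mem _ fun i _ => Submodule.mem_iSup_of_mem i ?_
    exact (DirectSum.decompose 𝒱 (x : V) i).2

end Graded

/-! ### Algebras generated by a graded vector space -/

section Words

variable {V : Type*} [AddCommGroup V] [Module ℝ V] (𝒱 : ℤ → Submodule ℝ V)
  {A : Type*} [Ring A] [Algebra ℝ A] (ι : V →ₗ[ℝ] A)

/-- `IsWord 𝒱 ι n a` says that `a = ι x₁ * ⋯ * ι xₖ` with homogeneous `xᵢ` of total degree `n`. -/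
inductive IsWord : ℤ → A → Prop
  | one : IsWord 0 1
  | cons {i n : ℤ} {x : V} {a : A} : x ∈ 𝒱 i → IsWord n a → IsWord (i + n) (ι x * a)

/-- The degree `n` part: the span of the words of total degree `n`. -/
def wordDeg (n : ℤ) : Submodule ℝ A := Submodule.span ℝ {a | IsWord 𝒱 ι n a}

variable {𝒱 ι}

theorem IsWord.mul {m n : ℤ} {a b : A} (ha : IsWord 𝒱 ι m a) (hb : IsWord 𝒱 ι n b) :
    IsWord 𝒱 ι (m + n) (a * b) := by
  induction ha with
  | one => simpa using hb
  | cons hx _ ih => rw [add_assoc, mul_assoc]; exact IsWord.cons hx ih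

theorem IsWord.gen {n : ℤ} {x : V} (hx : x ∈ 𝒱 n) : IsWord 𝒱 ι n (ι x) := by
  simpa using IsWord.cons hx (IsWord.one (𝒱 := 𝒱) (ι := ι))

theorem gen_mem {n : ℤ} {x : V} (hx : x ∈ 𝒱 n) : ι x ∈ wordDeg 𝒱 ι n :=
  Submodule.subset_span (IsWord.gen hx)

instance : SetLike.GradedMonoid (wordDeg 𝒱 ι) where
  one_mem := Submodule.subset_span IsWord.one
  mul_mem m n a b ha hb := by
    have := Submodule.mul_mem_mul ha hb
    rw [wordDeg, wordDeg, Submodule.span_mul_span] at this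
    refine Submodule.span_mono ?_ this
    rintro _ ⟨a, ha, b, hb, rfl⟩
    exact IsWord.mul ha hb

/-- Induction on words with a fixed total degree. -/
theorem wordDeg_le {n : ℤ} (P : Submodule ℝ A) (h : ∀ a, IsWord 𝒱 ι n a → a ∈ P) :
    wordDeg 𝒱 ι n ≤ P := Submodule.span_le.2 h

variable [DirectSum.Decomposition 𝒱]

theorem word_span (hgen : Algebra.adjoin ℝ (Set.range ι) = ⊤) (P : Submodule ℝ A)
    (h : ∀ n a, IsWord 𝒱 ι n a → a ∈ P) : P = ⊤ := by
  have key : ∀ a : A, a ∈ ⨆ n, wordDeg 𝒱 ι n := by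
    intro a
    have ha : a ∈ Algebra.adjoin ℝ (Set.range ι) := hgen ▸ Algebra.mem_top
    induction ha using Algebra.adjoin_induction with
    | mem x hx =>
      obtain ⟨v, rfl⟩ := hx
      induction v using deg_induction 𝒱 with
      | h0 => simp
      | hadd x y hx hy => rw [map_add]; exact add_mem hx hy
      | hd n x hx => exact Submodule.mem_iSup_of_mem n (gen_mem hx)
    | algebraMap r =>
      rw [Algebra.algebraMap_eq_smul_one]
      exact Submodule.smul_mem _ _
        (Submodule.mem_iSup_of_mem 0 (Submodule.subset_span IsWord.one))
    | add x y _ _ hx hy => exact add_mem hx hy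
    | mul x y hx' hy' hx hy =>
      clear hx' hy'
      induction hx using Submodule.iSup_induction' with
      | zero => simp
      | add a b _ _ h1 h2 => rw [add_mul]; exact add_mem h1 h2
      | mem m a ha =>
        induction hy using Submodule.iSup_induction' with
        | zero => simp
        | add a b _ _ h1 h2 => rw [mul_add]; exact add_mem h1 h2
        | mem n b hb =>
          exact Submodule.mem_iSup_of_mem (m + n) (SetLike.GradedMul.mul_mem ha hb)
  rw [eq_top_iff]
  rintro a -
  exact (iSup_le fun n => wordDeg_le P (h n)) (key a)

theorem word_induction (hgen : Algebra.adjoin ℝ (Set.range ι) = ⊤) (P : Submodule ℝ A)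
    (h1 : (1 : A) ∈ P) (hc : ∀ i x a, x ∈ 𝒱 i → a ∈ P → ι x * a ∈ P) (a : A) : a ∈ P := by
  have : P = ⊤ := by
    refine word_span (𝒱 := 𝒱) hgen P fun n a ha => ?_
    induction ha with
    | one => exact h1
    | cons hx _ ih => exact hc _ _ _ hx ih
  rw [this]
  trivial

/-- The linear map `V → A[ℤ]`, `x ↦ ι x · tⁿ` for `x` of degree `n`. -/
def coact (𝒱 : ℤ → Submodule ℝ V) [DirectSum.Decomposition 𝒱] (ι : V →ₗ[ℝ] A) :
    V →ₗ[ℝ] AddMonoidAlgebra A ℤ :=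
  DirectSum.toModule ℝ ℤ _ (fun n => AddMonoidAlgebra.lsingle n ∘ₗ ι ∘ₗ (𝒱 n).subtype) ∘ₗ
    (DirectSum.decomposeLinearEquiv 𝒱).toLinearMap

theorem coact_apply {n : ℤ} {x : V} (hx : x ∈ 𝒱 n) :
    coact 𝒱 ι x = AddMonoidAlgebra.single n (ι x) := by
  simp only [coact, LinearMap.comp_apply, LinearEquiv.coe_coe,
    DirectSum.decomposeLinearEquiv_apply, DirectSum.decompose_of_mem 𝒱 hx]
  rw [← DirectSum.lof_eq_of ℝ, DirectSum.toModule_lof]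
  rfl

/-- The words define a grading of `A` as soon as the degree of a word is well defined, that is, as
soon as `x ↦ ι x · tⁿ` extends to an algebra morphism `A → A[ℤ]`. -/
@[reducible] def wordGradedAlgebra (hgen : Algebra.adjoin ℝ (Set.range ι) = ⊤)
    (ψ : A →ₐ[ℝ] AddMonoidAlgebra A ℤ) (hψ : ∀ x, ψ (ι x) = coact 𝒱 ι x) :
    GradedAlgebra (wordDeg 𝒱 ι) := by
  have hw : ∀ n a, a ∈ wordDeg 𝒱 ι n → ψ a = AddMonoidAlgebra.single n a := by
    intro n a ha
    have : wordDeg 𝒱 ι n ≤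
        LinearMap.eqLocus ψ.toLinearMap (AddMonoidAlgebra.lsingle (R := ℝ) n) := by
      clear ha
      refine wordDeg_le _ fun a ha => ?_
      change ψ a = AddMonoidAlgebra.single n a
      induction ha with
      | one => rw [map_one, AddMonoidAlgebra.one_def]
      | cons hx _ ih =>
        rw [map_mul, ih, hψ, coact_apply hx, AddMonoidAlgebra.single_mul_single]
    exact this ha
  letI : DirectSum.Decomposition (wordDeg 𝒱 ι) := by
    refine DirectSum.IsInternal.chooseDecomposition _ ?_
    refine (DirectSum.isInternal_submodule_iff_iSupIndep_and_iSup_eq_top _).2 ⟨?_, ?_⟩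
    · intro i
      rw [Submodule.disjoint_def]
      intro a ha ha'
      let P : Submodule ℝ A :=
        { carrier := {a | (ψ a).coeff i = 0}
          add_mem' := by
            intro a b ha hb
            change (ψ (a + b)).coeff i = 0
            rw [map_add, AddMonoidAlgebra.coeff_add, Finsupp.add_apply, ha, hb, add_zero]
          zero_mem' := by simp
          smul_mem' := by
            intro c a ha
            change (ψ (c • a)).coeff i = 0
            rw [map_smul, AddMonoidAlgebra.coeff_smul, Finsupp.smul_apply, ha, smul_zero] }
      have hP : (⨆ j, ⨆ (_ : j ≠ i), wordDeg 𝒱 ι j) ≤ P := by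
        refine iSup₂_le fun j hj b hb => ?_
        change (ψ b).coeff i = 0
        rw [hw j b hb, AddMonoidAlgebra.coeff_single, Finsupp.single_apply, if_neg hj]
      have h := hP ha'
      change (ψ a).coeff i = 0 at h
      rw [hw i a ha, AddMonoidAlgebra.coeff_single, Finsupp.single_apply, if_pos rfl] at h
      exact h
    · exact word_span (𝒱 := 𝒱) hgen _ fun n a ha =>
        Submodule.mem_iSup_of_mem n (Submodule.subset_span ha)
  exact { }

theorem parity_mul (𝒜 : ℤ → Submodule ℝ A) [GradedAlgebra 𝒜] (a b : A) :
    parity 𝒜 (a * b) = parity 𝒜 a * parity 𝒜 b := by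
  induction a using deg_induction 𝒜 with
  | h0 => simp
  | hadd x y hx hy => rw [add_mul, map_add, map_add, add_mul, hx, hy]
  | hd i a ha =>
    induction b using deg_induction 𝒜 with
    | h0 => simp
    | hadd x y hx hy => rw [mul_add, map_add, map_add, mul_add, hx, hy]
    | hd j b hb =>
      rw [parity_apply 𝒜 ha, parity_apply 𝒜 hb, parity_apply 𝒜 (SetLike.GradedMul.mul_mem ha hb),
        sgn_add, smul_mul_smul_comm]

theorem parity_one (𝒜 : ℤ → Submodule ℝ A) [GradedAlgebra 𝒜] : parity 𝒜 (1 : A) = 1 := by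
  rw [parity_apply 𝒜 SetLike.GradedOne.one_mem, sgn_zero, one_smul]

/-- The linear map sending `x` to the matrix with rows `(ι ((-1)^{|x|} x), f x)` and `(0, ι x)`.
An extension of it to a morphism of algebras `A → M₂(A)` is the same thing as a signed derivation of
`A` that extends `f`. -/
def derivMatrix (𝒱 : ℤ → Submodule ℝ V) [DirectSum.Decomposition 𝒱] (ι f : V →ₗ[ℝ] A) :
    V →ₗ[ℝ] Matrix (Fin 2) (Fin 2) A where
  toFun x := !![ι (parity 𝒱 x), f x; 0, ι x]
  map_add' x y := by ext i j; fin_cases i <;> fin_cases j <;> simp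
  map_smul' c x := by ext i j; fin_cases i <;> fin_cases j <;> simp

/-- The upper right entry of an algebra morphism `A → M₂(A)`, as a linear map. -/
def upperRight (Φ : A →ₐ[ℝ] Matrix (Fin 2) (Fin 2) A) : A →ₗ[ℝ] A :=
  Matrix.entryLinearMap ℝ A 0 1 ∘ₗ Φ.toLinearMap

theorem upperRight_apply (Φ : A →ₐ[ℝ] Matrix (Fin 2) (Fin 2) A) (a : A) :
    upperRight Φ a = Φ a 0 1 := rfl

theorem upperRight_gen {Φ : A →ₐ[ℝ] Matrix (Fin 2) (Fin 2) A} {f : V →ₗ[ℝ] A}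
    (hΦ : ∀ x, Φ (ι x) = derivMatrix 𝒱 ι f x) (x : V) : upperRight Φ (ι x) = f x := by
  rw [upperRight_apply, hΦ]
  rfl

theorem upperRight_mul [GradedAlgebra (wordDeg 𝒱 ι)]
    (hgen : Algebra.adjoin ℝ (Set.range ι) = ⊤)
    {Φ : A →ₐ[ℝ] Matrix (Fin 2) (Fin 2) A} {f : V →ₗ[ℝ] A}
    (hΦ : ∀ x, Φ (ι x) = derivMatrix 𝒱 ι f x) (a b : A) :
    upperRight Φ (a * b) =
      upperRight Φ a * b + parity (wordDeg 𝒱 ι) a * upperRight Φ b := by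
  have h11 : Φ b 1 1 = b := by
    refine word_induction (𝒱 := 𝒱) hgen
      (LinearMap.eqLocus (Matrix.entryLinearMap ℝ A 1 1 ∘ₗ Φ.toLinearMap) LinearMap.id) ?_ ?_ b
    · change Φ 1 1 1 = 1
      rw [map_one, Matrix.one_apply_eq]
    · intro i x a hx ha
      change Φ a 1 1 = a at ha
      change Φ (ι x * a) 1 1 = ι x * a
      rw [map_mul, Matrix.mul_apply, Fin.sum_univ_two, ha, hΦ]
      simp [derivMatrix]
  have h00 : Φ a 0 0 = parity (wordDeg 𝒱 ι) a ∧ Φ a 1 0 = 0 := by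
    refine word_induction (𝒱 := 𝒱) hgen
      (LinearMap.eqLocus (Matrix.entryLinearMap ℝ A 0 0 ∘ₗ Φ.toLinearMap)
        (parity (wordDeg 𝒱 ι)) ⊓
        LinearMap.ker (Matrix.entryLinearMap ℝ A 1 0 ∘ₗ Φ.toLinearMap)) ?_ ?_ a
    · change Φ 1 0 0 = parity (wordDeg 𝒱 ι) 1 ∧ Φ 1 1 0 = 0
      rw [map_one, Matrix.one_apply_eq, parity_one]
      exact ⟨rfl, Matrix.one_apply_ne (by decide)⟩
    · intro i x a hx ha
      change Φ a 0 0 = parity (wordDeg 𝒱 ι) a ∧ Φ a 1 0 = 0 at ha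
      change Φ (ι x * a) 0 0 = parity (wordDeg 𝒱 ι) (ι x * a) ∧ Φ (ι x * a) 1 0 = 0
      rw [map_mul, Matrix.mul_apply, Matrix.mul_apply, Fin.sum_univ_two, Fin.sum_univ_two, ha.1,
        ha.2, hΦ, parity_mul, ← map_parity ι (fun n x => gen_mem)]
      simp [derivMatrix]
  rw [upperRight_apply, map_mul, Matrix.mul_apply, Fin.sum_univ_two, h11, h00.1]
  exact add_comm _ _

theorem deriv_one {𝒜 : ℤ → Submodule ℝ A} [GradedAlgebra 𝒜] {d : A →ₗ[ℝ] A}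
    (hd : ∀ a b, d (a * b) = d a * b + parity 𝒜 a * d b) : d 1 = 0 := by
  have := hd 1 1
  rw [mul_one, mul_one, parity_one, one_mul] at this
  exact left_eq_add.1 this

theorem deriv_mem [GradedAlgebra (wordDeg 𝒱 ι)] {d : A →ₗ[ℝ] A}
    (hd : ∀ a b, d (a * b) = d a * b + parity (wordDeg 𝒱 ι) a * d b)
    (hgen : ∀ n x, x ∈ 𝒱 n → d (ι x) ∈ wordDeg 𝒱 ι (n + 1)) {n : ℤ} {a : A}
    (ha : a ∈ wordDeg 𝒱 ι n) : d a ∈ wordDeg 𝒱 ι (n + 1) := by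
  refine wordDeg_le ((wordDeg 𝒱 ι (n + 1)).comap d) (fun a ha => ?_) ha
  clear * - ha hd hgen
  change d a ∈ wordDeg 𝒱 ι (n + 1)
  induction ha with
  | one => rw [deriv_one hd]; exact zero_mem _
  | @cons i n x a hx h ih =>
    rw [hd]
    refine add_mem ?_ ?_
    · rw [add_right_comm]
      exact SetLike.GradedMul.mul_mem (hgen i x hx) (Submodule.subset_span h)
    · rw [add_assoc]
      exact SetLike.GradedMul.mul_mem (parity_mem _ (gen_mem hx)) ih

theorem deriv_deriv [GradedAlgebra (wordDeg 𝒱 ι)] (hA : Algebra.adjoin ℝ (Set.range ι) = ⊤)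
    {d : A →ₗ[ℝ] A} (hd : ∀ a b, d (a * b) = d a * b + parity (wordDeg 𝒱 ι) a * d b)
    (hgen : ∀ n x, x ∈ 𝒱 n → d (ι x) ∈ wordDeg 𝒱 ι (n + 1)) (h2 : ∀ x, d (d (ι x)) = 0) (a : A) :
    d (d a) = 0 := by
  refine word_induction (𝒱 := 𝒱) hA (LinearMap.ker (d ∘ₗ d)) ?_ ?_ a
  · change d (d 1) = 0
    rw [deriv_one hd, map_zero]
  · intro i x a hx ha
    change d (d a) = 0 at ha
    change d (d (ι x * a)) = 0
    rw [hd, map_add, hd, hd, h2, ha,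
      map_parity_succ (𝒲 := wordDeg 𝒱 ι) d (fun n b => deriv_mem hd hgen)]
    simp

end Words

/-! ### The four categories -/

/-- A (unital) differential graded algebra over `ℝ`, with differential of degree `1`. -/
structure DGA where
  carrier : Type u
  [ring : Ring carrier]
  [algebra : Algebra ℝ carrier]
  deg : ℤ → Submodule ℝ carrier
  [graded : GradedAlgebra deg]
  d : carrier →ₗ[ℝ] carrier
  d_mem : ∀ n x, x ∈ deg n → d x ∈ deg (n + 1)
  d_d : ∀ x, d (d x) = 0
  leibniz : ∀ n x y, x ∈ deg n → d (x * y) = d x * y + sgn n • (x * d y)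

attribute [instance] DGA.ring DGA.algebra DGA.graded

namespace DGA

/-- A (unital) morphism of differential graded algebras. -/
@[ext] structure Hom (A B : DGA.{u}) where
  toAlgHom : A.carrier →ₐ[ℝ] B.carrier
  map_deg : ∀ n x, x ∈ A.deg n → toAlgHom x ∈ B.deg n
  map_d : ∀ x, toAlgHom (A.d x) = B.d (toAlgHom x)

instance : Category DGA.{u} where
  Hom := Hom
  id A := ⟨AlgHom.id ℝ A.carrier, fun _ _ h => h, fun _ => rfl⟩
  comp f g := ⟨g.toAlgHom.comp f.toAlgHom, fun n x h => g.map_deg n _ (f.map_deg n x h),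
    fun x => (congrArg g.toAlgHom (f.map_d x)).trans (g.map_d _)⟩

theorem d_mul (A : DGA.{u}) (x y : A.carrier) :
    A.d (x * y) = A.d x * y + parity A.deg x * A.d y := by
  induction x using deg_induction A.deg with
  | h0 => simp
  | hadd x x' hx hx' => simp only [add_mul, map_add, hx, hx']; abel
  | hd n x hx => rw [A.leibniz n x y hx, parity_apply A.deg hx, smul_mul_assoc]

end DGA

/-- A differential graded Lie algebra over `ℝ`, with differential of degree `1`. -/
structure DGLA where
  carrier : Type u
  [addCommGroup : AddCommGroup carrier]
  [module : Module ℝ carrier]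
  deg : ℤ → Submodule ℝ carrier
  [decomposition : DirectSum.Decomposition deg]
  d : carrier →ₗ[ℝ] carrier
  bracket : carrier →ₗ[ℝ] carrier →ₗ[ℝ] carrier
  d_mem : ∀ n x, x ∈ deg n → d x ∈ deg (n + 1)
  d_d : ∀ x, d (d x) = 0
  bracket_mem : ∀ i j x y, x ∈ deg i → y ∈ deg j → bracket x y ∈ deg (i + j)
  skew : ∀ i j x y, x ∈ deg i → y ∈ deg j → bracket x y = -(sgn (i * j) • bracket y x)
  jacobi : ∀ i j x y z, x ∈ deg i → y ∈ deg j →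
    bracket x (bracket y z) = bracket (bracket x y) z + sgn (i * j) • bracket y (bracket x z)
  leibniz : ∀ n x y, x ∈ deg n → d (bracket x y) = bracket (d x) y + sgn n • bracket x (d y)

attribute [instance] DGLA.addCommGroup DGLA.module DGLA.decomposition

namespace DGLA

/-- A morphism of differential graded Lie algebras. -/
@[ext] structure Hom (g h : DGLA.{u}) where
  toLinearMap : g.carrier →ₗ[ℝ] h.carrier
  map_deg : ∀ n x, x ∈ g.deg n → toLinearMap x ∈ h.deg n
  map_d : ∀ x, toLinearMap (g.d x) = h.d (toLinearMap x)
  map_bracket : ∀ x y, toLinearMap (g.bracket x y) = h.bracket (toLinearMap x) (toLinearMap y)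

instance : Category DGLA.{u} where
  Hom := Hom
  id g := ⟨LinearMap.id, fun _ _ h => h, fun _ => rfl, fun _ _ => rfl⟩
  comp f g := ⟨g.toLinearMap ∘ₗ f.toLinearMap, fun n x h => g.map_deg n _ (f.map_deg n x h),
    fun x => (congrArg g.toLinearMap (f.map_d x)).trans (g.map_d _),
    fun x y => (congrArg g.toLinearMap (f.map_bracket x y)).trans (g.map_bracket _ _)⟩

end DGLA

/-- A co-augmented cocommutative differential graded coalgebra over `ℝ`: a graded coalgebra whose
comultiplication is invariant under the signed flip, a coderivation `d` of degree `1` and square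
zero, and a co-augmentation `ℝ → C`, given by the image `coaug` of `1`. -/
structure DGCCa where
  carrier : Type u
  [addCommGroup : AddCommGroup carrier]
  [module : Module ℝ carrier]
  [coalgebra : Coalgebra ℝ carrier]
  deg : ℤ → Submodule ℝ carrier
  [decomposition : DirectSum.Decomposition deg]
  d : carrier →ₗ[ℝ] carrier
  coaug : carrier
  comul_mem : ∀ n x, x ∈ deg n → Coalgebra.comul (R := ℝ) x ∈ tensorDeg deg deg n
  counit_of_ne : ∀ n x, x ∈ deg n → n ≠ 0 → Coalgebra.counit (R := ℝ) x = 0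
  cocomm : ∀ x, gradedSwap deg (Coalgebra.comul x) = Coalgebra.comul x
  d_mem : ∀ n x, x ∈ deg n → d x ∈ deg (n + 1)
  d_d : ∀ x, d (d x) = 0
  comul_d : ∀ x, Coalgebra.comul (d x) =
    TensorProduct.map d LinearMap.id (Coalgebra.comul (R := ℝ) x) +
      TensorProduct.map (parity deg) d (Coalgebra.comul (R := ℝ) x)
  counit_d : ∀ x, Coalgebra.counit (R := ℝ) (d x) = 0
  coaug_mem : coaug ∈ deg 0
  d_coaug : d coaug = 0
  comul_coaug : Coalgebra.comul (R := ℝ) coaug = coaug ⊗ₜ coaug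
  counit_coaug : Coalgebra.counit (R := ℝ) coaug = 1

attribute [instance] DGCCa.addCommGroup DGCCa.module DGCCa.coalgebra DGCCa.decomposition

namespace DGCCa

/-- A morphism of co-augmented cocommutative differential graded coalgebras. -/
@[ext] structure Hom (C D : DGCCa.{u}) where
  toCoalgHom : C.carrier →ₗc[ℝ] D.carrier
  map_deg : ∀ n x, x ∈ C.deg n → toCoalgHom x ∈ D.deg n
  map_d : ∀ x, toCoalgHom (C.d x) = D.d (toCoalgHom x)
  map_coaug : toCoalgHom C.coaug = D.coaug

instance : Category DGCCa.{u} where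
  Hom := Hom
  id C := ⟨CoalgHom.id ℝ C.carrier, fun _ _ h => h, fun _ => rfl, rfl⟩
  comp f g := ⟨g.toCoalgHom.comp f.toCoalgHom, fun n x h => g.map_deg n _ (f.map_deg n x h),
    fun x => (congrArg g.toCoalgHom (f.map_d x)).trans (g.map_d _),
    (congrArg g.toCoalgHom f.map_coaug).trans g.map_coaug⟩

end DGCCa

/-! ### The functor `Σ` -/

section Commutator

variable {A : Type*} [Ring A] [Algebra ℝ A] (𝒜 : ℤ → Submodule ℝ A) [GradedAlgebra 𝒜]

/-- The graded commutator, `[x, y] = x y - (-1)^{|x||y|} y x` for homogeneous `x`, `y`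
(see `commutator_apply`). -/
def commutator : A →ₗ[ℝ] A →ₗ[ℝ] A :=
  TensorProduct.curry (LinearMap.mul' ℝ A - LinearMap.mul' ℝ A ∘ₗ gradedSwap 𝒜)

theorem commutator_apply {i j : ℤ} {x y : A} (hx : x ∈ 𝒜 i) (hy : y ∈ 𝒜 j) :
    commutator 𝒜 x y = x * y - sgn (i * j) • (y * x) := by
  simp [commutator, gradedSwap_tmul 𝒜 hx hy]

theorem commutator_mem {i j : ℤ} {x y : A} (hx : x ∈ 𝒜 i) (hy : y ∈ 𝒜 j) :
    commutator 𝒜 x y ∈ 𝒜 (i + j) := by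
  rw [commutator_apply 𝒜 hx hy]
  refine sub_mem (SetLike.GradedMul.mul_mem hx hy) (Submodule.smul_mem _ _ ?_)
  rw [add_comm]
  exact SetLike.GradedMul.mul_mem hy hx

theorem commutator_skew {i j : ℤ} {x y : A} (hx : x ∈ 𝒜 i) (hy : y ∈ 𝒜 j) :
    commutator 𝒜 x y = -(sgn (i * j) • commutator 𝒜 y x) := by
  rw [commutator_apply 𝒜 hx hy, commutator_apply 𝒜 hy hx, mul_comm j i, smul_sub, smul_smul,
    sgn_mul_self]
  module

theorem commutator_jacobi {i j k : ℤ} {x y z : A} (hx : x ∈ 𝒜 i) (hy : y ∈ 𝒜 j) (hz : z ∈ 𝒜 k) :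
    commutator 𝒜 x (commutator 𝒜 y z) = commutator 𝒜 (commutator 𝒜 x y) z +
      sgn (i * j) • commutator 𝒜 y (commutator 𝒜 x z) := by
  rw [commutator_apply 𝒜 hx (commutator_mem 𝒜 hy hz),
    commutator_apply 𝒜 (commutator_mem 𝒜 hx hy) hz,
    commutator_apply 𝒜 hy (commutator_mem 𝒜 hx hz), commutator_apply 𝒜 hx hy,
    commutator_apply 𝒜 hx hz, commutator_apply 𝒜 hy hz]
  simp only [mul_add, add_mul, sgn_add, mul_sub, sub_mul, smul_sub, mul_smul_comm,
    smul_mul_assoc, smul_smul, ← mul_assoc, mul_comm j i, mul_comm k i, mul_comm k j]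
  rcases sgn_eq (i * j) with ⟨-, h⟩ | ⟨-, h⟩ <;> rw [h] <;> module

theorem commutator_leibniz {d : A →ₗ[ℝ] A} (hm : ∀ n x, x ∈ 𝒜 n → d x ∈ 𝒜 (n + 1))
    (hd : ∀ n x y, x ∈ 𝒜 n → d (x * y) = d x * y + sgn n • (x * d y)) {i j : ℤ} {x y : A}
    (hx : x ∈ 𝒜 i) (hy : y ∈ 𝒜 j) :
    d (commutator 𝒜 x y) = commutator 𝒜 (d x) y + sgn i • commutator 𝒜 x (d y) := by
  rw [commutator_apply 𝒜 hx hy, commutator_apply 𝒜 (hm i x hx) hy,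
    commutator_apply 𝒜 hx (hm j y hy), map_sub, map_smul, hd i x y hx, hd j y x hy,
    add_mul, mul_add, sgn_add, sgn_add, one_mul, mul_one]
  rcases sgn_eq i with ⟨-, h⟩ | ⟨-, h⟩ <;> rcases sgn_eq j with ⟨-, h'⟩ | ⟨-, h'⟩ <;>
    rw [h, h'] <;> module

end Commutator

/-- The functor `Σ : DGA → DGLA`: the same complex, with the graded commutator as bracket. -/
def SigmaDG : DGA.{u} ⥤ DGLA.{u} where
  obj A :=
    { carrier := A.carrier
      deg := A.deg
      d := A.d
      bracket := commutator A.deg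
      d_mem := A.d_mem
      d_d := A.d_d
      bracket_mem := fun _ _ _ _ hx hy => commutator_mem A.deg hx hy
      skew := fun _ _ _ _ hx hy => commutator_skew A.deg hx hy
      jacobi := by
        intro i j x y z hx hy
        induction z using deg_induction A.deg with
        | h0 => simp
        | hadd z z' hz hz' => simp only [map_add, hz, hz', smul_add]; abel
        | hd k z hz => exact commutator_jacobi A.deg hx hy hz
      leibniz := by
        intro n x y hx
        induction y using deg_induction A.deg with
        | h0 => simp
        | hadd z z' hz hz' => simp only [map_add, hz, hz', smul_add]; abel
        | hd k z hz => exact commutator_leibniz A.deg A.d_mem A.leibniz hx hz }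
  map {A B} f :=
    { toLinearMap := f.toAlgHom.toLinearMap
      map_deg := f.map_deg
      map_d := f.map_d
      map_bracket := by
        intro x y
        change f.toAlgHom (commutator A.deg x y) =
          commutator B.deg (f.toAlgHom x) (f.toAlgHom y)
        induction x using deg_induction A.deg with
        | h0 => simp
        | hadd z z' hz hz' => simp only [map_add, LinearMap.add_apply, hz, hz']
        | hd i x hx =>
          induction y using deg_induction A.deg with
          | h0 => simp
          | hadd z z' hz hz' => simp only [map_add, hz, hz']
          | hd j y hy =>
            rw [commutator_apply _ hx hy, commutator_apply _ (f.map_deg i x hx)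
              (f.map_deg j y hy), map_sub, map_smul, map_mul, map_mul] }

/-! ### Enveloping algebras and the functor `U` -/

section Env

variable {V : Type*} [AddCommGroup V] [Module ℝ V]

/-- The relations `x ⊗ y = (-1)^{|x||y|} y ⊗ x + b(x, y)` in the tensor algebra of `V`. -/
inductive EnvRel (𝒱 : ℤ → Submodule ℝ V) (b : V →ₗ[ℝ] V →ₗ[ℝ] V) :
    TensorAlgebra ℝ V → TensorAlgebra ℝ V → Prop
  | mk {i j : ℤ} {x y : V} (hx : x ∈ 𝒱 i) (hy : y ∈ 𝒱 j) :
      EnvRel 𝒱 b (TensorAlgebra.ι ℝ x * TensorAlgebra.ι ℝ y)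
        (sgn (i * j) • (TensorAlgebra.ι ℝ y * TensorAlgebra.ι ℝ x) + TensorAlgebra.ι ℝ (b x y))

/-- The quotient of the tensor algebra of `V` by the two-sided ideal generated by the elements
`x ⊗ y - (-1)^{|x||y|} y ⊗ x - b(x, y)`. -/
def Env (𝒱 : ℤ → Submodule ℝ V) (b : V →ₗ[ℝ] V →ₗ[ℝ] V) : Type _ := RingQuot (EnvRel 𝒱 b)

namespace Env

variable {𝒱 : ℤ → Submodule ℝ V} {b : V →ₗ[ℝ] V →ₗ[ℝ] V}

instance : Ring (Env 𝒱 b) := inferInstanceAs (Ring (RingQuot (EnvRel 𝒱 b)))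

instance : Algebra ℝ (Env 𝒱 b) := inferInstanceAs (Algebra ℝ (RingQuot (EnvRel 𝒱 b)))

variable (𝒱 b) in
/-- The quotient map. -/
def mk : TensorAlgebra ℝ V →ₐ[ℝ] Env 𝒱 b := RingQuot.mkAlgHom ℝ (EnvRel 𝒱 b)

variable (𝒱 b) in
/-- The canonical map of `V` into the quotient of its tensor algebra. -/
def ι : V →ₗ[ℝ] Env 𝒱 b := (mk 𝒱 b).toLinearMap ∘ₗ TensorAlgebra.ι ℝ

theorem mk_ι (x : V) : mk 𝒱 b (TensorAlgebra.ι ℝ x) = ι 𝒱 b x := rfl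

theorem ι_mul_ι {i j : ℤ} {x y : V} (hx : x ∈ 𝒱 i) (hy : y ∈ 𝒱 j) :
    ι 𝒱 b x * ι 𝒱 b y = sgn (i * j) • (ι 𝒱 b y * ι 𝒱 b x) + ι 𝒱 b (b x y) := by
  have : mk 𝒱 b _ = mk 𝒱 b _ := RingQuot.mkAlgHom_rel ℝ (EnvRel.mk (b := b) hx hy)
  rw [map_mul, map_add, map_smul, map_mul] at this
  exact this

/-- The universal property of the quotient. -/
def lift {B : Type*} [Ring B] [Algebra ℝ B] (f : V →ₗ[ℝ] B)
    (hf : ∀ i j x y, x ∈ 𝒱 i → y ∈ 𝒱 j → f x * f y = sgn (i * j) • (f y * f x) + f (b x y)) :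
    Env 𝒱 b →ₐ[ℝ] B :=
  RingQuot.liftAlgHom ℝ ⟨TensorAlgebra.lift ℝ f, by
    rintro _ _ ⟨hx, hy⟩
    simpa only [map_mul, map_add, map_smul, TensorAlgebra.lift_ι_apply] using hf _ _ _ _ hx hy⟩

@[simp] theorem lift_ι {B : Type*} [Ring B] [Algebra ℝ B] (f : V →ₗ[ℝ] B)
    (hf : ∀ i j x y, x ∈ 𝒱 i → y ∈ 𝒱 j → f x * f y = sgn (i * j) • (f y * f x) + f (b x y))
    (x : V) : lift f hf (ι 𝒱 b x) = f x := by
  change RingQuot.liftAlgHom ℝ _ (RingQuot.mkAlgHom ℝ _ _) = _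
  rw [RingQuot.liftAlgHom_mkAlgHom_apply, TensorAlgebra.lift_ι_apply]

variable (𝒱 b) in
theorem adjoin_ι : Algebra.adjoin ℝ (Set.range (ι 𝒱 b)) = ⊤ := by
  have : Set.range (ι 𝒱 b) = mk 𝒱 b '' Set.range (TensorAlgebra.ι ℝ (M := V)) := by
    rw [← Set.range_comp]; rfl
  rw [this, ← AlgHom.map_adjoin, TensorAlgebra.adjoin_range_ι, Algebra.map_top,
    AlgHom.range_eq_top]
  exact RingQuot.mkAlgHom_surjective ℝ _

theorem hom_ext {B : Type*} [Ring B] [Algebra ℝ B] {f g : Env 𝒱 b →ₐ[ℝ] B}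
    (h : ∀ x, f (ι 𝒱 b x) = g (ι 𝒱 b x)) : f = g := by
  refine AlgHom.ext_of_adjoin_eq_top (adjoin_ι 𝒱 b) ?_
  rintro _ ⟨x, rfl⟩
  exact h x

/-- If `b` has degree zero, the quotient is graded by the total degree of words. -/
@[reducible] def gradedAlgebra [DirectSum.Decomposition 𝒱]
    (hb : ∀ i j x y, x ∈ 𝒱 i → y ∈ 𝒱 j → b x y ∈ 𝒱 (i + j)) :
    GradedAlgebra (wordDeg 𝒱 (ι 𝒱 b)) :=
  wordGradedAlgebra (adjoin_ι 𝒱 b)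
    (lift (coact 𝒱 (ι 𝒱 b)) (by
      intro i j x y hx hy
      rw [coact_apply hx, coact_apply hy, coact_apply (hb i j x y hx hy),
        AddMonoidAlgebra.single_mul_single, AddMonoidAlgebra.single_mul_single, ι_mul_ι hx hy,
        AddMonoidAlgebra.single_add, add_comm j i, AddMonoidAlgebra.smul_single]))
    (lift_ι _ _)

end Env

end Env

/-- The differential of the enveloping algebra, as an algebra morphism to matrices. -/
def envMatrix (g : DGLA.{u}) :
    Env g.deg g.bracket →ₐ[ℝ] Matrix (Fin 2) (Fin 2) (Env g.deg g.bracket) :=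
  Env.lift (derivMatrix g.deg (Env.ι g.deg g.bracket) (Env.ι g.deg g.bracket ∘ₗ g.d)) (by
    intro i j x y hx hy
    have h1 := Env.ι_mul_ι (b := g.bracket) hx hy
    have h2 := Env.ι_mul_ι (b := g.bracket) hx (g.d_mem j y hy)
    have h3 := Env.ι_mul_ι (b := g.bracket) (g.d_mem i x hx) hy
    have hxy := g.bracket_mem i j x y hx hy
    rw [mul_add, mul_one, sgn_add] at h2
    rw [add_mul, one_mul, sgn_add] at h3
    ext k l
    fin_cases k <;> fin_cases l
    · simp only [derivMatrix, LinearMap.coe_mk, AddHom.coe_mk, parity_apply _ hx,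
        parity_apply _ hy, parity_apply _ hxy]
      simp [Matrix.mul_apply, h1, sgn_add]
      module
    · simp only [derivMatrix, LinearMap.coe_mk, AddHom.coe_mk, parity_apply _ hx,
        parity_apply _ hy, parity_apply _ hxy]
      simp [Matrix.mul_apply, h2, h3, g.leibniz i x y hx]
      rcases sgn_eq i with ⟨-, h⟩ | ⟨-, h⟩ <;> rw [h] <;> module
    · simp [derivMatrix, Matrix.mul_apply]
    · simp [derivMatrix, Matrix.mul_apply, h1])

theorem envMatrix_ι (g : DGLA.{u}) (x : g.carrier) :
    envMatrix g (Env.ι g.deg g.bracket x) =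
      derivMatrix g.deg (Env.ι g.deg g.bracket) (Env.ι g.deg g.bracket ∘ₗ g.d) x :=
  Env.lift_ι _ _ x

instance envGraded (g : DGLA.{u}) : GradedAlgebra (wordDeg g.deg (Env.ι g.deg g.bracket)) :=
  Env.gradedAlgebra g.bracket_mem

/-- The differential of the enveloping algebra: the signed derivation that extends the differential
of `g` (see `envD_ι` and `envD_mul`). -/
def envD (g : DGLA.{u}) : Env g.deg g.bracket →ₗ[ℝ] Env g.deg g.bracket :=
  upperRight (envMatrix g)

theorem envD_ι (g : DGLA.{u}) (x : g.carrier) :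
    envD g (Env.ι g.deg g.bracket x) = Env.ι g.deg g.bracket (g.d x) :=
  upperRight_gen (envMatrix_ι g) x

theorem envD_mul (g : DGLA.{u}) (a b : Env g.deg g.bracket) :
    envD g (a * b) =
      envD g a * b + parity (wordDeg g.deg (Env.ι g.deg g.bracket)) a * envD g b :=
  upperRight_mul (Env.adjoin_ι _ _) (envMatrix_ι g) a b

theorem envD_ι_mem (g : DGLA.{u}) (n : ℤ) (x : g.carrier) (hx : x ∈ g.deg n) :
    envD g (Env.ι g.deg g.bracket x) ∈ wordDeg g.deg (Env.ι g.deg g.bracket) (n + 1) := by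
  rw [envD_ι]
  exact gen_mem (g.d_mem n x hx)

section AlgHom

variable {V W A B : Type*} [AddCommGroup V] [Module ℝ V] [AddCommGroup W] [Module ℝ W]
  [Ring A] [Algebra ℝ A] [Ring B] [Algebra ℝ B] {𝒱 : ℤ → Submodule ℝ V} {𝒲 : ℤ → Submodule ℝ W}
  {ι : V →ₗ[ℝ] A} {κ : W →ₗ[ℝ] B}

theorem algHom_mem_wordDeg (F : A →ₐ[ℝ] B) (f : V →ₗ[ℝ] W)
    (hf : ∀ n x, x ∈ 𝒱 n → f x ∈ 𝒲 n) (hF : ∀ x, F (ι x) = κ (f x)) (n : ℤ) (a : A)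
    (ha : a ∈ wordDeg 𝒱 ι n) : F a ∈ wordDeg 𝒲 κ n := by
  refine wordDeg_le ((wordDeg 𝒲 κ n).comap F.toLinearMap) (fun a ha => ?_) ha
  clear * - ha hf hF
  change F a ∈ wordDeg 𝒲 κ n
  refine Submodule.subset_span ?_
  induction ha with
  | one => rw [map_one]; exact IsWord.one
  | cons hx _ ih => rw [map_mul, hF]; exact IsWord.cons (hf _ _ hx) ih

theorem algHom_deriv [DirectSum.Decomposition 𝒱] [DirectSum.Decomposition 𝒲]
    [GradedAlgebra (wordDeg 𝒱 ι)] [GradedAlgebra (wordDeg 𝒲 κ)] (F : A →ₐ[ℝ] B) (f : V →ₗ[ℝ] W)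
    (hf : ∀ n x, x ∈ 𝒱 n → f x ∈ 𝒲 n) (hF : ∀ x, F (ι x) = κ (f x))
    (hgen : Algebra.adjoin ℝ (Set.range ι) = ⊤) {d : A →ₗ[ℝ] A} {d' : B →ₗ[ℝ] B}
    (hd : ∀ a b, d (a * b) = d a * b + parity (wordDeg 𝒱 ι) a * d b)
    (hd' : ∀ a b, d' (a * b) = d' a * b + parity (wordDeg 𝒲 κ) a * d' b)
    (h : ∀ x, F (d (ι x)) = d' (κ (f x))) (a : A) : F (d a) = d' (F a) := by
  refine word_induction (𝒱 := 𝒱) hgen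
    (LinearMap.eqLocus (F.toLinearMap ∘ₗ d) (d' ∘ₗ F.toLinearMap)) ?_ ?_ a
  · change F (d 1) = d' (F 1)
    rw [deriv_one hd, map_zero, map_one F, deriv_one hd']
  · intro i x a hx ha
    change F (d a) = d' (F a) at ha
    change F (d (ι x * a)) = d' (F (ι x * a))
    have hp := map_parity (𝒱 := wordDeg 𝒱 ι) (𝒲 := wordDeg 𝒲 κ) F.toLinearMap
      (algHom_mem_wordDeg F f hf hF) (ι x)
    change F (parity (wordDeg 𝒱 ι) (ι x)) = parity (wordDeg 𝒲 κ) (F (ι x)) at hp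
    rw [hd, map_add, map_mul, map_mul, map_mul, hd', h, ha, hp, hF]

end AlgHom

/-- The morphism of enveloping algebras induced by a morphism of differential graded Lie
algebras. -/
def envMap {g h : DGLA.{u}} (f : g ⟶ h) : Env g.deg g.bracket →ₐ[ℝ] Env h.deg h.bracket :=
  Env.lift (Env.ι h.deg h.bracket ∘ₗ f.toLinearMap) (by
    intro i j x y hx hy
    simp only [LinearMap.comp_apply]
    rw [Env.ι_mul_ι (f.map_deg i x hx) (f.map_deg j y hy), f.map_bracket])

theorem envMap_ι {g h : DGLA.{u}} (f : g ⟶ h) (x : g.carrier) :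
    envMap f (Env.ι g.deg g.bracket x) = Env.ι h.deg h.bracket (f.toLinearMap x) :=
  Env.lift_ι _ _ x

/-- The universal enveloping algebra functor `U : DGLA → DGA`. -/
def U : DGLA.{u} ⥤ DGA.{u} where
  obj g :=
    { carrier := Env g.deg g.bracket
      deg := wordDeg g.deg (Env.ι g.deg g.bracket)
      d := envD g
      d_mem := fun _ _ => deriv_mem (envD_mul g) (envD_ι_mem g)
      d_d := deriv_deriv (Env.adjoin_ι _ _) (envD_mul g) (envD_ι_mem g) (by
        intro x
        rw [envD_ι, envD_ι, g.d_d, map_zero])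
      leibniz := by
        intro n x y hx
        rw [envD_mul, parity_apply _ hx, smul_mul_assoc] }
  map {g h} f :=
    { toAlgHom := envMap f
      map_deg := algHom_mem_wordDeg (envMap f) f.toLinearMap f.map_deg (envMap_ι f)
      map_d := algHom_deriv (envMap f) f.toLinearMap f.map_deg (envMap_ι f) (Env.adjoin_ι _ _)
        (envD_mul g) (envD_mul h) (by
          intro x
          rw [envD_ι, envD_ι, envMap_ι, f.map_d]) }
  map_id g := DGA.Hom.ext (Env.hom_ext fun x => envMap_ι _ x)
  map_comp f f' := DGA.Hom.ext (Env.hom_ext fun x =>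
    (envMap_ι _ x).trans ((congrArg (envMap f') (envMap_ι f x)).trans (envMap_ι _ _)).symm)

/-! ### The cobar differential and the functor `L` -/

section Cobar

instance tensorAlgebraGraded {V : Type*} [AddCommGroup V] [Module ℝ V] (𝒱 : ℤ → Submodule ℝ V)
    [DirectSum.Decomposition 𝒱] :
    GradedAlgebra (wordDeg 𝒱 (TensorAlgebra.ι ℝ (M := V))) :=
  wordGradedAlgebra TensorAlgebra.adjoin_range_ι (TensorAlgebra.lift ℝ (coact 𝒱 _))
    (TensorAlgebra.lift_ι_apply _)

variable (C : DGCCa.{u})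

/-- The kernel `C̄` of the co-unit. -/
def kerCounit : Submodule ℝ C.carrier := LinearMap.ker (Coalgebra.counit (R := ℝ) (A := C.carrier))

theorem counit_decompose (x : C.carrier) :
    Coalgebra.counit (R := ℝ) ((DirectSum.decompose C.deg x 0 : C.deg 0) : C.carrier) =
      Coalgebra.counit (R := ℝ) x := by
  induction x using deg_induction C.deg with
  | h0 => simp
  | hadd x y hx hy =>
    rw [DirectSum.decompose_add, DirectSum.add_apply, Submodule.coe_add, map_add, hx, hy, map_add]
  | hd n x hx =>
    rcases eq_or_ne n 0 with rfl | hn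
    · rw [DirectSum.decompose_of_mem_same _ hx]
    · rw [DirectSum.decompose_of_mem_ne _ hx hn, map_zero, C.counit_of_ne n x hx hn]

/-- The grading of `C̄` (before desuspension). -/
abbrev kerCounitDeg : ℤ → Submodule ℝ (kerCounit C) := subDeg C.deg (kerCounit C)

instance kerCounitDecomposition : DirectSum.Decomposition (kerCounitDeg C) :=
  subDecomposition C.deg (kerCounit C) (by
    intro x hx n
    change Coalgebra.counit (R := ℝ) _ = 0
    rcases eq_or_ne n 0 with rfl | hn
    · rw [counit_decompose]; exact hx
    · exact C.counit_of_ne n _ (DirectSum.decompose C.deg x n).2 hn)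

/-- The projection `x ↦ x - ε(x) 1` of `C` onto `C̄`. -/
def kerCounitProj : C.carrier →ₗ[ℝ] kerCounit C :=
  LinearMap.codRestrict (kerCounit C)
    (LinearMap.id - (Coalgebra.counit (R := ℝ) (A := C.carrier)).smulRight C.coaug) (by
      intro x
      change Coalgebra.counit (R := ℝ) (x - Coalgebra.counit (R := ℝ) x • C.coaug) = 0
      rw [map_sub, map_smul, C.counit_coaug, smul_eq_mul, mul_one, sub_self])

theorem coe_kerCounitProj (x : C.carrier) :
    (kerCounitProj C x : C.carrier) = x - Coalgebra.counit (R := ℝ) x • C.coaug := rfl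

theorem kerCounitProj_coe (x : kerCounit C) : kerCounitProj C x = x := by
  apply Subtype.ext
  have hx : Coalgebra.counit (R := ℝ) (x : C.carrier) = 0 := x.2
  rw [coe_kerCounitProj, hx, zero_smul, sub_zero]

theorem kerCounitProj_coaug : kerCounitProj C C.coaug = 0 := by
  apply Subtype.ext
  rw [coe_kerCounitProj, C.counit_coaug, one_smul, sub_self]
  rfl

theorem kerCounitProj_mem (n : ℤ) (x : C.carrier) (hx : x ∈ C.deg n) :
    kerCounitProj C x ∈ kerCounitDeg C n := by
  change (kerCounitProj C x : C.carrier) ∈ C.deg n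
  rw [coe_kerCounitProj]
  rcases eq_or_ne n 0 with rfl | hn
  · exact sub_mem hx (Submodule.smul_mem _ _ C.coaug_mem)
  · rwa [C.counit_of_ne n x hx hn, zero_smul, sub_zero]

/-- The reduced coproduct `C̄ → C̄ ⊗ C̄`; by `coe_redComul` it is given by
`Δ̄(x) = Δ(x) - x ⊗ 1 - 1 ⊗ x`. -/
def redComul : kerCounit C →ₗ[ℝ] kerCounit C ⊗[ℝ] kerCounit C :=
  TensorProduct.map (kerCounitProj C) (kerCounitProj C) ∘ₗ Coalgebra.comul ∘ₗ (kerCounit C).subtype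

theorem coe_redComul (x : kerCounit C) :
    TensorProduct.map (kerCounit C).subtype (kerCounit C).subtype (redComul C x) =
      Coalgebra.comul (R := ℝ) (x : C.carrier) - (x : C.carrier) ⊗ₜ[ℝ] C.coaug -
        C.coaug ⊗ₜ[ℝ] (x : C.carrier) := by
  let e : C.carrier →ₗ[ℝ] ℝ := Coalgebra.counit
  have h1 : ∀ t : C.carrier ⊗[ℝ] C.carrier,
      TensorProduct.map (kerCounit C).subtype (kerCounit C).subtype
        (TensorProduct.map (kerCounitProj C) (kerCounitProj C) t) =
      t - TensorProduct.map LinearMap.id (LinearMap.toSpanSingleton ℝ _ C.coaug) (e.lTensor _ t)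
        - TensorProduct.map (LinearMap.toSpanSingleton ℝ _ C.coaug) LinearMap.id (e.rTensor _ t)
        + TensorProduct.map LinearMap.id (LinearMap.toSpanSingleton ℝ _ C.coaug)
          (TensorProduct.map (LinearMap.toSpanSingleton ℝ _ C.coaug) LinearMap.id
            (TensorProduct.map e e t)) := by
    intro t
    induction t using TensorProduct.induction_on with
    | zero => simp
    | add a b ha hb => simp only [map_add, ha, hb]; abel
    | tmul a b =>
      simp [coe_kerCounitProj, TensorProduct.sub_tmul, TensorProduct.tmul_sub, e]
      module
  have hx : e x = 0 := x.2
  have h2 : TensorProduct.map e e (Coalgebra.comul (R := ℝ) (x : C.carrier)) = 0 := by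
    have : TensorProduct.map e e = e.lTensor _ ∘ₗ e.rTensor _ := by
      rw [LinearMap.lTensor_comp_rTensor]
    rw [this, LinearMap.comp_apply, Coalgebra.rTensor_counit_comul, LinearMap.lTensor_tmul, hx,
      TensorProduct.tmul_zero]
  have := h1 (Coalgebra.comul (R := ℝ) (x : C.carrier))
  rw [h2, Coalgebra.rTensor_counit_comul, Coalgebra.lTensor_counit_comul] at this
  simpa [redComul] using this

theorem redComul_kerCounitProj (x : C.carrier) : redComul C (kerCounitProj C x) =
    TensorProduct.map (kerCounitProj C) (kerCounitProj C) (Coalgebra.comul (R := ℝ) x) := by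
  simp only [redComul, LinearMap.comp_apply, Submodule.subtype_apply, coe_kerCounitProj, map_sub,
    map_smul, C.comul_coaug, TensorProduct.map_tmul, kerCounitProj_coaug, TensorProduct.zero_tmul,
    smul_zero, sub_zero]

theorem redComul_coassoc (x : kerCounit C) :
    TensorProduct.assoc ℝ _ _ _ ((redComul C).rTensor _ (redComul C x)) =
      (redComul C).lTensor _ (redComul C x) := by
  have hr : ∀ t : C.carrier ⊗[ℝ] C.carrier,
      TensorProduct.assoc ℝ _ _ _ ((redComul C).rTensor _
        (TensorProduct.map (kerCounitProj C) (kerCounitProj C) t)) =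
      TensorProduct.map (kerCounitProj C) (TensorProduct.map (kerCounitProj C) (kerCounitProj C))
        (TensorProduct.assoc ℝ _ _ _ ((Coalgebra.comul (R := ℝ)).rTensor _ t)) := by
    intro t
    induction t using TensorProduct.induction_on with
    | zero => simp
    | add a b ha hb => simp only [map_add, ha, hb]
    | tmul a b =>
      rw [TensorProduct.map_tmul, LinearMap.rTensor_tmul, LinearMap.rTensor_tmul,
        redComul_kerCounitProj]
      generalize Coalgebra.comul (R := ℝ) a = s
      induction s using TensorProduct.induction_on with
      | zero => simp
      | add a b ha hb => simp only [map_add, TensorProduct.add_tmul, ha, hb]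
      | tmul a b => simp
  have hl : ∀ t : C.carrier ⊗[ℝ] C.carrier,
      (redComul C).lTensor _ (TensorProduct.map (kerCounitProj C) (kerCounitProj C) t) =
      TensorProduct.map (kerCounitProj C) (TensorProduct.map (kerCounitProj C) (kerCounitProj C))
        ((Coalgebra.comul (R := ℝ)).lTensor _ t) := by
    intro t
    induction t using TensorProduct.induction_on with
    | zero => simp
    | add a b ha hb => simp only [map_add, ha, hb]
    | tmul a b =>
      rw [TensorProduct.map_tmul, LinearMap.lTensor_tmul, LinearMap.lTensor_tmul,
        redComul_kerCounitProj, TensorProduct.map_tmul]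
  rw [← kerCounitProj_coe C x, redComul_kerCounitProj, hr, hl, Coalgebra.coassoc_apply]

theorem redComul_mem (n : ℤ) (x : kerCounit C) (hx : x ∈ kerCounitDeg C n) :
    redComul C x ∈ tensorDeg (kerCounitDeg C) (kerCounitDeg C) n :=
  map_mem_of_tensorDeg _ (TensorProduct.map (kerCounitProj C) (kerCounitProj C))
    (fun i j x y h hx hy =>
      tmul_mem_tensorDeg h (kerCounitProj_mem C i x hx) (kerCounitProj_mem C j y hy))
    (C.comul_mem n x hx)

theorem redComul_cocomm (x : kerCounit C) : gradedSwap (kerCounitDeg C) (redComul C x) = redComul C x := by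
  have := gradedSwap_map (𝒱 := C.deg) (𝒲 := kerCounitDeg C) (kerCounitProj C) (kerCounitProj C)
    (kerCounitProj_mem C) (kerCounitProj_mem C) (Coalgebra.comul (R := ℝ) (x : C.carrier))
  rw [C.cocomm] at this
  exact this

theorem redComul_parity (x : kerCounit C) : redComul C (parity (kerCounitDeg C) x) =
    TensorProduct.map (parity (kerCounitDeg C)) (parity (kerCounitDeg C)) (redComul C x) := by
  suffices redComul C ∘ₗ parity (kerCounitDeg C) =
      TensorProduct.map (parity (kerCounitDeg C)) (parity (kerCounitDeg C)) ∘ₗ redComul C from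
    LinearMap.congr_fun this x
  apply hom_ext_deg (kerCounitDeg C)
  intro n x hx
  rw [LinearMap.comp_apply, LinearMap.comp_apply, parity_apply _ hx, map_smul]
  have := map_mem_of_tensorDeg (LinearMap.ker (sgn n • LinearMap.id -
    TensorProduct.map (parity (kerCounitDeg C)) (parity (kerCounitDeg C)))) LinearMap.id (by
      intro i j x y h hx hy
      rw [LinearMap.mem_ker, LinearMap.id_apply, LinearMap.sub_apply, TensorProduct.map_tmul,
        parity_apply _ hx, parity_apply _ hy, TensorProduct.smul_tmul_smul, ← h, sgn_add]
      exact sub_self _) (redComul_mem C n x hx)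
  exact sub_eq_zero.1 this

/-- The differential of `C̄`. -/
def kerCounitD : kerCounit C →ₗ[ℝ] kerCounit C :=
  C.d.restrict (p := kerCounit C) (q := kerCounit C) fun x _ => C.counit_d x

theorem coe_kerCounitD (x : kerCounit C) : (kerCounitD C x : C.carrier) = C.d x := rfl

theorem kerCounitD_mem (n : ℤ) (x : kerCounit C) (hx : x ∈ kerCounitDeg C n) :
    kerCounitD C x ∈ kerCounitDeg C (n + 1) := C.d_mem n x hx

theorem kerCounitD_kerCounitProj (x : C.carrier) : kerCounitD C (kerCounitProj C x) = kerCounitProj C (C.d x) := by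
  apply Subtype.ext
  rw [coe_kerCounitD, coe_kerCounitProj, coe_kerCounitProj, C.counit_d, zero_smul, sub_zero, map_sub, map_smul,
    C.d_coaug, smul_zero, sub_zero]

theorem redComul_kerCounitD (x : kerCounit C) : redComul C (kerCounitD C x) =
    TensorProduct.map (kerCounitD C) LinearMap.id (redComul C x) +
      TensorProduct.map (parity (kerCounitDeg C)) (kerCounitD C) (redComul C x) := by
  rw [← kerCounitProj_coe C x, kerCounitD_kerCounitProj, redComul_kerCounitProj, redComul_kerCounitProj, C.comul_d,
    map_add]
  generalize Coalgebra.comul (R := ℝ) (x : C.carrier) = t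
  induction t using TensorProduct.induction_on with
  | zero => simp
  | add a b ha hb =>
    simp only [map_add] at ha hb ⊢
    rw [add_add_add_comm, ha, hb]
    abel
  | tmul a b =>
    simp only [TensorProduct.map_tmul, LinearMap.id_apply, kerCounitD_kerCounitProj]
    rw [map_parity (𝒱 := C.deg) (𝒲 := kerCounitDeg C) (kerCounitProj C) (kerCounitProj_mem C)]

/-- The tensor algebra of the desuspension `u C̄`. -/
abbrev CobarAlg : Type u := TensorAlgebra ℝ (kerCounit C)

/-- The inclusion of `u C̄` into its tensor algebra. -/
abbrev cobarι : kerCounit C →ₗ[ℝ] CobarAlg C := TensorAlgebra.ι ℝ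

/-- The grading of the tensor algebra of `u C̄`. -/
abbrev cobarDeg : ℤ → Submodule ℝ (CobarAlg C) := wordDeg (desusp (kerCounitDeg C)) (cobarι C)

/-- The map `x ⊗ y ↦ (-1)^{|x|} u x ⊗ u y`, with `|x|` the degree of `x` in `C`. -/
def cobarPair : kerCounit C ⊗[ℝ] kerCounit C →ₗ[ℝ] CobarAlg C :=
  LinearMap.mul' ℝ (CobarAlg C) ∘ₗ
    TensorProduct.map (cobarι C ∘ₗ parity (kerCounitDeg C)) (cobarι C)

theorem cobarPair_tmul (x y : kerCounit C) :
    cobarPair C (x ⊗ₜ y) = cobarι C (parity (kerCounitDeg C) x) * cobarι C y := rfl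

/-- The restriction of the cobar differential to `u C̄`:
`u x ↦ u (d x) - ∑ (-1)^{|xᵢ|} u xᵢ ⊗ u yᵢ` if `Δ̄ x = ∑ xᵢ ⊗ yᵢ`. -/
def cobarGen : kerCounit C →ₗ[ℝ] CobarAlg C :=
  cobarι C ∘ₗ kerCounitD C - cobarPair C ∘ₗ redComul C

/-- The cobar differential: the signed derivation of the tensor algebra of `u C̄` extending
`cobarGen` (see `cobarD_ι` and `cobarD_mul`). -/
def cobarD : CobarAlg C →ₗ[ℝ] CobarAlg C :=
  upperRight (TensorAlgebra.lift ℝ (derivMatrix (desusp (kerCounitDeg C)) (cobarι C) (cobarGen C)))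

theorem cobarD_ι (x : kerCounit C) : cobarD C (cobarι C x) = cobarGen C x :=
  upperRight_gen (𝒱 := desusp (kerCounitDeg C)) (TensorAlgebra.lift_ι_apply _) x

theorem cobarD_mul (a b : CobarAlg C) :
    cobarD C (a * b) = cobarD C a * b + parity (cobarDeg C) a * cobarD C b :=
  upperRight_mul (𝒱 := desusp (kerCounitDeg C)) TensorAlgebra.adjoin_range_ι
    (TensorAlgebra.lift_ι_apply _) a b

theorem cobarι_mem {n : ℤ} {x : kerCounit C} (hx : x ∈ kerCounitDeg C n) :
    cobarι C x ∈ cobarDeg C (n + 1) := by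
  refine gen_mem ?_
  change x ∈ kerCounitDeg C (n + 1 + -1)
  rwa [add_neg_cancel_right]

theorem cobarGen_mem {n : ℤ} {x : kerCounit C} (hx : x ∈ desusp (kerCounitDeg C) n) :
    cobarGen C x ∈ cobarDeg C (n + 1) := by
  have hx' : x ∈ kerCounitDeg C (n - 1) := hx
  refine sub_mem ?_ ?_
  · have := cobarι_mem C (kerCounitD_mem C _ x hx')
    rwa [sub_add_cancel] at this
  · refine map_mem_of_tensorDeg _ (cobarPair C) ?_ (redComul_mem C _ x hx')
    intro i j a b h ha hb
    have h' : n + 1 = (i + 1) + (j + 1) := by omega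
    rw [cobarPair_tmul, h']
    exact SetLike.GradedMul.mul_mem (cobarι_mem C (parity_mem _ ha)) (cobarι_mem C hb)

theorem cobarD_ι_mem (n : ℤ) (x : kerCounit C) (hx : x ∈ desusp (kerCounitDeg C) n) :
    cobarD C (cobarι C x) ∈ cobarDeg C (n + 1) := by
  rw [cobarD_ι]
  exact cobarGen_mem C hx

theorem parity_cobarι (x : kerCounit C) :
    parity (cobarDeg C) (cobarι C x) = -cobarι C (parity (kerCounitDeg C) x) := by
  rw [← map_parity (𝒱 := desusp (kerCounitDeg C)) (cobarι C) (fun n x hx => gen_mem hx),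
    parity_shift_neg_one, map_neg]

theorem cobarD_cobarD_ι (x : kerCounit C) : cobarD C (cobarD C (cobarι C x)) = 0 := by
  have h1 : ∀ t, cobarD C (cobarPair C t) =
      LinearMap.mul' ℝ _ (TensorProduct.map (cobarGen C ∘ₗ parity (kerCounitDeg C)) (cobarι C) t) -
        LinearMap.mul' ℝ _ (TensorProduct.map (cobarι C) (cobarGen C) t) := by
    intro t
    induction t using TensorProduct.induction_on with
    | zero => simp
    | add a b ha hb => simp only [map_add, ha, hb]; abel
    | tmul a b =>
      rw [cobarPair_tmul, cobarD_mul, cobarD_ι, cobarD_ι, parity_cobarι, parity_parity]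
      simp [sub_eq_add_neg]
  have h2 : ∀ t, LinearMap.mul' ℝ _ (TensorProduct.map (cobarGen C ∘ₗ parity (kerCounitDeg C))
        (cobarι C) t) - LinearMap.mul' ℝ _ (TensorProduct.map (cobarι C) (cobarGen C) t) =
      -(cobarPair C (TensorProduct.map (kerCounitD C) LinearMap.id t)
        + cobarPair C (TensorProduct.map (parity (kerCounitDeg C)) (kerCounitD C) t)) -
      (LinearMap.mul' ℝ _ (TensorProduct.map (cobarPair C ∘ₗ redComul C ∘ₗ parity (kerCounitDeg C))
        (cobarι C) t) -
        LinearMap.mul' ℝ _ (TensorProduct.map (cobarι C) (cobarPair C ∘ₗ redComul C) t)) := by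
    intro t
    induction t using TensorProduct.induction_on with
    | zero => simp
    | add a b ha hb =>
      simp only [map_add, neg_add] at ha hb ⊢
      rw [add_sub_add_comm, ha, hb]
      abel
    | tmul a b =>
      simp only [TensorProduct.map_tmul, LinearMap.comp_apply, LinearMap.mul'_apply, cobarGen,
        LinearMap.sub_apply, cobarPair_tmul, LinearMap.id_apply, parity_parity,
        map_parity_succ (𝒲 := kerCounitDeg C) (kerCounitD C) (kerCounitD_mem C), map_neg, sub_mul, mul_sub,
        neg_mul]
      abel
  have h3 : LinearMap.mul' ℝ _ (TensorProduct.map (cobarPair C ∘ₗ redComul C ∘ₗ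
        parity (kerCounitDeg C)) (cobarι C) (redComul C x)) =
      LinearMap.mul' ℝ _ (TensorProduct.map (cobarι C) (cobarPair C ∘ₗ redComul C)
        (redComul C x)) := by
    have hl : ∀ t, LinearMap.mul' ℝ _ (TensorProduct.map (cobarι C)
        (cobarPair C ∘ₗ redComul C) t) =
        LinearMap.mul' ℝ _ (TensorProduct.map (cobarι C) (cobarPair C)
          ((redComul C).lTensor _ t)) := by
      intro t
      induction t using TensorProduct.induction_on with
      | zero => simp
      | add a b ha hb => simp only [map_add, ha, hb]
      | tmul a b => simp
    have hr : ∀ t, LinearMap.mul' ℝ _ (TensorProduct.map (cobarPair C ∘ₗ redComul C ∘ₗ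
        parity (kerCounitDeg C)) (cobarι C) t) =
        LinearMap.mul' ℝ _ (TensorProduct.map (cobarι C) (cobarPair C)
          (TensorProduct.assoc ℝ _ _ _ ((redComul C).rTensor _ t))) := by
      intro t
      induction t using TensorProduct.induction_on with
      | zero => simp
      | add a b ha hb => simp only [map_add, ha, hb]
      | tmul a b =>
        rw [TensorProduct.map_tmul, LinearMap.rTensor_tmul, LinearMap.comp_apply,
          LinearMap.comp_apply, redComul_parity]
        generalize redComul C a = s
        induction s using TensorProduct.induction_on with
        | zero => simp
        | add a b ha hb =>
          simp only [map_add, TensorProduct.add_tmul] at ha hb ⊢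
          rw [ha, hb]
        | tmul a c =>
          simp [cobarPair_tmul, parity_parity, mul_assoc]
    rw [hl, hr, redComul_coassoc]
  have h4 : kerCounitD C (kerCounitD C x) = 0 := Subtype.ext (C.d_d x)
  rw [cobarD_ι, cobarGen, LinearMap.sub_apply, map_sub, LinearMap.comp_apply, LinearMap.comp_apply,
    cobarD_ι, cobarGen, LinearMap.sub_apply, LinearMap.comp_apply, LinearMap.comp_apply, h4,
    map_zero, redComul_kerCounitD, map_add, h1, h2, h3]
  abel

/-- The cobar construction, as a differential graded algebra. -/
def cobar : DGA.{u} where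
  carrier := CobarAlg C
  deg := cobarDeg C
  d := cobarD C
  d_mem := fun _ _ => deriv_mem (cobarD_mul C) (cobarD_ι_mem C)
  d_d := deriv_deriv TensorAlgebra.adjoin_range_ι (cobarD_mul C) (cobarD_ι_mem C)
    (cobarD_cobarD_ι C)
  leibniz := by
    intro n x y hx
    rw [cobarD_mul, parity_apply _ hx, smul_mul_assoc]

end Cobar

section FreeLie

variable {V A : Type*} [AddCommGroup V] [Module ℝ V] [Ring A] [Algebra ℝ A]
  (𝒱 : ℤ → Submodule ℝ V) (ι : V →ₗ[ℝ] A) (𝒜 : ℤ → Submodule ℝ A) [GradedAlgebra 𝒜]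

/-- Iterated graded commutators of homogeneous elements of `V`, with their degree. -/
inductive IsLieWord : ℤ → A → Prop
  | gen {n : ℤ} {x : V} : x ∈ 𝒱 n → IsLieWord n (ι x)
  | bracket {i j : ℤ} {a b : A} : IsLieWord i a → IsLieWord j b →
      IsLieWord (i + j) (commutator 𝒜 a b)

/-- The graded Lie subalgebra of `A` generated by `V`: the span of the iterated commutators. -/
def lieSpan : Submodule ℝ A := Submodule.span ℝ {a | ∃ n, IsLieWord 𝒱 ι 𝒜 n a}

variable {𝒱 ι 𝒜}

theorem IsLieWord.mem_deg (hι : ∀ n x, x ∈ 𝒱 n → ι x ∈ 𝒜 n) {n : ℤ} {a : A}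
    (h : IsLieWord 𝒱 ι 𝒜 n a) : a ∈ 𝒜 n := by
  induction h with
  | gen hx => exact hι _ _ hx
  | bracket _ _ h1 h2 => exact commutator_mem 𝒜 h1 h2

theorem lieSpan_component (hι : ∀ n x, x ∈ 𝒱 n → ι x ∈ 𝒜 n) (a : A) (ha : a ∈ lieSpan 𝒱 ι 𝒜)
    (n : ℤ) : (DirectSum.decompose 𝒜 a n : A) ∈ lieSpan 𝒱 ι 𝒜 := by
  induction ha using Submodule.span_induction with
  | mem a h =>
    obtain ⟨m, h⟩ := h
    rcases eq_or_ne m n with rfl | hmn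
    · rw [DirectSum.decompose_of_mem_same _ (h.mem_deg hι)]
      exact Submodule.subset_span ⟨m, h⟩
    · rw [DirectSum.decompose_of_mem_ne _ (h.mem_deg hι) hmn]
      exact zero_mem _
  | zero => simp
  | add a b _ _ ha hb =>
    rw [DirectSum.decompose_add, DirectSum.add_apply, Submodule.coe_add]
    exact add_mem ha hb
  | smul c a _ ha =>
    rw [DirectSum.decompose_smul]
    exact Submodule.smul_mem _ c ha

theorem commutator_mem_lieSpan {a b : A} (ha : a ∈ lieSpan 𝒱 ι 𝒜) (hb : b ∈ lieSpan 𝒱 ι 𝒜) :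
    commutator 𝒜 a b ∈ lieSpan 𝒱 ι 𝒜 := by
  induction ha using Submodule.span_induction with
  | mem a h =>
    induction hb using Submodule.span_induction with
    | mem b h' =>
      obtain ⟨m, h⟩ := h
      obtain ⟨n, h'⟩ := h'
      exact Submodule.subset_span ⟨_, h.bracket h'⟩
    | zero => simp
    | add x y _ _ hx hy => rw [map_add]; exact add_mem hx hy
    | smul c x _ hx => rw [map_smul]; exact Submodule.smul_mem _ c hx
  | zero => simp
  | add x y _ _ hx hy => rw [map_add]; exact add_mem hx hy
  | smul c x _ hx => rw [map_smul]; exact Submodule.smul_mem _ c hx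

theorem lieSpan_le (hι : ∀ n x, x ∈ 𝒱 n → ι x ∈ 𝒜 n) [DirectSum.Decomposition 𝒱]
    (P : Submodule ℝ A) (hg : ∀ x, ι x ∈ P)
    (hb : ∀ i j a b, a ∈ 𝒜 i → b ∈ 𝒜 j → a ∈ lieSpan 𝒱 ι 𝒜 → b ∈ lieSpan 𝒱 ι 𝒜 → a ∈ P → b ∈ P →
      commutator 𝒜 a b ∈ P) : lieSpan 𝒱 ι 𝒜 ≤ P := by
  refine Submodule.span_le.2 ?_
  rintro a ⟨n, h⟩
  change a ∈ P
  induction h with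
  | gen hx => exact hg _
  | bracket h h' ih ih' =>
    exact hb _ _ _ _ (h.mem_deg hι) (h'.mem_deg hι) (Submodule.subset_span ⟨_, h⟩)
      (Submodule.subset_span ⟨_, h'⟩) ih ih'

theorem ι_mem_lieSpan [DirectSum.Decomposition 𝒱] (x : V) : ι x ∈ lieSpan 𝒱 ι 𝒜 := by
  induction x using deg_induction 𝒱 with
  | h0 => simp
  | hadd x y hx hy => rw [map_add]; exact add_mem hx hy
  | hd n x hx => exact Submodule.subset_span ⟨n, IsLieWord.gen hx⟩

end FreeLie

/-- The graded Lie subalgebra of the tensor algebra of `u C̄` generated by `u C̄`, that is, the free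
graded Lie algebra on `u C̄`. -/
def freeLie (C : DGCCa.{u}) : Submodule ℝ (CobarAlg C) :=
  lieSpan (desusp (kerCounitDeg C)) (cobarι C) (cobarDeg C)

theorem cobarPair_mem_freeLie (C : DGCCa.{u}) (t : kerCounit C ⊗[ℝ] kerCounit C)
    (ht : gradedSwap (kerCounitDeg C) t = t) : cobarPair C t ∈ freeLie C := by
  let b : kerCounit C ⊗[ℝ] kerCounit C →ₗ[ℝ] CobarAlg C := TensorProduct.lift
    ((commutator (cobarDeg C)).compl₁₂ (cobarι C ∘ₗ parity (kerCounitDeg C)) (cobarι C))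
  have h1 : cobarPair C ∘ₗ (LinearMap.id + gradedSwap (kerCounitDeg C)) = b := by
    apply tensor_ext_deg (kerCounitDeg C) (kerCounitDeg C)
    intro i j x y hx hy
    rw [LinearMap.comp_apply, LinearMap.add_apply, LinearMap.id_apply, gradedSwap_tmul _ hx hy,
      map_add, map_smul, cobarPair_tmul, cobarPair_tmul, TensorProduct.lift.tmul,
      LinearMap.compl₁₂_apply, LinearMap.comp_apply, parity_apply _ hx, parity_apply _ hy, map_smul,
      map_smul, map_smul, LinearMap.smul_apply,
      commutator_apply _ (cobarι_mem C hx) (cobarι_mem C hy), add_mul, mul_add, sgn_add, sgn_add,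
      mul_one, one_mul, sgn_add_one, smul_mul_assoc, smul_mul_assoc]
    rcases sgn_eq i with ⟨-, h⟩ | ⟨-, h⟩ <;> rw [h] <;> module
  have h2 : ∀ t, b t ∈ freeLie C := by
    intro t
    induction t using TensorProduct.induction_on with
    | zero => rw [map_zero]; exact zero_mem _
    | add x y hx hy => rw [map_add]; exact add_mem hx hy
    | tmul x y => exact commutator_mem_lieSpan (ι_mem_lieSpan _) (ι_mem_lieSpan _)
  have h3 : cobarPair C t = (1 / 2 : ℝ) • b t := by
    rw [← h1, LinearMap.comp_apply, LinearMap.add_apply, ht, LinearMap.id_apply, map_add]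
    module
  rw [h3]
  exact Submodule.smul_mem _ _ (h2 t)

theorem cobarD_mem_freeLie (C : DGCCa.{u}) (a : CobarAlg C) (ha : a ∈ freeLie C) :
    cobarD C a ∈ freeLie C := by
  refine lieSpan_le (fun n x hx => gen_mem hx) ((freeLie C).comap (cobarD C)) ?_ ?_ ha
  · intro x
    change cobarD C (cobarι C x) ∈ freeLie C
    rw [cobarD_ι]
    exact sub_mem (ι_mem_lieSpan _) (cobarPair_mem_freeLie C _ (redComul_cocomm C x))
  · intro i j a b ha hb hal hbl hda hdb
    change cobarD C (commutator (cobarDeg C) a b) ∈ freeLie C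
    rw [commutator_leibniz (cobarDeg C) (d := cobarD C) (cobar C).d_mem (cobar C).leibniz ha hb]
    exact add_mem (commutator_mem_lieSpan hda hbl)
      (Submodule.smul_mem _ _ (commutator_mem_lieSpan hal hdb))

instance freeLieDecomposition (C : DGCCa.{u}) :
    DirectSum.Decomposition (subDeg (cobarDeg C) (freeLie C)) :=
  subDecomposition (cobarDeg C) (freeLie C) (lieSpan_component fun _ _ hx => gen_mem hx)

/-- The differential graded Lie algebra `L(C)`: the free graded Lie algebra on `u C̄`, with the
restriction of the cobar differential. -/
def LObj (C : DGCCa.{u}) : DGLA.{u} where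
  carrier := freeLie C
  deg := subDeg (cobarDeg C) (freeLie C)
  d := (cobarD C).restrict (cobarD_mem_freeLie C)
  bracket := LinearMap.mk₂ ℝ
    (fun x y => ⟨commutator (cobarDeg C) x y, commutator_mem_lieSpan x.2 y.2⟩)
    (fun x y z => Subtype.ext (by simp)) (fun c x y => Subtype.ext (by simp))
    (fun x y z => Subtype.ext (by simp)) (fun c x y => Subtype.ext (by simp))
  d_mem := fun n x hx => (cobar C).d_mem n x.1 hx
  d_d := fun x => Subtype.ext ((cobar C).d_d x.1)
  bracket_mem := fun i j x y hx hy => (SigmaDG.obj (cobar C)).bracket_mem i j x.1 y.1 hx hy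
  skew := fun i j x y hx hy => Subtype.ext ((SigmaDG.obj (cobar C)).skew i j x.1 y.1 hx hy)
  jacobi := fun i j x y z hx hy =>
    Subtype.ext ((SigmaDG.obj (cobar C)).jacobi i j x.1 y.1 z.1 hx hy)
  leibniz := fun n x y hx => Subtype.ext ((SigmaDG.obj (cobar C)).leibniz n x.1 y.1 hx)

section LMap

variable {C D : DGCCa.{u}} (f : C ⟶ D)

theorem DGCCa.Hom.counit_apply (x : C.carrier) :
    Coalgebra.counit (R := ℝ) (f.toCoalgHom x) = Coalgebra.counit (R := ℝ) x :=
  LinearMap.congr_fun f.toCoalgHom.counit_comp x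

theorem DGCCa.Hom.comul_apply (x : C.carrier) :
    Coalgebra.comul (R := ℝ) (f.toCoalgHom x) =
      TensorProduct.map f.toCoalgHom.toLinearMap f.toCoalgHom.toLinearMap
        (Coalgebra.comul (R := ℝ) x) :=
  (LinearMap.congr_fun f.toCoalgHom.map_comp_comul x).symm

/-- The restriction of a morphism to the kernels of the co-units. -/
def kerCounitMap : kerCounit C →ₗ[ℝ] kerCounit D :=
  f.toCoalgHom.toLinearMap.restrict (p := kerCounit C) (q := kerCounit D) fun x hx =>
    (DGCCa.Hom.counit_apply f x).trans hx

theorem kerCounitMap_mem (n : ℤ) (x : kerCounit C) (hx : x ∈ kerCounitDeg C n) :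
    kerCounitMap f x ∈ kerCounitDeg D n := f.map_deg n x hx

theorem kerCounitMap_proj (x : C.carrier) :
    kerCounitMap f (kerCounitProj C x) = kerCounitProj D (f.toCoalgHom x) := by
  apply Subtype.ext
  change f.toCoalgHom (kerCounitProj C x : C.carrier) = _
  rw [coe_kerCounitProj, coe_kerCounitProj, map_sub, map_smul, f.map_coaug,
    DGCCa.Hom.counit_apply]

theorem redComul_kerCounitMap (x : kerCounit C) : redComul D (kerCounitMap f x) =
    TensorProduct.map (kerCounitMap f) (kerCounitMap f) (redComul C x) := by
  rw [← kerCounitProj_coe C x, kerCounitMap_proj, redComul_kerCounitProj, redComul_kerCounitProj,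
    DGCCa.Hom.comul_apply]
  generalize Coalgebra.comul (R := ℝ) (x : C.carrier) = t
  induction t using TensorProduct.induction_on with
  | zero => simp
  | add a b ha hb => simp only [map_add, ha, hb]
  | tmul a b =>
    simp only [TensorProduct.map_tmul, kerCounitMap_proj]
    rfl

/-- The morphism of tensor algebras induced by a morphism of coalgebras. -/
def cobarMap : CobarAlg C →ₐ[ℝ] CobarAlg D :=
  TensorAlgebra.lift ℝ (cobarι D ∘ₗ kerCounitMap f)

theorem cobarMap_ι (x : kerCounit C) : cobarMap f (cobarι C x) = cobarι D (kerCounitMap f x) :=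
  TensorAlgebra.lift_ι_apply _ x

theorem cobarMap_mem (n : ℤ) (a : CobarAlg C) (ha : a ∈ cobarDeg C n) :
    cobarMap f a ∈ cobarDeg D n :=
  algHom_mem_wordDeg (cobarMap f) (kerCounitMap f) (fun n x hx => kerCounitMap_mem f (n + -1) x hx)
    (cobarMap_ι f) n a ha

theorem cobarMap_cobarD (a : CobarAlg C) : cobarMap f (cobarD C a) = cobarD D (cobarMap f a) := by
  refine algHom_deriv (𝒱 := desusp (kerCounitDeg C)) (𝒲 := desusp (kerCounitDeg D)) (cobarMap f)
    (kerCounitMap f) (fun n x hx => kerCounitMap_mem f (n + -1) x hx) (cobarMap_ι f)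
    TensorAlgebra.adjoin_range_ι (cobarD_mul C) (cobarD_mul D) ?_ a
  intro x
  have h1 : kerCounitMap f (kerCounitD C x) = kerCounitD D (kerCounitMap f x) :=
    Subtype.ext (f.map_d x)
  rw [cobarD_ι, cobarD_ι, cobarGen, cobarGen, LinearMap.sub_apply, LinearMap.sub_apply, map_sub,
    LinearMap.comp_apply, LinearMap.comp_apply, LinearMap.comp_apply, LinearMap.comp_apply,
    cobarMap_ι, h1, redComul_kerCounitMap]
  congr 1
  generalize redComul C x = t
  induction t using TensorProduct.induction_on with
  | zero => simp
  | add a b ha hb => simp only [map_add, ha, hb]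
  | tmul a b =>
    rw [TensorProduct.map_tmul, cobarPair_tmul, cobarPair_tmul, map_mul, cobarMap_ι, cobarMap_ι,
      map_parity (𝒲 := kerCounitDeg D) (kerCounitMap f) (kerCounitMap_mem f)]

theorem cobarMap_commutator (a b : CobarAlg C) :
    cobarMap f (commutator (cobarDeg C) a b) =
      commutator (cobarDeg D) (cobarMap f a) (cobarMap f b) :=
  let F : cobar C ⟶ cobar D := ⟨cobarMap f, cobarMap_mem f, cobarMap_cobarD f⟩
  (SigmaDG.map F).map_bracket a b

theorem cobarMap_mem_freeLie (a : CobarAlg C) (ha : a ∈ freeLie C) : cobarMap f a ∈ freeLie D := by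
  refine lieSpan_le (fun n x hx => gen_mem hx) ((freeLie D).comap (cobarMap f).toLinearMap) ?_ ?_ ha
  · intro x
    change cobarMap f (cobarι C x) ∈ freeLie D
    rw [cobarMap_ι]
    exact ι_mem_lieSpan _
  · intro i j a b _ _ _ _ ha hb
    change cobarMap f (commutator (cobarDeg C) a b) ∈ freeLie D
    rw [cobarMap_commutator]
    exact commutator_mem_lieSpan ha hb

end LMap

/-- The Lie functor `L : DGCCₐ → DGLA`. -/
def L : DGCCa.{u} ⥤ DGLA.{u} where
  obj := LObj
  map {C D} f :=
    { toLinearMap := (cobarMap f).toLinearMap.restrict (cobarMap_mem_freeLie f)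
      map_deg := fun n x hx => cobarMap_mem f n x.1 hx
      map_d := fun x => Subtype.ext (cobarMap_cobarD f x.1)
      map_bracket := fun x y => Subtype.ext (cobarMap_commutator f x.1 y.1) }
  map_id C := by
    refine DGLA.Hom.ext (LinearMap.ext fun x => Subtype.ext ?_)
    have : cobarMap (𝟙 C) = AlgHom.id ℝ _ := TensorAlgebra.hom_ext (LinearMap.ext fun x =>
      cobarMap_ι (𝟙 C) x)
    exact DFunLike.congr_fun this x.1
  map_comp {C D E} f g := by
    refine DGLA.Hom.ext (LinearMap.ext fun x => Subtype.ext ?_)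
    have : cobarMap (f ≫ g) = (cobarMap g).comp (cobarMap f) :=
      TensorAlgebra.hom_ext (LinearMap.ext fun x => (cobarMap_ι (f ≫ g) x).trans
        ((congrArg (cobarMap g) (cobarMap_ι f x)).trans (cobarMap_ι g _)).symm)
    exact DFunLike.congr_fun this x.1

/-! ### The symmetric coalgebra -/

section Sym

variable {V : Type*} [AddCommGroup V] [Module ℝ V] (𝒱 : ℤ → Submodule ℝ V)
  [DirectSum.Decomposition 𝒱]

/-- The operator `y ↦ (-1)^{i|y|} y`. -/
def koszul (i : ℤ) : V →ₗ[ℝ] V := if Even i then LinearMap.id else parity 𝒱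

theorem koszul_apply (i : ℤ) {j : ℤ} {y : V} (hy : y ∈ 𝒱 j) :
    koszul 𝒱 i y = sgn (i * j) • y := by
  by_cases hi : Even i
  · rw [koszul, if_pos hi, sgn_even (hi.mul_right j), one_smul]
    rfl
  · rw [koszul, if_neg hi, parity_apply 𝒱 hy]
    rw [Int.not_even_iff_odd] at hi
    rcases sgn_eq j with ⟨hj, h⟩ | ⟨hj, h⟩
    · rw [h, sgn_even (hj.mul_left i)]
    · rw [h, sgn_odd (hi.mul hj)]

/-- The graded symmetric algebra of a graded vector space: the quotient of the tensor algebra by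
the relations `x y = (-1)^{|x||y|} y x`. -/
abbrev Sym : Type _ := Env 𝒱 0

/-- The inclusion of the generators. -/
abbrev symι : V →ₗ[ℝ] Sym 𝒱 := Env.ι 𝒱 0

/-- The grading of the symmetric algebra by total degree. -/
abbrev symDeg : ℤ → Submodule ℝ (Sym 𝒱) := wordDeg 𝒱 (symι 𝒱)

instance symGraded : GradedAlgebra (symDeg 𝒱) :=
  Env.gradedAlgebra fun _ _ _ _ _ _ => zero_mem _

variable {𝒱} in
theorem symι_comm {i j : ℤ} {x y : V} (hx : x ∈ 𝒱 i) (hy : y ∈ 𝒱 j) :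
    symι 𝒱 x * symι 𝒱 y = sgn (i * j) • (symι 𝒱 y * symι 𝒱 x) := by
  have := Env.ι_mul_ι (b := 0) hx hy
  rwa [LinearMap.zero_apply, LinearMap.zero_apply, map_zero, add_zero] at this

theorem gradedTensor_mul {A : Type*} [Ring A] [Algebra ℝ A] (𝒜 : ℤ → Submodule ℝ A)
    [GradedAlgebra 𝒜] {j i : ℤ} (a b a' b' : A) (hb : b ∈ 𝒜 j) (ha' : a' ∈ 𝒜 i) :
    GradedTensorProduct.tmul ℝ (𝒜 := 𝒜) (ℬ := 𝒜) a b * GradedTensorProduct.tmul ℝ a' b' =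
      sgn (j * i) • GradedTensorProduct.tmul ℝ (a * a') (b * b') := by
  rw [← uzpow_smul]
  exact GradedTensorProduct.tmul_coe_mul_coe_tmul 𝒜 𝒜 a ⟨b, hb⟩ ⟨a', ha'⟩ b'

/-- The comultiplication of the symmetric coalgebra as a morphism of algebras into the graded
tensor product: it is determined by `Δ(x) = x ⊗ 1 + 1 ⊗ x` for `x ∈ V`. -/
def symComulAlg : Sym 𝒱 →ₐ[ℝ] symDeg 𝒱 ᵍ⊗[ℝ] symDeg 𝒱 :=
  Env.lift
    ((GradedTensorProduct.of ℝ (symDeg 𝒱) (symDeg 𝒱)).toLinearMap ∘ₗ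
      ((TensorProduct.mk ℝ (Sym 𝒱) (Sym 𝒱)).flip 1 + TensorProduct.mk ℝ (Sym 𝒱) (Sym 𝒱) 1) ∘ₗ
        symι 𝒱) (by
    intro i j x y hx hy
    have hx' : symι 𝒱 x ∈ symDeg 𝒱 i := gen_mem hx
    have hy' : symι 𝒱 y ∈ symDeg 𝒱 j := gen_mem hy
    have h1 : (1 : Sym 𝒱) ∈ symDeg 𝒱 0 := SetLike.GradedOne.one_mem
    have e : ∀ z : V, ((GradedTensorProduct.of ℝ (symDeg 𝒱) (symDeg 𝒱)).toLinearMap ∘ₗ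
      ((TensorProduct.mk ℝ (Sym 𝒱) (Sym 𝒱)).flip 1 + TensorProduct.mk ℝ (Sym 𝒱) (Sym 𝒱) 1) ∘ₗ
        symι 𝒱) z = GradedTensorProduct.tmul ℝ (symι 𝒱 z) 1 +
          GradedTensorProduct.tmul ℝ 1 (symι 𝒱 z) := fun z => by
      change GradedTensorProduct.of ℝ (symDeg 𝒱) (symDeg 𝒱) (symι 𝒱 z ⊗ₜ 1 + 1 ⊗ₜ symι 𝒱 z) = _
      rw [map_add]
    rw [LinearMap.zero_apply, LinearMap.zero_apply, map_zero, add_zero, e, e]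
    simp only [mul_add, add_mul]
    rw [gradedTensor_mul _ _ _ _ _ h1 hy', gradedTensor_mul _ _ _ _ _ hx' hy',
      gradedTensor_mul _ _ _ _ _ h1 h1, gradedTensor_mul _ _ _ _ _ hx' h1,
      gradedTensor_mul _ _ _ _ _ h1 hx', gradedTensor_mul _ _ _ _ _ hy' hx',
      gradedTensor_mul _ _ _ _ _ h1 h1, gradedTensor_mul _ _ _ _ _ hy' h1]
    simp only [mul_one, one_mul, zero_mul, mul_zero, sgn_zero, one_smul]
    have h2 : symι 𝒱 x * symι 𝒱 y = _ := symι_comm hx hy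
    have h3 : ∀ (c : ℝ) (z : Sym 𝒱), GradedTensorProduct.tmul ℝ (𝒜 := symDeg 𝒱) (ℬ := symDeg 𝒱)
        (c • z) 1 = c • GradedTensorProduct.tmul ℝ z 1 := fun c z => by
      rw [GradedTensorProduct.tmul, ← TensorProduct.smul_tmul', map_smul]
    have h4 : ∀ (c : ℝ) (z : Sym 𝒱), GradedTensorProduct.tmul ℝ (𝒜 := symDeg 𝒱) (ℬ := symDeg 𝒱)
        1 (c • z) = c • GradedTensorProduct.tmul ℝ 1 z := fun c z => by
      rw [GradedTensorProduct.tmul, TensorProduct.tmul_smul, map_smul]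
    rw [h2, h3, h4, mul_comm j i]
    simp only [smul_add, smul_smul, sgn_mul_self, one_smul]
    abel)

/-- The comultiplication of the symmetric coalgebra. -/
def symComul : Sym 𝒱 →ₗ[ℝ] Sym 𝒱 ⊗[ℝ] Sym 𝒱 :=
  (GradedTensorProduct.of ℝ (symDeg 𝒱) (symDeg 𝒱)).symm.toLinearMap ∘ₗ (symComulAlg 𝒱).toLinearMap

/-- The co-unit of the symmetric coalgebra: the projection onto the words of length zero. -/
def symCounit : Sym 𝒱 →ₐ[ℝ] ℝ := Env.lift 0 (by simp)

theorem symCounit_ι (x : V) : symCounit 𝒱 (symι 𝒱 x) = 0 := Env.lift_ι _ _ x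

theorem symComul_one : symComul 𝒱 1 = 1 ⊗ₜ 1 := by
  rw [symComul, LinearMap.comp_apply, AlgHom.toLinearMap_apply, map_one]
  rfl

theorem symComul_ι_mul {i : ℤ} {x : V} (hx : x ∈ 𝒱 i) (a : Sym 𝒱) :
    symComul 𝒱 (symι 𝒱 x * a) =
      TensorProduct.map (LinearMap.mulLeft ℝ (symι 𝒱 x)) LinearMap.id (symComul 𝒱 a) +
      TensorProduct.map (koszul (symDeg 𝒱) i) (LinearMap.mulLeft ℝ (symι 𝒱 x))
        (symComul 𝒱 a) := by
  have hx' : symι 𝒱 x ∈ symDeg 𝒱 i := gen_mem hx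
  have h1 : (1 : Sym 𝒱) ∈ symDeg 𝒱 0 := SetLike.GradedOne.one_mem
  have e : symComulAlg 𝒱 (symι 𝒱 x) = GradedTensorProduct.tmul ℝ (symι 𝒱 x) 1 +
      GradedTensorProduct.tmul ℝ 1 (symι 𝒱 x) := (Env.lift_ι _ _ x).trans
      (map_add (GradedTensorProduct.of ℝ (symDeg 𝒱) (symDeg 𝒱)) (symι 𝒱 x ⊗ₜ 1) (1 ⊗ₜ symι 𝒱 x))
  have key : ∀ t : Sym 𝒱 ⊗[ℝ] Sym 𝒱,
      (GradedTensorProduct.tmul ℝ (symι 𝒱 x) 1 + GradedTensorProduct.tmul ℝ 1 (symι 𝒱 x)) *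
        GradedTensorProduct.of ℝ (symDeg 𝒱) (symDeg 𝒱) t =
      GradedTensorProduct.of ℝ (symDeg 𝒱) (symDeg 𝒱)
        (TensorProduct.map (LinearMap.mulLeft ℝ (symι 𝒱 x)) LinearMap.id t +
          TensorProduct.map (koszul (symDeg 𝒱) i) (LinearMap.mulLeft ℝ (symι 𝒱 x)) t) := by
    intro t
    suffices h : GradedTensorProduct.mulHom (symDeg 𝒱) (symDeg 𝒱)
        (GradedTensorProduct.tmul ℝ (symι 𝒱 x) 1 +
          GradedTensorProduct.tmul ℝ 1 (symι 𝒱 x)) ∘ₗ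
          (GradedTensorProduct.of ℝ (symDeg 𝒱) (symDeg 𝒱)).toLinearMap =
        (GradedTensorProduct.of ℝ (symDeg 𝒱) (symDeg 𝒱)).toLinearMap ∘ₗ
          (TensorProduct.map (LinearMap.mulLeft ℝ (symι 𝒱 x)) LinearMap.id +
          TensorProduct.map (koszul (symDeg 𝒱) i) (LinearMap.mulLeft ℝ (symι 𝒱 x))) from
      LinearMap.congr_fun h t
    apply tensor_ext_deg (symDeg 𝒱) (symDeg 𝒱)
    intro j k b c hb hc
    change (GradedTensorProduct.tmul ℝ (symι 𝒱 x) 1 + GradedTensorProduct.tmul ℝ 1 (symι 𝒱 x)) *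
        GradedTensorProduct.tmul ℝ b c = GradedTensorProduct.of ℝ (symDeg 𝒱) (symDeg 𝒱)
          ((symι 𝒱 x * b) ⊗ₜ c + koszul (symDeg 𝒱) i b ⊗ₜ (symι 𝒱 x * c))
    rw [add_mul, gradedTensor_mul _ _ _ _ _ h1 hb, gradedTensor_mul _ _ _ _ _ hx' hb,
      koszul_apply _ i hb, map_add, ← TensorProduct.smul_tmul', map_smul, zero_mul, sgn_zero,
      one_smul, one_mul, one_mul]
  have hs : symComulAlg 𝒱 a =
      GradedTensorProduct.of ℝ (symDeg 𝒱) (symDeg 𝒱) (symComul 𝒱 a) := rfl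
  change (GradedTensorProduct.of ℝ (symDeg 𝒱) (symDeg 𝒱)).symm
    (symComulAlg 𝒱 (symι 𝒱 x * a)) = _
  rw [map_mul, e, hs, key]
  rfl

theorem koszul_mem (i : ℤ) {j : ℤ} {y : V} (hy : y ∈ 𝒱 j) : koszul 𝒱 i y ∈ 𝒱 j := by
  rw [koszul_apply 𝒱 i hy]
  exact Submodule.smul_mem _ _ hy

theorem symComul_mem (n : ℤ) (a : Sym 𝒱) (ha : a ∈ symDeg 𝒱 n) :
    symComul 𝒱 a ∈ tensorDeg (symDeg 𝒱) (symDeg 𝒱) n := by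
  refine wordDeg_le ((tensorDeg (symDeg 𝒱) (symDeg 𝒱) n).comap (symComul 𝒱)) (fun a ha => ?_) ha
  clear * - ha
  change symComul 𝒱 a ∈ tensorDeg (symDeg 𝒱) (symDeg 𝒱) n
  induction ha with
  | one =>
    rw [symComul_one]
    exact tmul_mem_tensorDeg (add_zero 0) SetLike.GradedOne.one_mem SetLike.GradedOne.one_mem
  | @cons i n x a hx h ih =>
    have hx' : symι 𝒱 x ∈ symDeg 𝒱 i := gen_mem hx
    rw [symComul_ι_mul 𝒱 hx]
    refine add_mem ?_ ?_
    · refine map_mem_of_tensorDeg _ _ (fun j k b c hjk hb hc => ?_) ih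
      exact tmul_mem_tensorDeg (by omega) (SetLike.GradedMul.mul_mem hx' hb) hc
    · refine map_mem_of_tensorDeg _ _ (fun j k b c hjk hb hc => ?_) ih
      exact tmul_mem_tensorDeg (by omega) (koszul_mem _ i hb) (SetLike.GradedMul.mul_mem hx' hc)

theorem symCounit_of_ne (n : ℤ) (a : Sym 𝒱) (ha : a ∈ symDeg 𝒱 n) (hn : n ≠ 0) :
    symCounit 𝒱 a = 0 := by
  refine wordDeg_le (LinearMap.ker (symCounit 𝒱).toLinearMap) (fun a ha => ?_) ha
  clear * - ha hn
  change symCounit 𝒱 a = 0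
  cases ha with
  | one => exact absurd rfl hn
  | cons _ _ => rw [map_mul, symCounit_ι, zero_mul]

theorem symCounit_koszul (i : ℤ) (a : Sym 𝒱) :
    symCounit 𝒱 (koszul (symDeg 𝒱) i a) = symCounit 𝒱 a := by
  induction a using deg_induction (symDeg 𝒱) with
  | h0 => simp
  | hadd x y hx hy => rw [map_add, map_add, hx, hy, map_add]
  | hd n x hx =>
    rw [koszul_apply _ i hx, map_smul]
    rcases eq_or_ne n 0 with rfl | hn
    · rw [mul_zero, sgn_zero, one_smul]
    · rw [symCounit_of_ne 𝒱 n x hx hn, smul_zero]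

theorem symComul_koszul (i : ℤ) (a : Sym 𝒱) : symComul 𝒱 (koszul (symDeg 𝒱) i a) =
    TensorProduct.map (koszul (symDeg 𝒱) i) (koszul (symDeg 𝒱) i) (symComul 𝒱 a) := by
  suffices symComul 𝒱 ∘ₗ koszul (symDeg 𝒱) i =
      TensorProduct.map (koszul (symDeg 𝒱) i) (koszul (symDeg 𝒱) i) ∘ₗ symComul 𝒱 from
    LinearMap.congr_fun this a
  apply hom_ext_deg (symDeg 𝒱)
  intro n x hx
  rw [LinearMap.comp_apply, LinearMap.comp_apply, koszul_apply _ i hx, map_smul]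
  have := map_mem_of_tensorDeg (LinearMap.ker (sgn (i * n) • LinearMap.id -
    TensorProduct.map (koszul (symDeg 𝒱) i) (koszul (symDeg 𝒱) i))) LinearMap.id (by
      intro j k x y h hx hy
      rw [LinearMap.mem_ker, LinearMap.id_apply, LinearMap.sub_apply, TensorProduct.map_tmul,
        koszul_apply _ i hx, koszul_apply _ i hy, TensorProduct.smul_tmul_smul, ← h, mul_add,
        sgn_add]
      exact sub_self _) (symComul_mem 𝒱 n x hx)
  exact sub_eq_zero.1 this

theorem symComul_coassoc (a : Sym 𝒱) :
    TensorProduct.assoc ℝ _ _ _ ((symComul 𝒱).rTensor _ (symComul 𝒱 a)) =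
      (symComul 𝒱).lTensor _ (symComul 𝒱 a) := by
  refine word_induction (𝒱 := 𝒱) (Env.adjoin_ι 𝒱 0) (LinearMap.eqLocus
    ((TensorProduct.assoc ℝ _ _ _).toLinearMap ∘ₗ (symComul 𝒱).rTensor _ ∘ₗ symComul 𝒱)
    ((symComul 𝒱).lTensor _ ∘ₗ symComul 𝒱)) ?_ ?_ a
  · change TensorProduct.assoc ℝ _ _ _ ((symComul 𝒱).rTensor _ (symComul 𝒱 1)) =
      (symComul 𝒱).lTensor _ (symComul 𝒱 1)
    simp [symComul_one]
  · intro i x a hx ha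
    change TensorProduct.assoc ℝ _ _ _ ((symComul 𝒱).rTensor _ (symComul 𝒱 a)) =
      (symComul 𝒱).lTensor _ (symComul 𝒱 a) at ha
    change TensorProduct.assoc ℝ _ _ _ ((symComul 𝒱).rTensor _ (symComul 𝒱 (symι 𝒱 x * a))) =
      (symComul 𝒱).lTensor _ (symComul 𝒱 (symι 𝒱 x * a))
    let l : Sym 𝒱 →ₗ[ℝ] Sym 𝒱 := LinearMap.mulLeft ℝ (symι 𝒱 x)
    let k : Sym 𝒱 →ₗ[ℝ] Sym 𝒱 := koszul (symDeg 𝒱) i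
    let R : Sym 𝒱 ⊗[ℝ] (Sym 𝒱 ⊗[ℝ] Sym 𝒱) →ₗ[ℝ] Sym 𝒱 ⊗[ℝ] (Sym 𝒱 ⊗[ℝ] Sym 𝒱) :=
      TensorProduct.map l LinearMap.id + TensorProduct.map k (TensorProduct.map l LinearMap.id)
        + TensorProduct.map k (TensorProduct.map k l)
    have hl : ∀ t, (symComul 𝒱).lTensor _
        (TensorProduct.map l LinearMap.id t + TensorProduct.map k l t) =
        R ((symComul 𝒱).lTensor _ t) := by
      intro t
      induction t using TensorProduct.induction_on with
      | zero => simp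
      | add b c hb hc =>
        simp only [map_add] at hb hc ⊢
        rw [← hb, ← hc]
        abel
      | tmul b c =>
        simp only [map_add, TensorProduct.map_tmul, LinearMap.lTensor_tmul, LinearMap.id_apply, R,
          LinearMap.add_apply, l, LinearMap.mulLeft_apply, symComul_ι_mul 𝒱 hx,
          TensorProduct.tmul_add, k]
        abel
    have hr : ∀ t, TensorProduct.assoc ℝ _ _ _ ((symComul 𝒱).rTensor _
        (TensorProduct.map l LinearMap.id t + TensorProduct.map k l t)) =
        R (TensorProduct.assoc ℝ _ _ _ ((symComul 𝒱).rTensor _ t)) := by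
      intro t
      induction t using TensorProduct.induction_on with
      | zero => simp
      | add b c hb hc =>
        simp only [map_add] at hb hc ⊢
        rw [← hb, ← hc]
        abel
      | tmul b c =>
        simp only [map_add, TensorProduct.map_tmul, LinearMap.rTensor_tmul, LinearMap.id_apply,
          l, LinearMap.mulLeft_apply, symComul_ι_mul 𝒱 hx, TensorProduct.add_tmul, k,
          symComul_koszul]
        generalize symComul 𝒱 b = s
        induction s using TensorProduct.induction_on with
        | zero => simp
        | add b c hb hc =>
          simp only [map_add, TensorProduct.add_tmul] at hb hc ⊢
          rw [← hb, ← hc]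
          abel
        | tmul b d => simp [R, l, k]
    rw [symComul_ι_mul 𝒱 hx]
    exact (hr _).trans ((congrArg R ha).trans (hl _).symm)

theorem symCounit_rTensor (a : Sym 𝒱) :
    (symCounit 𝒱).toLinearMap.rTensor _ (symComul 𝒱 a) = 1 ⊗ₜ a := by
  refine word_induction (𝒱 := 𝒱) (Env.adjoin_ι 𝒱 0) (LinearMap.eqLocus
    ((symCounit 𝒱).toLinearMap.rTensor _ ∘ₗ symComul 𝒱) (TensorProduct.mk ℝ _ _ 1)) ?_ ?_ a
  · change (symCounit 𝒱).toLinearMap.rTensor _ (symComul 𝒱 1) = 1 ⊗ₜ 1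
    simp [symComul_one]
  · intro i x a hx ha
    change (symCounit 𝒱).toLinearMap.rTensor _ (symComul 𝒱 a) = 1 ⊗ₜ a at ha
    change (symCounit 𝒱).toLinearMap.rTensor _ (symComul 𝒱 (symι 𝒱 x * a)) = 1 ⊗ₜ (symι 𝒱 x * a)
    have h : ∀ t, (symCounit 𝒱).toLinearMap.rTensor (Sym 𝒱)
        (TensorProduct.map (LinearMap.mulLeft ℝ (symι 𝒱 x)) LinearMap.id t +
          TensorProduct.map (koszul (symDeg 𝒱) i) (LinearMap.mulLeft ℝ (symι 𝒱 x)) t) =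
        (LinearMap.mulLeft ℝ (symι 𝒱 x)).lTensor _
          ((symCounit 𝒱).toLinearMap.rTensor _ t) := by
      intro t
      induction t using TensorProduct.induction_on with
      | zero => simp
      | add b c hb hc =>
        simp only [map_add] at hb hc ⊢
        rw [← hb, ← hc]
        abel
      | tmul b c => simp [symCounit_ι, symCounit_koszul]
    rw [symComul_ι_mul 𝒱 hx, h, ha]
    rfl

theorem symCounit_lTensor (a : Sym 𝒱) :
    (symCounit 𝒱).toLinearMap.lTensor _ (symComul 𝒱 a) = a ⊗ₜ 1 := by
  refine word_induction (𝒱 := 𝒱) (Env.adjoin_ι 𝒱 0) (LinearMap.eqLocus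
    ((symCounit 𝒱).toLinearMap.lTensor _ ∘ₗ symComul 𝒱) ((TensorProduct.mk ℝ _ _).flip 1)) ?_ ?_ a
  · change (symCounit 𝒱).toLinearMap.lTensor _ (symComul 𝒱 1) = 1 ⊗ₜ 1
    simp [symComul_one]
  · intro i x a hx ha
    change (symCounit 𝒱).toLinearMap.lTensor _ (symComul 𝒱 a) = a ⊗ₜ 1 at ha
    change (symCounit 𝒱).toLinearMap.lTensor _ (symComul 𝒱 (symι 𝒱 x * a)) = (symι 𝒱 x * a) ⊗ₜ 1
    have h : ∀ t, (symCounit 𝒱).toLinearMap.lTensor (Sym 𝒱)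
        (TensorProduct.map (LinearMap.mulLeft ℝ (symι 𝒱 x)) LinearMap.id t +
          TensorProduct.map (koszul (symDeg 𝒱) i) (LinearMap.mulLeft ℝ (symι 𝒱 x)) t) =
        (LinearMap.mulLeft ℝ (symι 𝒱 x)).rTensor _
          ((symCounit 𝒱).toLinearMap.lTensor _ t) := by
      intro t
      induction t using TensorProduct.induction_on with
      | zero => simp
      | add b c hb hc =>
        simp only [map_add] at hb hc ⊢
        rw [← hb, ← hc]
        abel
      | tmul b c => simp [symCounit_ι]
    rw [symComul_ι_mul 𝒱 hx, h, ha]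
    rfl

instance symCoalgebra : Coalgebra ℝ (Sym 𝒱) where
  comul := symComul 𝒱
  counit := (symCounit 𝒱).toLinearMap
  coassoc := LinearMap.ext (symComul_coassoc 𝒱)
  rTensor_counit_comp_comul := LinearMap.ext (symCounit_rTensor 𝒱)
  lTensor_counit_comp_comul := LinearMap.ext (symCounit_lTensor 𝒱)

theorem symComul_cocomm (a : Sym 𝒱) : gradedSwap (symDeg 𝒱) (symComul 𝒱 a) = symComul 𝒱 a := by
  refine word_induction (𝒱 := 𝒱) (Env.adjoin_ι 𝒱 0) (LinearMap.eqLocus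
    (gradedSwap (symDeg 𝒱) ∘ₗ symComul 𝒱) (symComul 𝒱)) ?_ ?_ a
  · change gradedSwap (symDeg 𝒱) (symComul 𝒱 1) = symComul 𝒱 1
    rw [symComul_one, gradedSwap_tmul (symDeg 𝒱) (i := 0) (j := 0) SetLike.GradedOne.one_mem
      SetLike.GradedOne.one_mem, mul_zero, sgn_zero, one_smul]
  · intro i x a hx ha
    change gradedSwap (symDeg 𝒱) (symComul 𝒱 a) = symComul 𝒱 a at ha
    change gradedSwap (symDeg 𝒱) (symComul 𝒱 (symι 𝒱 x * a)) = symComul 𝒱 (symι 𝒱 x * a)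
    have hx' : symι 𝒱 x ∈ symDeg 𝒱 i := gen_mem hx
    have h : gradedSwap (symDeg 𝒱) ∘ₗ
        (TensorProduct.map (LinearMap.mulLeft ℝ (symι 𝒱 x)) LinearMap.id +
          TensorProduct.map (koszul (symDeg 𝒱) i) (LinearMap.mulLeft ℝ (symι 𝒱 x))) =
        (TensorProduct.map (LinearMap.mulLeft ℝ (symι 𝒱 x)) LinearMap.id +
          TensorProduct.map (koszul (symDeg 𝒱) i) (LinearMap.mulLeft ℝ (symι 𝒱 x))) ∘ₗ
          gradedSwap (symDeg 𝒱) := by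
      apply tensor_ext_deg (symDeg 𝒱) (symDeg 𝒱)
      intro j k b c hb hc
      have hxb : symι 𝒱 x * b ∈ symDeg 𝒱 (i + j) := SetLike.GradedMul.mul_mem hx' hb
      have hxc : symι 𝒱 x * c ∈ symDeg 𝒱 (i + k) := SetLike.GradedMul.mul_mem hx' hc
      simp only [LinearMap.comp_apply, LinearMap.add_apply, TensorProduct.map_tmul, map_add,
        LinearMap.mulLeft_apply, LinearMap.id_apply, koszul_apply _ i hb, gradedSwap_tmul _ hb hc,
        gradedSwap_tmul _ hxb hc, map_smul, koszul_apply _ i hc, ← TensorProduct.smul_tmul',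
        gradedSwap_tmul _ hb hxc]
      rw [mul_comm j (i + k), add_mul, add_mul, sgn_add, sgn_add, mul_comm k j]
      rcases sgn_eq (i * j) with ⟨-, h⟩ | ⟨-, h⟩ <;> rw [h] <;> module
    have := LinearMap.congr_fun h (symComul 𝒱 a)
    rw [LinearMap.comp_apply, LinearMap.comp_apply, ha, LinearMap.add_apply,
      ← symComul_ι_mul 𝒱 hx] at this
    exact this

end Sym

/-! ### Coderivations, `L∞`-algebras and the functor `CE` -/

section Coder

variable {V : Type*} [AddCommGroup V] [Module ℝ V] {𝒱 : ℤ → Submodule ℝ V}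
  [DirectSum.Decomposition 𝒱] (l : Sym 𝒱 →ₗ[ℝ] V)

/-- The map `a ⊗ y ↦ l(a) y`. -/
def insertMap : Sym 𝒱 ⊗[ℝ] Sym 𝒱 →ₗ[ℝ] Sym 𝒱 :=
  LinearMap.mul' ℝ (Sym 𝒱) ∘ₗ TensorProduct.map (symι 𝒱 ∘ₗ l) LinearMap.id

theorem insertMap_tmul (a y : Sym 𝒱) : insertMap l (a ⊗ₜ y) = symι 𝒱 (l a) * y := rfl

/-- The coderivation of the symmetric coalgebra with corestriction `l : S(V) → V`, that is
`x ↦ ∑ l(x') x''` where `Δ x = ∑ x' ⊗ x''`. On words it is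
`x₁ ⋯ xₙ ↦ ∑ ± l(x_I) x_J`, the sum over all decompositions `I ⊔ J = {1, …, n}`, with Koszul
signs. -/
def coder : Sym 𝒱 →ₗ[ℝ] Sym 𝒱 := insertMap l ∘ₗ symComul 𝒱

theorem coder_apply (x : Sym 𝒱) : coder l x = insertMap l (symComul 𝒱 x) := rfl

variable {l}

theorem lTensor_coassoc_symm (x : Sym 𝒱) :
    (TensorProduct.assoc ℝ _ _ _).symm ((symComul 𝒱).lTensor _ (symComul 𝒱 x)) =
      (symComul 𝒱).rTensor _ (symComul 𝒱 x) := by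
  rw [← symComul_coassoc, LinearEquiv.symm_apply_apply]

theorem coder_mem (hl : ∀ n x, x ∈ symDeg 𝒱 n → l x ∈ 𝒱 (n + 1)) (n : ℤ) (x : Sym 𝒱)
    (hx : x ∈ symDeg 𝒱 n) : coder l x ∈ symDeg 𝒱 (n + 1) := by
  refine map_mem_of_tensorDeg _ (insertMap l) (fun i j a y h ha hy => ?_) (symComul_mem 𝒱 n x hx)
  have h' : n + 1 = (i + 1) + j := by omega
  rw [insertMap_tmul, h']
  exact SetLike.GradedMul.mul_mem (gen_mem (hl i a ha)) hy

theorem coder_one (h1 : l 1 = 0) : coder l (1 : Sym 𝒱) = 0 := by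
  rw [coder_apply, symComul_one, insertMap_tmul, h1, map_zero, zero_mul]

theorem symCounit_coder (x : Sym 𝒱) : symCounit 𝒱 (coder l x) = 0 := by
  rw [coder_apply]
  generalize symComul 𝒱 x = t
  induction t using TensorProduct.induction_on with
  | zero => simp
  | add b c hb hc => rw [map_add, map_add, hb, hc, add_zero]
  | tmul b c => rw [insertMap_tmul, map_mul, symCounit_ι, zero_mul]

theorem symComul_insertMap (hl : ∀ n x, x ∈ symDeg 𝒱 n → l x ∈ 𝒱 (n + 1))
    (t : Sym 𝒱 ⊗[ℝ] Sym 𝒱) : symComul 𝒱 (insertMap l t) =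
    (insertMap l).rTensor _
      ((TensorProduct.assoc ℝ _ _ _).symm ((symComul 𝒱).lTensor _ t)) +
    TensorProduct.map (parity (symDeg 𝒱)) (insertMap l) (TensorProduct.assoc ℝ _ _ _
      ((gradedSwap (symDeg 𝒱)).rTensor _
        ((TensorProduct.assoc ℝ _ _ _).symm ((symComul 𝒱).lTensor _ t)))) := by
  let R : (Sym 𝒱 ⊗[ℝ] Sym 𝒱) ⊗[ℝ] Sym 𝒱 →ₗ[ℝ] Sym 𝒱 ⊗[ℝ] Sym 𝒱 :=
    (insertMap l).rTensor _ + TensorProduct.map (parity (symDeg 𝒱)) (insertMap l) ∘ₗ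
      (TensorProduct.assoc ℝ _ _ _).toLinearMap ∘ₗ (gradedSwap (symDeg 𝒱)).rTensor _
  suffices h : symComul 𝒱 ∘ₗ insertMap l =
      R ∘ₗ (TensorProduct.assoc ℝ _ _ _).symm.toLinearMap ∘ₗ (symComul 𝒱).lTensor _ from
    LinearMap.congr_fun h t
  apply TensorProduct.ext
  apply hom_ext_deg (symDeg 𝒱)
  intro n a ha
  refine LinearMap.ext fun y => ?_
  change symComul 𝒱 (symι 𝒱 (l a) * y) =
    R ((TensorProduct.assoc ℝ _ _ _).symm (a ⊗ₜ symComul 𝒱 y))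
  rw [symComul_ι_mul 𝒱 (hl n a ha)]
  generalize symComul 𝒱 y = s
  suffices h : TensorProduct.map (LinearMap.mulLeft ℝ (symι 𝒱 (l a))) LinearMap.id +
      TensorProduct.map (koszul (symDeg 𝒱) (n + 1)) (LinearMap.mulLeft ℝ (symι 𝒱 (l a))) =
      R ∘ₗ (TensorProduct.assoc ℝ _ _ _).symm.toLinearMap ∘ₗ TensorProduct.mk ℝ _ _ a from
    LinearMap.congr_fun h s
  apply tensor_ext_deg (symDeg 𝒱) (symDeg 𝒱)
  intro j k b c hb hc
  simp only [R, LinearMap.add_apply, LinearMap.comp_apply, TensorProduct.map_tmul,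
    LinearMap.mulLeft_apply, LinearMap.id_apply, LinearEquiv.coe_coe, TensorProduct.mk_apply,
    TensorProduct.assoc_symm_tmul, LinearMap.rTensor_tmul, insertMap_tmul,
    gradedSwap_tmul _ ha hb, koszul_apply _ (n + 1) hb, ← TensorProduct.smul_tmul', map_smul,
    TensorProduct.assoc_tmul, parity_apply _ hb]
  rw [add_mul, one_mul, sgn_add, smul_smul]

theorem symComul_coder (hl : ∀ n x, x ∈ symDeg 𝒱 n → l x ∈ 𝒱 (n + 1)) (x : Sym 𝒱) :
    symComul 𝒱 (coder l x) =
      TensorProduct.map (coder l) LinearMap.id (symComul 𝒱 x) +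
        TensorProduct.map (parity (symDeg 𝒱)) (coder l) (symComul 𝒱 x) := by
  have h1 : (gradedSwap (symDeg 𝒱)).rTensor _ ((symComul 𝒱).rTensor _ (symComul 𝒱 x)) =
      (symComul 𝒱).rTensor _ (symComul 𝒱 x) := by
    rw [← LinearMap.comp_apply, ← LinearMap.rTensor_comp]
    congr 2
    exact LinearMap.ext (symComul_cocomm 𝒱)
  rw [coder_apply, symComul_insertMap hl, lTensor_coassoc_symm, h1, symComul_coassoc]
  congr 1
  · rw [← LinearMap.comp_apply, ← LinearMap.rTensor_comp]
    rfl
  · rw [← LinearMap.comp_apply, LinearMap.map_comp_lTensor]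
    rfl

theorem coder_coder (hl : ∀ n x, x ∈ symDeg 𝒱 n → l x ∈ 𝒱 (n + 1))
    (h : ∀ x, l (coder l x) = 0) (x : Sym 𝒱) : coder l (coder l x) = 0 := by
  let N : Sym 𝒱 ⊗[ℝ] Sym 𝒱 →ₗ[ℝ] Sym 𝒱 := LinearMap.mul' ℝ (Sym 𝒱) ∘ₗ
    TensorProduct.map (symι 𝒱 ∘ₗ l ∘ₗ parity (symDeg 𝒱)) (symι 𝒱 ∘ₗ l)
  have hN : N ∘ₗ gradedSwap (symDeg 𝒱) = -N := by
    apply tensor_ext_deg (symDeg 𝒱) (symDeg 𝒱)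
    intro i j a b ha hb
    simp only [LinearMap.comp_apply, gradedSwap_tmul _ ha hb, map_smul, LinearMap.neg_apply, N,
      TensorProduct.map_tmul, LinearMap.mul'_apply, parity_apply _ ha, parity_apply _ hb,
      smul_mul_assoc]
    rw [symι_comm (hl i a ha) (hl j b hb), add_mul, mul_add, sgn_add, sgn_add, one_mul, mul_one,
      sgn_add_one]
    rcases sgn_eq i with ⟨-, h⟩ | ⟨-, h⟩ <;> rw [h] <;> module
  have hN' : ∀ y, N (symComul 𝒱 y) = 0 := by
    intro y
    have := LinearMap.congr_fun hN (symComul 𝒱 y)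
    rw [LinearMap.comp_apply, symComul_cocomm, LinearMap.neg_apply] at this
    have h2 : (2 : ℝ) • N (symComul 𝒱 y) = 0 := by
      rw [two_smul]
      exact add_eq_zero_iff_eq_neg.2 this
    exact (smul_eq_zero.1 h2).resolve_left two_ne_zero
  have h1 : ∀ t, insertMap l (TensorProduct.map (coder l) LinearMap.id t) = 0 := by
    intro t
    induction t using TensorProduct.induction_on with
    | zero => simp
    | add b c hb hc => rw [map_add, map_add, hb, hc, add_zero]
    | tmul b c => rw [TensorProduct.map_tmul, insertMap_tmul, h, map_zero, zero_mul]
  have h2 : ∀ t, insertMap l (TensorProduct.map (parity (symDeg 𝒱)) (coder l) t) =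
      LinearMap.mul' ℝ (Sym 𝒱) (N.rTensor _
        ((TensorProduct.assoc ℝ _ _ _).symm ((symComul 𝒱).lTensor _ t))) := by
    intro t
    induction t using TensorProduct.induction_on with
    | zero => simp
    | add b c hb hc => simp only [map_add, hb, hc]
    | tmul b c =>
      rw [TensorProduct.map_tmul, insertMap_tmul, LinearMap.lTensor_tmul, coder_apply]
      generalize symComul 𝒱 c = s
      induction s using TensorProduct.induction_on with
      | zero => simp
      | add b c hb hc => simp only [map_add, TensorProduct.tmul_add, mul_add, hb, hc]
      | tmul d e => simp [insertMap_tmul, N, mul_assoc]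
  have h3 : N ∘ₗ symComul 𝒱 = 0 := LinearMap.ext hN'
  rw [coder_apply l (coder l x), symComul_coder hl, map_add, h1, h2, lTensor_coassoc_symm,
    ← LinearMap.comp_apply (N.rTensor _), ← LinearMap.rTensor_comp, h3, LinearMap.rTensor_zero,
    LinearMap.zero_apply, map_zero, zero_add]

end Coder

/-- An `L∞`-algebra over `ℝ`: a graded vector space `g` with structure maps
`lₖ : Sᵏ(s g) → s g`, `k ≥ 1`, of degree `1`, collected in one linear map `l : S(s g) → s g` that
vanishes on `S⁰(s g) = ℝ`. The generalized Jacobi identities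
`∑ ± l(l(x_I) x_J) = 0` (sum over `I ⊔ J = {1, …, n}`) say that the composition of `l` with the
coderivation determined by `l` is zero. -/
structure LInfty where
  carrier : Type u
  [addCommGroup : AddCommGroup carrier]
  [module : Module ℝ carrier]
  deg : ℤ → Submodule ℝ carrier
  [decomposition : DirectSum.Decomposition deg]
  l : Sym (susp deg) →ₗ[ℝ] carrier
  l_one : l 1 = 0
  l_mem : ∀ n x, x ∈ symDeg (susp deg) n → l x ∈ susp deg (n + 1)
  jacobi : ∀ x, l (coder l x) = 0

attribute [instance] LInfty.addCommGroup LInfty.module LInfty.decomposition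

/-- The Chevalley–Eilenberg coalgebra of an `L∞`-algebra: the symmetric coalgebra of `s g` with the
coderivation determined by the structure maps. -/
def CEObj (g : LInfty.{u}) : DGCCa.{u} where
  carrier := Sym (susp g.deg)
  deg := symDeg (susp g.deg)
  d := coder g.l
  coaug := 1
  comul_mem := symComul_mem (susp g.deg)
  counit_of_ne := symCounit_of_ne (susp g.deg)
  cocomm := symComul_cocomm (susp g.deg)
  d_mem := coder_mem g.l_mem
  d_d := coder_coder g.l_mem g.jacobi
  comul_d := symComul_coder g.l_mem
  counit_d := symCounit_coder
  coaug_mem := SetLike.GradedOne.one_mem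
  d_coaug := coder_one g.l_one
  comul_coaug := symComul_one (susp g.deg)
  counit_coaug := map_one (symCounit (susp g.deg))

/-- A morphism of `L∞`-algebras `g → h` is a morphism `CE(g) → CE(h)` of co-augmented cocommutative
differential graded coalgebras. -/
instance : Category LInfty.{u} where
  Hom g h := CEObj g ⟶ CEObj h
  id g := 𝟙 (CEObj g)
  comp f f' := (f ≫ f' : CEObj _ ⟶ CEObj _)

/-- The Chevalley–Eilenberg functor `CE : L∞ → DGCCₐ`. -/
def CE : LInfty.{u} ⥤ DGCCa.{u} where
  obj := CEObj
  map f := f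

/-! ### The inclusion of differential graded Lie algebras into `L∞`-algebras -/

section Proj

variable {V : Type*} [AddCommGroup V] [Module ℝ V] (𝒱 : ℤ → Submodule ℝ V)

/-- The representation of the symmetric algebra on `ℝ × V` in which `v` acts by
`(a, w) ↦ (0, a v)`. -/
def symProjAlg : Sym 𝒱 →ₐ[ℝ] Module.End ℝ (ℝ × V) :=
  Env.lift
    { toFun := fun v => LinearMap.inr ℝ ℝ V ∘ₗ LinearMap.toSpanSingleton ℝ V v ∘ₗ
        LinearMap.fst ℝ ℝ V
      map_add' := fun v w => by ext <;> simp
      map_smul' := fun c v => by ext <;> simp } (by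
    intro i j x y _ _
    ext <;> simp)

/-- The projection of the symmetric algebra onto the words of length one
(see `symProj_one` and `symProj_ι_mul`). -/
def symProj : Sym 𝒱 →ₗ[ℝ] V :=
  LinearMap.snd ℝ ℝ V ∘ₗ LinearMap.applyₗ ((1, 0) : ℝ × V) ∘ₗ (symProjAlg 𝒱).toLinearMap

theorem symProj_apply (x : Sym 𝒱) : symProj 𝒱 x = (symProjAlg 𝒱 x (1, 0)).2 := rfl

theorem symProjAlg_ι (v : V) (z : ℝ × V) : symProjAlg 𝒱 (symι 𝒱 v) z = (0, z.1 • v) := by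
  rw [symProjAlg, Env.lift_ι]
  rfl

theorem symProj_one : symProj 𝒱 1 = 0 := by
  rw [symProj_apply, map_one]
  rfl

variable [DirectSum.Decomposition 𝒱]

theorem symProjAlg_fst (x : Sym 𝒱) : (symProjAlg 𝒱 x (1, 0)).1 = symCounit 𝒱 x := by
  refine word_induction (𝒱 := 𝒱) (Env.adjoin_ι 𝒱 0) (LinearMap.eqLocus
    (LinearMap.fst ℝ ℝ V ∘ₗ LinearMap.applyₗ ((1, 0) : ℝ × V) ∘ₗ (symProjAlg 𝒱).toLinearMap)
    (symCounit 𝒱).toLinearMap) ?_ ?_ x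
  · change (symProjAlg 𝒱 1 (1, 0)).1 = symCounit 𝒱 1
    rw [map_one, map_one]
    rfl
  · intro i v a hv ha
    change (symProjAlg 𝒱 (symι 𝒱 v * a) (1, 0)).1 = symCounit 𝒱 (symι 𝒱 v * a)
    rw [map_mul, map_mul, symCounit_ι, zero_mul, Module.End.mul_apply, symProjAlg_ι]

theorem symProj_ι_mul (v : V) (x : Sym 𝒱) :
    symProj 𝒱 (symι 𝒱 v * x) = symCounit 𝒱 x • v := by
  rw [symProj_apply, map_mul, Module.End.mul_apply, symProjAlg_ι, symProjAlg_fst]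

theorem symProj_ι (v : V) : symProj 𝒱 (symι 𝒱 v) = v := by
  have := symProj_ι_mul 𝒱 v 1
  rwa [mul_one, map_one, one_smul] at this

theorem symProj_mem (n : ℤ) (x : Sym 𝒱) (hx : x ∈ symDeg 𝒱 n) : symProj 𝒱 x ∈ 𝒱 n := by
  refine wordDeg_le ((𝒱 n).comap (symProj 𝒱)) (fun a ha => ?_) hx
  clear * - ha
  change symProj 𝒱 a ∈ 𝒱 n
  cases ha with
  | one => rw [symProj_one]; exact zero_mem _
  | @cons i m v a hv h =>
    rw [symProj_ι_mul]
    rcases eq_or_ne m 0 with rfl | hm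
    · rw [add_zero]
      exact Submodule.smul_mem _ _ hv
    · have ha : a ∈ symDeg 𝒱 m := Submodule.subset_span h
      rw [symCounit_of_ne 𝒱 m a ha hm, zero_smul]
      exact zero_mem _

/-- The corestriction of the coderivation `coder l` is `l`. -/
theorem symProj_coder (l : Sym 𝒱 →ₗ[ℝ] V) (x : Sym 𝒱) : symProj 𝒱 (coder l x) = l x := by
  have h : ∀ t, symProj 𝒱 (insertMap l t) =
      TensorProduct.rid ℝ V (TensorProduct.map l LinearMap.id
        ((symCounit 𝒱).toLinearMap.lTensor _ t)) := by
    intro t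
    induction t using TensorProduct.induction_on with
    | zero => simp
    | add b c hb hc => simp only [map_add, hb, hc]
    | tmul b c => simp [insertMap_tmul, symProj_ι_mul]
  rw [coder_apply, h, symCounit_lTensor, TensorProduct.map_tmul, LinearMap.id_apply,
    TensorProduct.rid_tmul, one_smul]

theorem swap_symProj (x : Sym 𝒱) :
    gradedSwap 𝒱 (TensorProduct.map (symProj 𝒱) (symProj 𝒱) (symComul 𝒱 x)) =
      TensorProduct.map (symProj 𝒱) (symProj 𝒱) (symComul 𝒱 x) := by
  rw [gradedSwap_map _ _ (symProj_mem 𝒱) (symProj_mem 𝒱), symComul_cocomm]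

theorem symProj_koszul (i : ℤ) (x : Sym 𝒱) :
    symProj 𝒱 (koszul (symDeg 𝒱) i x) = koszul 𝒱 i (symProj 𝒱 x) := by
  suffices symProj 𝒱 ∘ₗ koszul (symDeg 𝒱) i = koszul 𝒱 i ∘ₗ symProj 𝒱 from
    LinearMap.congr_fun this x
  apply hom_ext_deg (symDeg 𝒱)
  intro n x hx
  rw [LinearMap.comp_apply, LinearMap.comp_apply, koszul_apply _ i hx, map_smul,
    koszul_apply _ i (symProj_mem 𝒱 n x hx)]

theorem symProj_comul_ι_mul {i : ℤ} {v : V} (hv : v ∈ 𝒱 i) (x : Sym 𝒱) :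
    TensorProduct.map (symProj 𝒱) (symProj 𝒱) (symComul 𝒱 (symι 𝒱 v * x)) =
      v ⊗ₜ symProj 𝒱 x + koszul 𝒱 i (symProj 𝒱 x) ⊗ₜ v := by
  have h1 : ∀ t, TensorProduct.map (symProj 𝒱) (symProj 𝒱)
      (TensorProduct.map (LinearMap.mulLeft ℝ (symι 𝒱 v)) LinearMap.id t) =
      TensorProduct.map (LinearMap.toSpanSingleton ℝ V v) (symProj 𝒱)
        ((symCounit 𝒱).toLinearMap.rTensor _ t) := by
    intro t
    induction t using TensorProduct.induction_on with
    | zero => simp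
    | add b c hb hc => simp only [map_add, hb, hc]
    | tmul b c => simp [symProj_ι_mul]
  have h2 : ∀ t, TensorProduct.map (symProj 𝒱) (symProj 𝒱)
      (TensorProduct.map (koszul (symDeg 𝒱) i) (LinearMap.mulLeft ℝ (symι 𝒱 v)) t) =
      TensorProduct.map (koszul 𝒱 i ∘ₗ symProj 𝒱) (LinearMap.toSpanSingleton ℝ V v)
        ((symCounit 𝒱).toLinearMap.lTensor _ t) := by
    intro t
    induction t using TensorProduct.induction_on with
    | zero => simp
    | add b c hb hc => simp only [map_add, hb, hc]
    | tmul b c => simp [symProj_ι_mul, symProj_koszul]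
  rw [symComul_ι_mul 𝒱 hv, map_add, h1, h2, symCounit_rTensor, symCounit_lTensor]
  simp

end Proj

section Iota

/-- The bracket on the suspension, `s x ⊗ s y ↦ (-1)^{|s x|} s [x, y]`. -/
def suspBracket (g : DGLA.{u}) : g.carrier ⊗[ℝ] g.carrier →ₗ[ℝ] g.carrier :=
  TensorProduct.lift (g.bracket ∘ₗ parity (susp g.deg))

theorem suspBracket_tmul (g : DGLA.{u}) {i : ℤ} {x : g.carrier} (hx : x ∈ susp g.deg i)
    (y : g.carrier) : suspBracket g (x ⊗ₜ y) = sgn i • g.bracket x y := by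
  rw [suspBracket, TensorProduct.lift.tmul, LinearMap.comp_apply, parity_apply _ hx, map_smul,
    LinearMap.smul_apply]

theorem suspBracket_mem (g : DGLA.{u}) {i j : ℤ} {x y : g.carrier} (hx : x ∈ susp g.deg i)
    (hy : y ∈ susp g.deg j) : suspBracket g (x ⊗ₜ y) ∈ susp g.deg (i + j + 1) := by
  rw [suspBracket_tmul g hx]
  refine Submodule.smul_mem _ _ ?_
  have := g.bracket_mem (i + 1) (j + 1) x y hx hy
  rwa [show i + 1 + (j + 1) = i + j + 1 + 1 by ring] at this

theorem suspBracket_swap (g : DGLA.{u}) (t : g.carrier ⊗[ℝ] g.carrier) :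
    suspBracket g (gradedSwap (susp g.deg) t) = suspBracket g t := by
  suffices suspBracket g ∘ₗ gradedSwap (susp g.deg) = suspBracket g from
    LinearMap.congr_fun this t
  apply tensor_ext_deg (susp g.deg) (susp g.deg)
  intro i j x y hx hy
  rw [LinearMap.comp_apply, gradedSwap_tmul _ hx hy, map_smul, suspBracket_tmul g hx,
    suspBracket_tmul g hy, g.skew (j + 1) (i + 1) y x hy hx, add_mul, mul_add, mul_add, one_mul,
    one_mul, mul_one, mul_comm j i, sgn_add, sgn_add, sgn_add, sgn_one]
  rcases sgn_eq i with ⟨-, h⟩ | ⟨-, h⟩ <;> rcases sgn_eq j with ⟨-, h'⟩ | ⟨-, h'⟩ <;>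
    rcases sgn_eq (i * j) with ⟨-, h''⟩ | ⟨-, h''⟩ <;> rw [h, h', h''] <;> module

/-- The structure map of a differential graded Lie algebra, viewed as an `L∞`-algebra:
`l₁(s x) = -s d x`, `l₂(s x · s y) = (-1)^{|s x|} s [x, y]` and `lₖ = 0` for `k ≥ 3`
(see `iotaL_ι`, `iotaL_ι_mul_ι` and `iotaL_ι_mul`). -/
def iotaL (g : DGLA.{u}) : Sym (susp g.deg) →ₗ[ℝ] g.carrier :=
  (1 / 2 : ℝ) • (suspBracket g ∘ₗ
    TensorProduct.map (symProj (susp g.deg)) (symProj (susp g.deg)) ∘ₗ symComul (susp g.deg)) -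
    g.d ∘ₗ symProj (susp g.deg)

theorem iotaL_apply (g : DGLA.{u}) (x : Sym (susp g.deg)) : iotaL g x =
    (1 / 2 : ℝ) • suspBracket g (TensorProduct.map (symProj (susp g.deg)) (symProj (susp g.deg))
      (symComul (susp g.deg) x)) - g.d (symProj (susp g.deg) x) := rfl

theorem iotaL_one (g : DGLA.{u}) : iotaL g 1 = 0 := by
  rw [iotaL_apply, symComul_one, TensorProduct.map_tmul, symProj_one, TensorProduct.zero_tmul]
  simp

theorem iotaL_ι_mul (g : DGLA.{u}) (v : g.carrier) (y : Sym (susp g.deg)) :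
    iotaL g (symι (susp g.deg) v * y) = suspBracket g (v ⊗ₜ symProj (susp g.deg) y) -
      symCounit (susp g.deg) y • g.d v := by
  induction v using deg_induction (susp g.deg) with
  | h0 => simp
  | hadd v w hv hw =>
    rw [map_add, add_mul, map_add, hv, hw, TensorProduct.add_tmul, map_add, map_add, smul_add]
    abel
  | hd i v hv =>
    have h : suspBracket g (koszul (susp g.deg) i (symProj (susp g.deg) y) ⊗ₜ v) =
        suspBracket g (v ⊗ₜ symProj (susp g.deg) y) := by
      rw [← suspBracket_swap g (v ⊗ₜ _)]
      congr 1
      generalize symProj (susp g.deg) y = w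
      induction w using deg_induction (susp g.deg) with
      | h0 => simp
      | hadd w w' hw hw' =>
        rw [map_add, TensorProduct.add_tmul, hw, hw', TensorProduct.tmul_add, map_add]
      | hd j w hw =>
        rw [koszul_apply _ i hw, gradedSwap_tmul _ hv hw, TensorProduct.smul_tmul']
    rw [iotaL_apply, symProj_comul_ι_mul _ hv, map_add, h, symProj_ι_mul, map_smul]
    module

theorem iotaL_ι (g : DGLA.{u}) (v : g.carrier) : iotaL g (symι (susp g.deg) v) = -g.d v := by
  have := iotaL_ι_mul g v 1
  rw [mul_one, symProj_one, TensorProduct.tmul_zero, map_zero, map_one, one_smul, zero_sub] at this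
  exact this

theorem iotaL_ι_mul_ι (g : DGLA.{u}) {i : ℤ} {v : g.carrier} (hv : v ∈ susp g.deg i)
    (w : g.carrier) : iotaL g (symι (susp g.deg) v * symι (susp g.deg) w) =
      sgn i • g.bracket v w := by
  rw [iotaL_ι_mul, symProj_ι, symCounit_ι, zero_smul, sub_zero, suspBracket_tmul g hv]

theorem iotaL_mem (g : DGLA.{u}) (n : ℤ) (x : Sym (susp g.deg))
    (hx : x ∈ symDeg (susp g.deg) n) : iotaL g x ∈ susp g.deg (n + 1) := by
  rw [iotaL_apply]
  refine sub_mem (Submodule.smul_mem _ _ ?_) (g.d_mem _ _ (symProj_mem _ n x hx))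
  refine map_mem_of_tensorDeg _ (suspBracket g ∘ₗ TensorProduct.map (symProj (susp g.deg))
    (symProj (susp g.deg))) (fun i j a b h ha hb => ?_) (symComul_mem _ n x hx)
  rw [LinearMap.comp_apply, TensorProduct.map_tmul, ← h]
  exact suspBracket_mem g (symProj_mem _ i a ha) (symProj_mem _ j b hb)

/-- The part of the Jacobi identity that says that `d` is a derivation of the bracket. -/
theorem suspBracket_d (g : DGLA.{u}) (t : g.carrier ⊗[ℝ] g.carrier)
    (ht : gradedSwap (susp g.deg) t = t) :
    suspBracket g (TensorProduct.map g.d LinearMap.id t) +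
      (1 / 2 : ℝ) • g.d (suspBracket g t) = 0 := by
  let E : g.carrier ⊗[ℝ] g.carrier →ₗ[ℝ] g.carrier :=
    suspBracket g ∘ₗ TensorProduct.map g.d LinearMap.id + (1 / 2 : ℝ) • (g.d ∘ₗ suspBracket g)
  have hE : ∀ {i j : ℤ} {x y : g.carrier}, x ∈ susp g.deg i → y ∈ susp g.deg j →
      E (x ⊗ₜ y) = -(1 / 2 : ℝ) • (sgn i • g.bracket (g.d x) y + g.bracket x (g.d y)) := by
    intro i j x y hx hy
    have hdx : g.d x ∈ susp g.deg (i + 1) := g.d_mem _ _ hx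
    simp only [E, LinearMap.add_apply, LinearMap.comp_apply, LinearMap.smul_apply,
      TensorProduct.map_tmul, LinearMap.id_apply, suspBracket_tmul g hx, suspBracket_tmul g hdx,
      map_smul, g.leibniz (i + 1) x y hx, sgn_add_one]
    rcases sgn_eq i with ⟨-, h⟩ | ⟨-, h⟩ <;> rw [h] <;> module
  have h1 : E ∘ₗ gradedSwap (susp g.deg) = -E := by
    apply tensor_ext_deg (susp g.deg) (susp g.deg)
    intro i j x y hx hy
    rw [LinearMap.comp_apply, gradedSwap_tmul _ hx hy, map_smul, LinearMap.neg_apply, hE hx hy,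
      hE hy hx, g.skew (j + 1 + 1) (i + 1) _ x (g.d_mem _ _ hy) hx,
      g.skew (j + 1) (i + 1 + 1) y _ hy (g.d_mem _ _ hx)]
    simp only [add_mul, mul_add, one_mul, mul_one, mul_comm j i, sgn_add, sgn_one]
    rcases sgn_eq i with ⟨-, h⟩ | ⟨-, h⟩ <;> rcases sgn_eq j with ⟨-, h'⟩ | ⟨-, h'⟩ <;>
      rcases sgn_eq (i * j) with ⟨-, h''⟩ | ⟨-, h''⟩ <;> rw [h, h', h''] <;> module
  have h2 := LinearMap.congr_fun h1 t
  rw [LinearMap.comp_apply, ht, LinearMap.neg_apply] at h2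
  have h3 : (2 : ℝ) • E t = 0 := by
    rw [two_smul]
    exact add_eq_zero_iff_eq_neg.2 h2
  exact (smul_eq_zero.1 h3).resolve_left two_ne_zero

/-- The part of the Jacobi identity that says that the bracket satisfies the Jacobi identity. -/
theorem suspBracket_suspBracket (g : DGLA.{u}) (t : (g.carrier ⊗[ℝ] g.carrier) ⊗[ℝ] g.carrier)
    (h12 : (gradedSwap (susp g.deg)).rTensor _ t = t)
    (h23 : (TensorProduct.assoc ℝ _ _ _).symm ((gradedSwap (susp g.deg)).lTensor _
      (TensorProduct.assoc ℝ _ _ _ t)) = t) :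
    suspBracket g ((suspBracket g).rTensor _ t) = 0 := by
  let J : (g.carrier ⊗[ℝ] g.carrier) ⊗[ℝ] g.carrier →ₗ[ℝ] g.carrier :=
    suspBracket g ∘ₗ (suspBracket g).rTensor _
  let s12 : (g.carrier ⊗[ℝ] g.carrier) ⊗[ℝ] g.carrier →ₗ[ℝ]
    (g.carrier ⊗[ℝ] g.carrier) ⊗[ℝ] g.carrier := (gradedSwap (susp g.deg)).rTensor _
  let s23 : (g.carrier ⊗[ℝ] g.carrier) ⊗[ℝ] g.carrier →ₗ[ℝ]
    (g.carrier ⊗[ℝ] g.carrier) ⊗[ℝ] g.carrier :=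
    (TensorProduct.assoc ℝ _ _ _).symm.toLinearMap ∘ₗ (gradedSwap (susp g.deg)).lTensor _ ∘ₗ
      (TensorProduct.assoc ℝ _ _ _).toLinearMap
  have hJ : ∀ {i j : ℤ} {x y z : g.carrier}, x ∈ susp g.deg i → y ∈ susp g.deg j →
      J ((x ⊗ₜ y) ⊗ₜ z) = -(sgn j • g.bracket (g.bracket x y) z) := by
    intro i j x y z hx hy
    have hxy : g.bracket x y ∈ susp g.deg (i + j + 1) := by
      have := g.bracket_mem (i + 1) (j + 1) x y hx hy
      rwa [show i + 1 + (j + 1) = i + j + 1 + 1 by ring] at this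
    simp only [J, LinearMap.comp_apply, LinearMap.rTensor_tmul, suspBracket_tmul g hx,
      ← TensorProduct.smul_tmul', map_smul, suspBracket_tmul g hxy, sgn_add, sgn_one]
    rcases sgn_eq i with ⟨-, h⟩ | ⟨-, h⟩ <;> rw [h] <;> module
  have h1 : J + J ∘ₗ s23 + J ∘ₗ s23 ∘ₗ s12 = 0 := by
    apply TensorProduct.ext_threefold
    intro x y z
    induction x using deg_induction (susp g.deg) with
    | h0 => simp
    | hadd x x' hx hx' =>
      rw [TensorProduct.add_tmul, TensorProduct.add_tmul, map_add, hx, hx', map_add]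
    | hd i x hx =>
    induction y using deg_induction (susp g.deg) with
    | h0 => simp
    | hadd y y' hy hy' =>
      rw [TensorProduct.tmul_add, TensorProduct.add_tmul, map_add, hy, hy', map_add]
    | hd j y hy =>
    induction z using deg_induction (susp g.deg) with
    | h0 => simp
    | hadd z z' hz hz' => rw [TensorProduct.tmul_add, map_add, hz, hz', map_add]
    | hd k z hz =>
    have e := g.jacobi (i + 1) (j + 1) x y z hx hy
    rw [g.skew (i + 1) (j + 1 + (k + 1)) x _ hx (g.bracket_mem _ _ _ _ hy hz),
      g.skew (j + 1) (i + 1 + (k + 1)) y _ hy (g.bracket_mem _ _ _ _ hx hz)] at e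
    have e' : g.bracket (g.bracket x y) z =
      -(sgn ((i + 1) * (j + 1 + (k + 1))) • g.bracket (g.bracket y z) x) -
      sgn ((i + 1) * (j + 1)) •
        -(sgn ((j + 1) * (i + 1 + (k + 1))) • g.bracket (g.bracket x z) y) :=
      eq_sub_of_add_eq e.symm
    simp only [LinearMap.add_apply, LinearMap.comp_apply, LinearMap.zero_apply, s12, s23,
      LinearMap.rTensor_tmul, LinearEquiv.coe_coe, TensorProduct.assoc_tmul,
      LinearMap.lTensor_tmul, gradedSwap_tmul _ hx hy, gradedSwap_tmul _ hy hz,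
      gradedSwap_tmul _ hx hz, TensorProduct.tmul_smul, map_smul, ← TensorProduct.smul_tmul',
      TensorProduct.assoc_symm_tmul, hJ hx hy, hJ hx hz, hJ hy hz]
    rw [e']
    simp only [add_mul, mul_add, one_mul, mul_one, mul_comm j i, sgn_add, sgn_one]
    rcases sgn_eq i with ⟨-, h⟩ | ⟨-, h⟩ <;> rcases sgn_eq j with ⟨-, h'⟩ | ⟨-, h'⟩ <;>
      rcases sgn_eq k with ⟨-, h3⟩ | ⟨-, h3⟩ <;> rcases sgn_eq (i * j) with ⟨-, h4⟩ | ⟨-, h4⟩ <;>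
      rw [h, h', h3, h4] <;> module
  have h2 := LinearMap.congr_fun h1 t
  have e12 : s12 t = t := h12
  have e23 : s23 t = t := h23
  change J t + J (s23 t) + J (s23 (s12 t)) = 0 at h2
  rw [e12, e23] at h2
  have h3 : (3 : ℝ) • J t = 0 := by
    rw [← h2]
    module
  exact (smul_eq_zero.1 h3).resolve_left three_ne_zero

theorem iotaL_jacobi (g : DGLA.{u}) (x : Sym (susp g.deg)) : iotaL g (coder (iotaL g) x) = 0 := by
  let p : Sym (susp g.deg) →ₗ[ℝ] g.carrier := symProj (susp g.deg)
  let M : Sym (susp g.deg) →ₗ[ℝ] g.carrier ⊗[ℝ] g.carrier :=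
    TensorProduct.map p p ∘ₗ symComul (susp g.deg)
  have h1 : ∀ t, iotaL g (insertMap (iotaL g) t) =
      suspBracket g (TensorProduct.map (iotaL g) p t) -
        g.d (TensorProduct.rid ℝ _ (TensorProduct.map (iotaL g) LinearMap.id
          ((symCounit (susp g.deg)).toLinearMap.lTensor _ t))) := by
    intro t
    induction t using TensorProduct.induction_on with
    | zero => simp
    | add b c hb hc => simp only [map_add, hb, hc]; abel
    | tmul b c =>
      rw [insertMap_tmul, iotaL_ι_mul]
      simp [p]
  have h2 : TensorProduct.map (iotaL g) p (symComul (susp g.deg) x) =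
      (1 / 2 : ℝ) • (suspBracket g).rTensor _ (TensorProduct.map M p (symComul (susp g.deg) x)) -
        TensorProduct.map g.d LinearMap.id (M x) := by
    change _ = _ - TensorProduct.map g.d LinearMap.id
      (TensorProduct.map p p (symComul (susp g.deg) x))
    generalize symComul (susp g.deg) x = t
    induction t using TensorProduct.induction_on with
    | zero => simp
    | add b c hb hc => simp only [map_add, hb, hc, smul_add]; abel
    | tmul b c =>
      simp only [TensorProduct.map_tmul, LinearMap.rTensor_tmul, LinearMap.id_apply]
      rw [iotaL_apply, TensorProduct.sub_tmul, TensorProduct.smul_tmul']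
      rfl
  have hM : ∀ y, gradedSwap (susp g.deg) (M y) = M y := swap_symProj (susp g.deg)
  have h12 : (gradedSwap (susp g.deg)).rTensor _
      (TensorProduct.map M p (symComul (susp g.deg) x)) =
      TensorProduct.map M p (symComul (susp g.deg) x) := by
    rw [← LinearMap.comp_apply, LinearMap.rTensor_comp_map]
    congr 2
    exact LinearMap.ext hM
  have ha : TensorProduct.assoc ℝ _ _ _ (TensorProduct.map M p (symComul (susp g.deg) x)) =
      TensorProduct.map p M (symComul (susp g.deg) x) := by
    have e1 : TensorProduct.map M p (symComul (susp g.deg) x) =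
        TensorProduct.map (TensorProduct.map p p) p
          ((symComul (susp g.deg)).rTensor _ (symComul (susp g.deg) x)) := by
      rw [← LinearMap.comp_apply (TensorProduct.map (TensorProduct.map p p) p),
        LinearMap.map_comp_rTensor]
    have e2 : TensorProduct.map p M (symComul (susp g.deg) x) =
        TensorProduct.map p (TensorProduct.map p p)
          ((symComul (susp g.deg)).lTensor _ (symComul (susp g.deg) x)) := by
      rw [← LinearMap.comp_apply (TensorProduct.map p (TensorProduct.map p p)),
        LinearMap.map_comp_lTensor]
    rw [e1, e2, ← symComul_coassoc]
    generalize (symComul (susp g.deg)).rTensor _ (symComul (susp g.deg) x) = t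
    suffices h : (TensorProduct.assoc ℝ _ _ _).toLinearMap ∘ₗ
        TensorProduct.map (TensorProduct.map p p) p =
        TensorProduct.map p (TensorProduct.map p p) ∘ₗ
          (TensorProduct.assoc ℝ _ _ _).toLinearMap from LinearMap.congr_fun h t
    apply TensorProduct.ext_threefold
    intro a b c
    rfl
  have h23 : (TensorProduct.assoc ℝ _ _ _).symm ((gradedSwap (susp g.deg)).lTensor _
      (TensorProduct.assoc ℝ _ _ _ (TensorProduct.map M p (symComul (susp g.deg) x)))) =
      TensorProduct.map M p (symComul (susp g.deg) x) := by
    rw [LinearEquiv.symm_apply_eq, ha, ← LinearMap.comp_apply, LinearMap.lTensor_comp_map]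
    congr 2
    exact LinearMap.ext hM
  have h3 := suspBracket_suspBracket g _ h12 h23
  have h4 := suspBracket_d g (M x) (hM x)
  have h5 : iotaL g x = (1 / 2 : ℝ) • suspBracket g (M x) - g.d (p x) := rfl
  rw [coder_apply, h1, h2, map_sub, map_smul, h3, smul_zero, zero_sub, symCounit_lTensor,
    TensorProduct.map_tmul, LinearMap.id_apply, TensorProduct.rid_tmul, one_smul, h5, map_sub,
    map_smul, g.d_d, sub_zero, ← neg_add', h4, neg_zero]

end Iota

section SymMap

variable {V W : Type*} [AddCommGroup V] [Module ℝ V] {𝒱 : ℤ → Submodule ℝ V}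
  [DirectSum.Decomposition 𝒱] [AddCommGroup W] [Module ℝ W] {𝒲 : ℤ → Submodule ℝ W}
  [DirectSum.Decomposition 𝒲] (f : V →ₗ[ℝ] W) (hf : ∀ n x, x ∈ 𝒱 n → f x ∈ 𝒲 n)

/-- The map of symmetric algebras induced by a map of graded vector spaces. -/
def symMap : Sym 𝒱 →ₐ[ℝ] Sym 𝒲 :=
  Env.lift (symι 𝒲 ∘ₗ f) (by
    intro i j x y hx hy
    rw [LinearMap.zero_apply, LinearMap.zero_apply, map_zero, add_zero]
    exact symι_comm (hf i x hx) (hf j y hy))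

theorem symMap_ι (x : V) : symMap f hf (symι 𝒱 x) = symι 𝒲 (f x) := Env.lift_ι _ _ x

theorem symMap_mem (n : ℤ) (x : Sym 𝒱) (hx : x ∈ symDeg 𝒱 n) :
    symMap f hf x ∈ symDeg 𝒲 n := by
  refine wordDeg_le ((symDeg 𝒲 n).comap (symMap f hf).toLinearMap) (fun a ha => ?_) hx
  clear * - ha
  change symMap f hf a ∈ symDeg 𝒲 n
  induction ha with
  | one => rw [map_one]; exact SetLike.GradedOne.one_mem
  | @cons i n x a hx h ih =>
    rw [map_mul]
    refine SetLike.GradedMul.mul_mem ?_ ih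
    change symMap f hf (symι 𝒱 x) ∈ symDeg 𝒲 i
    rw [symMap_ι]
    exact gen_mem (hf i x hx)

theorem symMap_koszul (i : ℤ) (x : Sym 𝒱) : symMap f hf (koszul (symDeg 𝒱) i x) =
    koszul (symDeg 𝒲) i (symMap f hf x) := by
  by_cases hi : Even i
  · rw [koszul, koszul, if_pos hi, if_pos hi]
    rfl
  · rw [koszul, koszul, if_neg hi, if_neg hi]
    exact map_parity (symMap f hf).toLinearMap (symMap_mem f hf) x

theorem symCounit_symMap (x : Sym 𝒱) : symCounit 𝒲 (symMap f hf x) = symCounit 𝒱 x := by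
  suffices (symCounit 𝒲).comp (symMap f hf) = symCounit 𝒱 from DFunLike.congr_fun this x
  refine Env.hom_ext fun v => ?_
  rw [AlgHom.comp_apply]
  change symCounit 𝒲 (symMap f hf (symι 𝒱 v)) = symCounit 𝒱 (symι 𝒱 v)
  rw [symMap_ι, symCounit_ι, symCounit_ι]

theorem symComul_symMap (x : Sym 𝒱) : symComul 𝒲 (symMap f hf x) =
    TensorProduct.map (symMap f hf).toLinearMap (symMap f hf).toLinearMap (symComul 𝒱 x) := by
  refine word_induction (𝒱 := 𝒱) (Env.adjoin_ι 𝒱 0) (LinearMap.eqLocus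
    (symComul 𝒲 ∘ₗ (symMap f hf).toLinearMap)
    (TensorProduct.map (symMap f hf).toLinearMap (symMap f hf).toLinearMap ∘ₗ symComul 𝒱))
    ?_ ?_ x
  · change symComul 𝒲 (symMap f hf 1) =
      TensorProduct.map (symMap f hf).toLinearMap (symMap f hf).toLinearMap (symComul 𝒱 1)
    simp [symComul_one]
  · intro i x a hx ha
    change symComul 𝒲 (symMap f hf a) =
      TensorProduct.map (symMap f hf).toLinearMap (symMap f hf).toLinearMap (symComul 𝒱 a) at ha
    change symComul 𝒲 (symMap f hf (symι 𝒱 x * a)) =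
      TensorProduct.map (symMap f hf).toLinearMap (symMap f hf).toLinearMap
        (symComul 𝒱 (symι 𝒱 x * a))
    rw [map_mul, symMap_ι, symComul_ι_mul 𝒱 hx, symComul_ι_mul 𝒲 (hf i x hx), ha]
    generalize symComul 𝒱 a = t
    induction t using TensorProduct.induction_on with
    | zero => simp
    | add b c hb hc =>
      simp only [map_add] at hb hc ⊢
      rw [add_add_add_comm, hb, hc]
      abel
    | tmul b c => simp [symMap_ι, symMap_koszul]

theorem symProj_symMap (x : Sym 𝒱) : symProj 𝒲 (symMap f hf x) = f (symProj 𝒱 x) := by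
  refine word_induction (𝒱 := 𝒱) (Env.adjoin_ι 𝒱 0) (LinearMap.eqLocus
    (symProj 𝒲 ∘ₗ (symMap f hf).toLinearMap) (f ∘ₗ symProj 𝒱)) ?_ ?_ x
  · change symProj 𝒲 (symMap f hf 1) = f (symProj 𝒱 1)
    rw [map_one, symProj_one, symProj_one, map_zero]
  · intro i x a hx ha
    change symProj 𝒲 (symMap f hf (symι 𝒱 x * a)) = f (symProj 𝒱 (symι 𝒱 x * a))
    rw [map_mul, symMap_ι, symProj_ι_mul, symProj_ι_mul, symCounit_symMap, map_smul]

theorem coder_symMap {l : Sym 𝒱 →ₗ[ℝ] V} {l' : Sym 𝒲 →ₗ[ℝ] W}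
    (h : ∀ x, f (l x) = l' (symMap f hf x)) (x : Sym 𝒱) :
    symMap f hf (coder l x) = coder l' (symMap f hf x) := by
  rw [coder_apply, coder_apply, symComul_symMap]
  generalize symComul 𝒱 x = t
  induction t using TensorProduct.induction_on with
  | zero => simp
  | add b c hb hc => simp only [map_add, hb, hc]
  | tmul b c =>
    rw [TensorProduct.map_tmul, insertMap_tmul, insertMap_tmul, map_mul, symMap_ι, h]
    rfl

end SymMap

/-- A differential graded Lie algebra, viewed as an `L∞`-algebra. -/
def iotaObj (g : DGLA.{u}) : LInfty.{u} where
  carrier := g.carrier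
  deg := g.deg
  l := iotaL g
  l_one := iotaL_one g
  l_mem := iotaL_mem g
  jacobi := iotaL_jacobi g

theorem map_susp {g h : DGLA.{u}} (f : g ⟶ h) (n : ℤ) (x : g.carrier) (hx : x ∈ susp g.deg n) :
    f.toLinearMap x ∈ susp h.deg n := f.map_deg (n + 1) x hx

/-- The map of symmetric coalgebras induced by a morphism of differential graded Lie algebras. -/
def iotaHom {g h : DGLA.{u}} (f : g ⟶ h) : Sym (susp g.deg) →ₐ[ℝ] Sym (susp h.deg) :=
  symMap f.toLinearMap (map_susp f)

theorem iotaHom_ι {g h : DGLA.{u}} (f : g ⟶ h) (x : g.carrier) :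
    iotaHom f (symι (susp g.deg) x) = symι (susp h.deg) (f.toLinearMap x) := symMap_ι _ _ x

theorem iotaHom_id (g : DGLA.{u}) : iotaHom (𝟙 g) = AlgHom.id ℝ (Sym (susp g.deg)) :=
  Env.hom_ext fun v => iotaHom_ι (𝟙 g) v

theorem iotaHom_comp {g h k : DGLA.{u}} (f : g ⟶ h) (f' : h ⟶ k) :
    iotaHom (f ≫ f') = (iotaHom f').comp (iotaHom f) :=
  Env.hom_ext fun v => (iotaHom_ι (f ≫ f') v).trans
    ((congrArg (iotaHom f') (iotaHom_ι f v)).trans (iotaHom_ι f' _)).symm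

theorem iotaL_symMap {g h : DGLA.{u}} (f : g ⟶ h) (x : Sym (susp g.deg)) :
    f.toLinearMap (iotaL g x) = iotaL h (iotaHom f x) := by
  have e : ∀ t, f.toLinearMap (suspBracket g t) =
      suspBracket h (TensorProduct.map f.toLinearMap f.toLinearMap t) := by
    intro t
    induction t using TensorProduct.induction_on with
    | zero => simp
    | add b c hb hc => simp only [map_add, hb, hc]
    | tmul b c =>
      rw [TensorProduct.map_tmul, suspBracket, suspBracket, TensorProduct.lift.tmul,
        TensorProduct.lift.tmul, LinearMap.comp_apply, LinearMap.comp_apply, f.map_bracket,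
        map_parity (𝒱 := susp g.deg) (𝒲 := susp h.deg) f.toLinearMap (map_susp f)]
  rw [iotaL_apply, iotaL_apply, iotaHom, symComul_symMap, symProj_symMap, map_sub, map_smul, e,
    f.map_d]
  congr 3
  generalize symComul (susp g.deg) x = t
  induction t using TensorProduct.induction_on with
  | zero => simp
  | add b c hb hc => simp only [map_add, hb, hc]
  | tmul b c => simp [symProj_symMap]

/-- The map of Chevalley–Eilenberg coalgebras induced by a morphism of differential graded Lie
algebras. -/
def iotaMap {g h : DGLA.{u}} (f : g ⟶ h) : CEObj (iotaObj g) ⟶ CEObj (iotaObj h) where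
  toCoalgHom :=
    { toLinearMap := (iotaHom f).toLinearMap
      counit_comp := LinearMap.ext (symCounit_symMap _ (map_susp f))
      map_comp_comul := LinearMap.ext fun x => (symComul_symMap _ (map_susp f) x).symm }
  map_deg := symMap_mem _ (map_susp f)
  map_d := coder_symMap _ (map_susp f) (iotaL_symMap f)
  map_coaug := map_one (iotaHom f)

/-- The inclusion of differential graded Lie algebras into `L∞`-algebras. -/
def iota : DGLA.{u} ⥤ LInfty.{u} where
  obj := iotaObj
  map f := iotaMap f
  map_id g := DGCCa.Hom.ext (CoalgHom.ext fun x => DFunLike.congr_fun (iotaHom_id g) x)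
  map_comp f f' := DGCCa.Hom.ext (CoalgHom.ext fun x => DFunLike.congr_fun (iotaHom_comp f f') x)

/-! ### The functors of the adjunction -/

/-- The functor `U∞ = U ∘ L ∘ CE : L∞ → DGA`. -/
def UInf : LInfty.{u} ⥤ DGA.{u} := CE ⋙ L ⋙ U

/-- The functor `Σ∞ : DGA → L∞`, the graded commutator viewed as an `L∞`-structure. -/
def SigmaInf : DGA.{u} ⥤ LInfty.{u} := SigmaDG ⋙ iota

end

end LInf

namespace LInf

noncomputable section

/-! ### Morphisms into differential graded algebras -/

section IntoDGA

variable {V A : Type*} [AddCommGroup V] [Module ℝ V] [Ring A] [Algebra ℝ A]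
  {𝒱 : ℤ → Submodule ℝ V} {ι : V →ₗ[ℝ] A} {B : DGA.{u}}

/-! Write `C = CE(g)`. Both Hom sets are in bijection with the twisting cochains `τ : C → A`, the
linear maps of degree one that kill the co-augmentation and satisfy the Maurer–Cartan equation of
`TwistingCochain`. The adjunction is the composite of the two bijections, and naturality is checked
on twisting cochains, where it becomes composition of linear maps.

Morphisms `U(L(C)) → A` (`envHomEquiv`). The tensor algebra `T(u C̄)` is free, so a linear map on `u
C̄` extends uniquely to an algebra morphism; it commutes with the differentials as soon as it does
so on `u C̄`, and there the condition is the Maurer–Cartan equation. Restricting to `L(C) ⊆ T(u C̄)`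
and extending over the enveloping algebra gives a morphism out of `U(L(C))`. Conversely, a morphism
out of `U(L(C))` is restricted along `T(u C̄) → U(L(C))`. The isomorphism `T(u C̄) ≅ U(L(C))` and
the universal property of free Lie algebras are never invoked: it is enough that `L(C) ⊆ T(u C̄) →
U(L(C))` is the canonical map of `L(C)` (`cobarToEnv_coe`).

Morphisms `g → Σ∞ A` (`lInfHomEquiv`). These are morphisms of differential graded coalgebras `S(s g)
→ S(s A)`. The symmetric coalgebra is cofree among the coalgebras that matter here, so such a
morphism `Φ` is determined by its corestriction `φ = p Φ : S(s g) → s A`, which can be any map of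
degree zero with `φ(1) = 0`. For existence, `Φ` is the exponential of `φ` in the convolution algebra
of maps `S(s g) → S(s A)`. The series is finite on each element because `S(s g)` is conilpotent
(`conil_induction`, `conv_pow_eventually`), and `Φ` respects the coproducts because `Δ` is an
algebra morphism, the values of `φ` are primitive, and exponentials of commuting elements multiply
(`map_convExp_eq_of_add`, `symComul_coLift`). For uniqueness, the Euler operator `E`, the
convolution of `p` with the identity, satisfies `E Φ = (p Φ) * Φ`, and its kernel consists of the
constants. Hence a difference of two morphisms with the same corestriction vanishes, by conilpotent
induction (`eq_zero_of_symEuler_comp`). The same argument shows that `Φ` commutes with the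
coderivations as soon as this holds after applying `p` (`map_coder_of_symProj`).

It remains to read this last condition. The structure map of `Σ∞ A` has only a unary and a binary
part, and `Δ` is cocommutative, so half of the commutator term equals a plain product
(`suspBracket_eq_sigmaMul`). The condition on `φ` becomes `IsCorestriction`, and the substitution
`τ(x) = -(-1)^{|x|} φ(x)` turns it into the Maurer–Cartan equation. -/

theorem algHom_mem_deg (F : A →ₐ[ℝ] B.carrier) (hF : ∀ n x, x ∈ 𝒱 n → F (ι x) ∈ B.deg n) (n : ℤ)
    (a : A) (ha : a ∈ wordDeg 𝒱 ι n) : F a ∈ B.deg n := by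
  refine wordDeg_le ((B.deg n).comap F.toLinearMap) (fun a ha => ?_) ha
  clear * - ha hF
  change F a ∈ B.deg n
  induction ha with
  | one => rw [map_one]; exact SetLike.GradedOne.one_mem
  | cons hx _ ih => rw [map_mul]; exact SetLike.GradedMul.mul_mem (hF _ _ hx) ih

/-- The maps `F ∘ d` and `B.d ∘ F` are both signed derivations along `F`, hence they agree once they
agree on generators. -/
theorem algHom_d [DirectSum.Decomposition 𝒱] [GradedAlgebra (wordDeg 𝒱 ι)]
    (F : A →ₐ[ℝ] B.carrier) (hF : ∀ n x, x ∈ 𝒱 n → F (ι x) ∈ B.deg n)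
    (hgen : Algebra.adjoin ℝ (Set.range ι) = ⊤) {d : A →ₗ[ℝ] A}
    (hd : ∀ a b, d (a * b) = d a * b + parity (wordDeg 𝒱 ι) a * d b)
    (h : ∀ x, F (d (ι x)) = B.d (F (ι x))) (a : A) : F (d a) = B.d (F a) := by
  refine word_induction (𝒱 := 𝒱) hgen
    (LinearMap.eqLocus (F.toLinearMap ∘ₗ d) (B.d ∘ₗ F.toLinearMap)) ?_ ?_ a
  · change F (d 1) = B.d (F 1)
    rw [deriv_one hd, map_zero, map_one F, deriv_one B.d_mul]
  · intro i x a hx ha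
    change F (d a) = B.d (F a) at ha
    change F (d (ι x * a)) = B.d (F (ι x * a))
    have hp := map_parity (𝒱 := wordDeg 𝒱 ι) (𝒲 := B.deg) F.toLinearMap
      (algHom_mem_deg F hF) (ι x)
    change F (parity (wordDeg 𝒱 ι) (ι x)) = parity B.deg (F (ι x)) at hp
    rw [hd, map_add, map_mul, map_mul, map_mul, B.d_mul, h, ha, hp]

end IntoDGA

/-! ### Twisting cochains -/

/-- A twisting cochain: a linear map `τ : C → A` of degree `1` that vanishes on the co-augmentation
and satisfies `d τ(x) = τ(d x) - ∑ (-1)^{|xᵢ|} τ(xᵢ) τ(yᵢ)` if `Δ x = ∑ xᵢ ⊗ yᵢ`. -/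
@[ext] structure TwistingCochain (C : DGCCa.{u}) (A : DGA.{u}) where
  toLinearMap : C.carrier →ₗ[ℝ] A.carrier
  map_coaug : toLinearMap C.coaug = 0
  map_mem : ∀ n x, x ∈ C.deg n → toLinearMap x ∈ A.deg (n + 1)
  maurerCartan : ∀ x, A.d (toLinearMap x) = toLinearMap (C.d x) -
    LinearMap.mul' ℝ A.carrier (TensorProduct.map (toLinearMap ∘ₗ parity C.deg) toLinearMap
      (Coalgebra.comul (R := ℝ) x))

/-! ### Morphisms out of `U(L(C))` from twisting cochains -/

section CobarHom

variable {C : DGCCa.{u}} {A : DGA.{u}}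

theorem parity_kerCounitProj (x : C.carrier) :
    parity (kerCounitDeg C) (kerCounitProj C x) = kerCounitProj C (parity C.deg x) :=
  (map_parity (kerCounitProj C) (kerCounitProj_mem C) x).symm

/-- A twisting cochain vanishes on the co-augmentation, so it carries the same information as its
restriction to `C̄`. -/
theorem toLinearMap_kerCounitProj (τ : TwistingCochain C A) (x : C.carrier) :
    τ.toLinearMap (kerCounitProj C x : C.carrier) = τ.toLinearMap x := by
  rw [coe_kerCounitProj, map_sub, map_smul, τ.map_coaug, smul_zero, sub_zero]

/-- The morphism of algebras `T(u C̄) → A` determined by a twisting cochain. -/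
def cobarLift (τ : TwistingCochain C A) : CobarAlg C →ₐ[ℝ] A.carrier :=
  TensorAlgebra.lift ℝ (τ.toLinearMap ∘ₗ (kerCounit C).subtype)

theorem cobarLift_ι (τ : TwistingCochain C A) (x : kerCounit C) :
    cobarLift τ (cobarι C x) = τ.toLinearMap (x : C.carrier) := TensorAlgebra.lift_ι_apply _ x

theorem cobarLift_ι_mem (τ : TwistingCochain C A) (n : ℤ) (x : kerCounit C)
    (hx : x ∈ desusp (kerCounitDeg C) n) : cobarLift τ (cobarι C x) ∈ A.deg n := by
  have := τ.map_mem (n + -1) x hx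
  rwa [neg_add_cancel_right, ← cobarLift_ι] at this

/-- The projection to `C̄` kills the co-augmentation, so the reduced coproduct can be replaced by
the full one. This identifies the quadratic part of the cobar differential with the quadratic term
of the Maurer–Cartan equation, and serves in both directions of `envHomEquiv`. -/
theorem cobarPair_redComul_kerCounitProj (F : CobarAlg C →ₐ[ℝ] A.carrier) (x : C.carrier) :
    F (cobarPair C (redComul C (kerCounitProj C x))) =
      LinearMap.mul' ℝ A.carrier (TensorProduct.map
        ((F.toLinearMap ∘ₗ cobarι C ∘ₗ kerCounitProj C) ∘ₗ parity C.deg)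
        (F.toLinearMap ∘ₗ cobarι C ∘ₗ kerCounitProj C) (Coalgebra.comul (R := ℝ) x)) := by
  rw [redComul_kerCounitProj]
  generalize Coalgebra.comul (R := ℝ) x = t
  induction t using TensorProduct.induction_on with
  | zero => simp
  | add a b ha hb => simp only [map_add, ha, hb]
  | tmul a b =>
    rw [TensorProduct.map_tmul, cobarPair_tmul, map_mul, parity_kerCounitProj]
    rfl

/-- On the generators `u x`, compatibility with the differentials is the Maurer–Cartan equation word
for word; `algHom_d` does the rest. -/
theorem cobarLift_cobarD (τ : TwistingCochain C A) (a : CobarAlg C) :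
    cobarLift τ (cobarD C a) = A.d (cobarLift τ a) := by
  refine algHom_d (𝒱 := desusp (kerCounitDeg C)) (cobarLift τ) (cobarLift_ι_mem τ)
    TensorAlgebra.adjoin_range_ι (cobarD_mul C) (fun x => ?_) a
  have h : (cobarLift τ).toLinearMap ∘ₗ cobarι C ∘ₗ kerCounitProj C = τ.toLinearMap :=
    LinearMap.ext fun y => (cobarLift_ι τ _).trans (toLinearMap_kerCounitProj τ y)
  have h2 := cobarPair_redComul_kerCounitProj (cobarLift τ) (x : C.carrier)
  rw [h, kerCounitProj_coe] at h2
  change cobarLift τ (cobarD C (cobarι C x)) = A.d (cobarLift τ (cobarι C x))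
  rw [cobarD_ι, cobarGen, LinearMap.sub_apply, map_sub, LinearMap.comp_apply,
    LinearMap.comp_apply, h2, cobarLift_ι, cobarLift_ι, τ.maurerCartan, coe_kerCounitD]

/-- A morphism from the cobar construction to a differential graded algebra. -/
def cobarLiftHom (τ : TwistingCochain C A) : cobar C ⟶ A where
  toAlgHom := cobarLift τ
  map_deg := algHom_mem_deg (cobarLift τ) (cobarLift_ι_mem τ)
  map_d := cobarLift_cobarD τ

/-- The morphism `U(L(C)) → A` determined by a twisting cochain. -/
def envLift (τ : TwistingCochain C A) :
    Env (LObj C).deg (LObj C).bracket →ₐ[ℝ] A.carrier :=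
  Env.lift ((cobarLift τ).toLinearMap ∘ₗ (freeLie C).subtype) (by
    rintro i j ⟨x, _⟩ ⟨y, _⟩ hx hy
    -- A morphism of graded algebras preserves graded commutators; this is the only property of
    -- `L(C)` as a Lie algebra that is needed to satisfy the enveloping relations.
    have h := (SigmaDG.map (cobarLiftHom τ)).map_bracket x y
    have h1 : cobarLift τ (commutator (cobarDeg C) x y) =
        cobarLift τ x * cobarLift τ y - sgn (i * j) • (cobarLift τ y * cobarLift τ x) :=
      h.trans (commutator_apply A.deg ((cobarLiftHom τ).map_deg i x hx)
        ((cobarLiftHom τ).map_deg j y hy))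
    change cobarLift τ x * cobarLift τ y = sgn (i * j) • (cobarLift τ y * cobarLift τ x) +
      cobarLift τ (commutator (cobarDeg C) x y)
    rw [h1]
    exact (add_sub_cancel _ _).symm)

theorem envLift_ι (τ : TwistingCochain C A) (x : freeLie C) :
    envLift τ (Env.ι (LObj C).deg (LObj C).bracket x) = cobarLift τ (x : CobarAlg C) :=
  Env.lift_ι _ _ x

theorem envLift_ι_mem (τ : TwistingCochain C A) (n : ℤ) (x : freeLie C)
    (hx : x ∈ (LObj C).deg n) :
    envLift τ (Env.ι (LObj C).deg (LObj C).bracket x) ∈ A.deg n := by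
  rw [envLift_ι]
  exact (cobarLiftHom τ).map_deg n x.1 hx

/-- The morphism `U(L(C)) → A` determined by a twisting cochain, as a morphism of differential
graded algebras. -/
def envLiftHom (τ : TwistingCochain C A) : U.obj (L.obj C) ⟶ A where
  toAlgHom := envLift τ
  map_deg := algHom_mem_deg (𝒱 := (LObj C).deg) (envLift τ) (envLift_ι_mem τ)
  map_d := algHom_d (𝒱 := (LObj C).deg) (envLift τ) (envLift_ι_mem τ) (Env.adjoin_ι _ _)
    (envD_mul (LObj C)) fun x => (congrArg (envLift τ) (envD_ι (LObj C) x)).trans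
      ((envLift_ι τ _).trans ((cobarLift_cobarD τ x.1).trans (congrArg A.d (envLift_ι τ x).symm)))

/-! ### From morphisms out of `U(L(C))` back to twisting cochains -/

variable (C) in
/-- The inclusion of `u C̄` into the free graded Lie algebra. -/
def freeLieι : kerCounit C →ₗ[ℝ] freeLie C :=
  (cobarι C).codRestrict (freeLie C) fun x => ι_mem_lieSpan x

variable (C) in
/-- The canonical morphism `T(u C̄) → U(L(C))`. -/
def cobarToEnv : CobarAlg C →ₐ[ℝ] Env (LObj C).deg (LObj C).bracket :=
  TensorAlgebra.lift ℝ (Env.ι (LObj C).deg (LObj C).bracket ∘ₗ freeLieι C)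

theorem cobarToEnv_ι (x : kerCounit C) :
    cobarToEnv C (cobarι C x) = Env.ι (LObj C).deg (LObj C).bracket (freeLieι C x) :=
  TensorAlgebra.lift_ι_apply _ x

/-- Both maps `L(C) → U(L(C))` agree on `u C̄` and carry brackets to graded commutators, and `u C̄`
generates `L(C)`. This compatibility is all that is used of the isomorphism `T(u C̄) ≅ U(L(C))`. -/
theorem cobarToEnv_coe (x : freeLie C) :
    cobarToEnv C (x : CobarAlg C) = Env.ι (LObj C).deg (LObj C).bracket x := by
  obtain ⟨a, ha⟩ := x
  -- The locus where the two maps agree lies in the subtype `freeLie C`; it is pushed into the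
  -- tensor algebra so that the induction principle `lieSpan_le` applies.
  have key : freeLie C ≤ (LinearMap.eqLocus ((cobarToEnv C).toLinearMap ∘ₗ (freeLie C).subtype)
      (Env.ι (LObj C).deg (LObj C).bracket)).map (freeLie C).subtype := by
    refine lieSpan_le (fun n x hx => gen_mem hx) _ ?_ ?_
    · intro x
      exact ⟨freeLieι C x, cobarToEnv_ι x, rfl⟩
    · rintro i j _ _ ha hb - - ⟨a, ha', rfl⟩ ⟨b, hb', rfl⟩
      refine ⟨(LObj C).bracket a b, ?_, rfl⟩
      have h1 : cobarToEnv C (a : CobarAlg C) = Env.ι (LObj C).deg (LObj C).bracket a := ha'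
      have h2 : cobarToEnv C (b : CobarAlg C) = Env.ι (LObj C).deg (LObj C).bracket b := hb'
      have h3 := Env.ι_mul_ι (𝒱 := (LObj C).deg) (b := (LObj C).bracket) (x := a) (y := b) ha hb
      refine (congrArg (cobarToEnv C) (commutator_apply (cobarDeg C) ha hb)).trans ?_
      rw [map_sub, map_smul, map_mul, map_mul]
      -- By the defining relation of the enveloping algebra, the graded commutator of the images of
      -- `a` and `b` is the image of their bracket.
      refine Eq.trans ?_ (sub_eq_of_eq_add' h3)
      exact congrArg₂ (· - ·) (congrArg₂ _ h1 h2) (congrArg _ (congrArg₂ _ h2 h1))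
  obtain ⟨y, hy, rfl⟩ := key ha
  exact hy

/-- The twisting cochain of a morphism `U(L(C)) → A`. -/
def cochainOfHom (F : U.obj (L.obj C) ⟶ A) : TwistingCochain C A where
  toLinearMap := (F.toAlgHom.toLinearMap ∘ₗ (cobarToEnv C).toLinearMap) ∘ₗ
    cobarι C ∘ₗ kerCounitProj C
  map_coaug := by simp [kerCounitProj_coaug]
  map_mem n x hx := by
    change F.toAlgHom (cobarToEnv C (cobarι C (kerCounitProj C x))) ∈ A.deg (n + 1)
    rw [cobarToEnv_ι]
    exact F.map_deg _ _ (gen_mem (cobarι_mem C (kerCounitProj_mem C n x hx)))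
  maurerCartan x := by
    have h := cobarPair_redComul_kerCounitProj (F.toAlgHom.comp (cobarToEnv C)) x
    -- The differential of `u x` is no longer a generator, but it still lies in `L(C)`, so
    -- `cobarToEnv_coe` identifies its image in `U(L(C))`.
    have h2 : A.d (F.toAlgHom (cobarToEnv C (cobarι C (kerCounitProj C x)))) =
        F.toAlgHom (cobarToEnv C (cobarD C (cobarι C (kerCounitProj C x)))) := by
      rw [cobarToEnv_ι]
      refine (F.map_d _).symm.trans (congrArg F.toAlgHom ?_)
      refine (envD_ι (LObj C) _).trans ?_
      exact (cobarToEnv_coe ((LObj C).d (freeLieι C (kerCounitProj C x)))).symm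
    refine h2.trans ?_
    change (F.toAlgHom.comp (cobarToEnv C)) _ = _
    rw [cobarD_ι, cobarGen, LinearMap.sub_apply, map_sub, LinearMap.comp_apply,
      LinearMap.comp_apply, kerCounitD_kerCounitProj]
    exact congrArg _ h

theorem cochainOfHom_apply (F : U.obj (L.obj C) ⟶ A) (x : C.carrier) :
    (cochainOfHom F).toLinearMap x = F.toAlgHom
      (Env.ι (LObj C).deg (LObj C).bracket (freeLieι C (kerCounitProj C x))) :=
  congrArg F.toAlgHom (cobarToEnv_ι _)

variable (C A) in
/-- Morphisms `U(L(C)) → A` are the same thing as twisting cochains. -/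
def envHomEquiv : (U.obj (L.obj C) ⟶ A) ≃ TwistingCochain C A where
  toFun := cochainOfHom
  invFun := envLiftHom
  left_inv F := by
    refine DGA.Hom.ext (Env.hom_ext fun x => ?_)
    -- Both sides are algebra morphisms on a tensor algebra, so it suffices to compare them on `u
    -- C̄`. Evaluating on `L(C)`, which generates `U(L(C))`, then recovers `F`.
    have h : cobarLift (cochainOfHom F) = F.toAlgHom.comp (cobarToEnv C) := by
      refine TensorAlgebra.hom_ext (LinearMap.ext fun y => ?_)
      refine (cobarLift_ι (cochainOfHom F) y).trans ?_
      rw [cochainOfHom_apply, kerCounitProj_coe, ← cobarToEnv_ι]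
      rfl
    refine (envLift_ι (cochainOfHom F) x).trans ?_
    rw [h]
    exact congrArg F.toAlgHom (cobarToEnv_coe x)
  right_inv τ := by
    refine TwistingCochain.ext (LinearMap.ext fun x => ?_)
    rw [cochainOfHom_apply]
    exact (envLift_ι τ _).trans ((cobarLift_ι τ _).trans (toLinearMap_kerCounitProj τ x))

/-- Naturality in the coalgebra: on twisting cochains, a coalgebra morphism acts by precomposition.
-/
theorem cochainOfHom_map {D : DGCCa.{u}} (f : D ⟶ C) (F : U.obj (L.obj C) ⟶ A) (x : D.carrier) :
    (cochainOfHom (U.map (L.map f) ≫ F)).toLinearMap x =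
      (cochainOfHom F).toLinearMap (f.toCoalgHom x) := by
  rw [cochainOfHom_apply, cochainOfHom_apply, ← kerCounitMap_proj]
  refine congrArg F.toAlgHom ((envMap_ι (L.map f) _).trans (congrArg _ (Subtype.ext ?_)))
  exact cobarMap_ι f (kerCounitProj D x)

theorem cochainOfHom_comp {B : DGA.{u}} (F : U.obj (L.obj C) ⟶ A) (k : A ⟶ B) (x : C.carrier) :
    (cochainOfHom (F ≫ k)).toLinearMap x = k.toAlgHom ((cochainOfHom F).toLinearMap x) := rfl

end CobarHom

/-! ### Locally finite sums of linear maps -/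

section LocSum

open Filter

theorem finsum_eq_sum_range {Y : Type*} [AddCommMonoid Y] {f : ℕ → Y} {N : ℕ}
    (h : ∀ n, N ≤ n → f n = 0) : ∑ᶠ n, f n = ∑ n ∈ Finset.range N, f n := by
  refine finsum_eq_sum_of_support_subset f fun n hn => ?_
  rw [Finset.coe_range, Set.mem_Iio]
  by_contra hN
  exact hn (h n (not_lt.1 hN))

/-- The square of pairs with both entries below `N` is sliced by the value of `p.1 + p.2`, which
stays below `2 * N`. The pairs on an antidiagonal that leave the square contribute zero. -/
theorem sum_range_antidiagonal {Y : Type*} [AddCommMonoid Y] {F : ℕ × ℕ → Y} {N : ℕ}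
    (hF : ∀ p, p ∉ Finset.range N ×ˢ Finset.range N → F p = 0) {M : ℕ} (hM : 2 * N ≤ M) :
    ∑ n ∈ Finset.range M, ∑ p ∈ Finset.HasAntidiagonal.antidiagonal n, F p =
      ∑ p ∈ Finset.range N ×ˢ Finset.range N, F p := by
  rw [← Finset.sum_fiberwise_of_maps_to (s := Finset.range N ×ˢ Finset.range N)
    (t := Finset.range M) (g := fun p => p.1 + p.2) (by
      intro p hp
      simp only [Finset.mem_product, Finset.mem_range] at hp ⊢
      omega)]
  refine Finset.sum_congr rfl fun n _ => (Finset.sum_subset (fun p hp => ?_) fun p hp hp' => ?_).symm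
  · exact Finset.HasAntidiagonal.mem_antidiagonal.2 (Finset.mem_filter.1 hp).2
  · refine hF p fun h => hp' (Finset.mem_filter.2 ⟨h, Finset.HasAntidiagonal.mem_antidiagonal.1 hp⟩)

variable {X Y X' Y' : Type*} [AddCommGroup X] [Module ℝ X] [AddCommGroup Y] [Module ℝ Y]
  [AddCommGroup X'] [Module ℝ X'] [AddCommGroup Y'] [Module ℝ Y']

/-- The subspace of the vectors killed by almost all members of a sequence of linear maps. -/
def eventuallyKer (G : ℕ → X →ₗ[ℝ] Y) : Submodule ℝ X where
  carrier := {x | ∀ᶠ n in atTop, G n x = 0}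
  add_mem' := by
    intro x y hx hy
    change ∀ᶠ n in atTop, G n (x + y) = 0
    filter_upwards [hx, hy] with n h1 h2
    rw [map_add, h1, h2, add_zero]
  zero_mem' := Eventually.of_forall fun n => map_zero (G n)
  smul_mem' := by
    intro c x hx
    change ∀ᶠ n in atTop, G n (c • x) = 0
    filter_upwards [hx] with n h
    rw [map_smul, h, smul_zero]

/-- The sum of a sequence of linear maps almost all of which vanish on any given vector. -/
def locSum (G : ℕ → X →ₗ[ℝ] Y) (hG : ∀ x, ∀ᶠ n in atTop, G n x = 0) : X →ₗ[ℝ] Y where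
  -- At each vector the support is finite by `hG`, so this is a genuine sum and never the default
  -- value of `finsum`.
  toFun x := ∑ᶠ n, G n x
  map_add' x y := by
    obtain ⟨N, hN⟩ := eventually_atTop.1 ((hG x).and (hG y))
    rw [finsum_eq_sum_range (N := N) fun n hn => by rw [map_add, (hN n hn).1, (hN n hn).2, add_zero],
      finsum_eq_sum_range (N := N) fun n hn => (hN n hn).1,
      finsum_eq_sum_range (N := N) fun n hn => (hN n hn).2, ← Finset.sum_add_distrib]
    exact Finset.sum_congr rfl fun n _ => map_add _ _ _
  map_smul' c x := by
    obtain ⟨N, hN⟩ := eventually_atTop.1 (hG x)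
    rw [finsum_eq_sum_range (N := N) fun n hn => by rw [map_smul, hN n hn, smul_zero],
      finsum_eq_sum_range (N := N) hN, RingHom.id_apply, Finset.smul_sum]
    exact Finset.sum_congr rfl fun n _ => map_smul _ _ _

theorem locSum_eq {G : ℕ → X →ₗ[ℝ] Y} (hG : ∀ x, ∀ᶠ n in atTop, G n x = 0) {N : ℕ} {x : X}
    (h : ∀ n, N ≤ n → G n x = 0) : locSum G hG x = ∑ n ∈ Finset.range N, G n x :=
  finsum_eq_sum_range h

theorem locSum_mem {G : ℕ → X →ₗ[ℝ] Y} (hG : ∀ x, ∀ᶠ n in atTop, G n x = 0) (P : Submodule ℝ Y)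
    {x : X} (h : ∀ n, G n x ∈ P) : locSum G hG x ∈ P := by
  obtain ⟨N, hN⟩ := eventually_atTop.1 (hG x)
  rw [locSum_eq hG hN]
  exact Submodule.sum_mem _ fun n _ => h n

theorem map_locSum {G : ℕ → X →ₗ[ℝ] Y} (hG : ∀ x, ∀ᶠ n in atTop, G n x = 0) (h : Y →ₗ[ℝ] Y')
    (hG' : ∀ x, ∀ᶠ n in atTop, (h ∘ₗ G n) x = 0) (x : X) :
    h (locSum G hG x) = locSum (fun n => h ∘ₗ G n) hG' x := by
  obtain ⟨N, hN⟩ := eventually_atTop.1 (hG x)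
  rw [locSum_eq hG hN, locSum_eq hG' (N := N) fun n hn => by
    rw [LinearMap.comp_apply, hN n hn, map_zero], map_sum]
  rfl

/-- A tensor is a finite sum of pure tensors, and for `a ⊗ b` any `N` works beyond which all `G n a`
and `H n b` vanish. The bound depends on `t`, hence the formulation with a filter, which also makes
the additive step immediate. The vanishing outside the square permits regrouping along
antidiagonals. -/
theorem map_locSum_locSum {G : ℕ → X →ₗ[ℝ] Y} (hG : ∀ x, ∀ᶠ n in atTop, G n x = 0)
    {H : ℕ → X' →ₗ[ℝ] Y'} (hH : ∀ x, ∀ᶠ n in atTop, H n x = 0) (t : X ⊗[ℝ] X') :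
    ∀ᶠ N in atTop,
      TensorProduct.map (locSum G hG) (locSum H hH) t =
        ∑ p ∈ Finset.range N ×ˢ Finset.range N, TensorProduct.map (G p.1) (H p.2) t ∧
      ∀ p : ℕ × ℕ, p ∉ Finset.range N ×ˢ Finset.range N →
        TensorProduct.map (G p.1) (H p.2) t = 0 := by
  induction t using TensorProduct.induction_on with
  | zero => exact Eventually.of_forall fun N => by simp
  | add a b ha hb =>
    filter_upwards [ha, hb] with N h1 h2
    refine ⟨?_, fun p hp => by rw [map_add, h1.2 p hp, h2.2 p hp, add_zero]⟩
    rw [map_add, h1.1, h2.1, ← Finset.sum_add_distrib]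
    exact Finset.sum_congr rfl fun p _ => (map_add _ _ _).symm
  | tmul a b =>
    filter_upwards [eventually_forall_ge_atTop.2 (hG a), eventually_forall_ge_atTop.2 (hH b)]
      with N h1 h2
    refine ⟨?_, fun p hp => ?_⟩
    · rw [TensorProduct.map_tmul, locSum_eq hG h1, locSum_eq hH h2, TensorProduct.sum_tmul,
        Finset.sum_product]
      refine Finset.sum_congr rfl fun i _ => ?_
      rw [TensorProduct.tmul_sum]
      rfl
    · rw [TensorProduct.map_tmul]
      rw [Finset.mem_product, Finset.mem_range, Finset.mem_range, not_and_or, not_lt,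
        not_lt] at hp
      rcases hp with hp | hp
      · rw [h1 _ hp, TensorProduct.zero_tmul]
      · rw [h2 _ hp, TensorProduct.tmul_zero]

end LocSum

/-! ### The symmetric coalgebra is conilpotent -/

section Conilpotent

variable {V : Type*} [AddCommGroup V] [Module ℝ V] {𝒱 : ℤ → Submodule ℝ V}
  [DirectSum.Decomposition 𝒱]

/-- The range of `Q.subtype.lTensor X` plays the role of the subspace `X ⊗ Q` of `X ⊗ Y`. It is
spanned by the `s ⊗ q`, so a linear condition can be tested on these. -/
theorem mem_of_mem_range_lTensor {X Y Z : Type*} [AddCommGroup X] [Module ℝ X] [AddCommGroup Y]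
    [Module ℝ Y] [AddCommGroup Z] [Module ℝ Z] {Q : Submodule ℝ Y} (G : X ⊗[ℝ] Y →ₗ[ℝ] Z)
    (K : Submodule ℝ Z) (h : ∀ s, ∀ q ∈ Q, G (s ⊗ₜ q) ∈ K) {t : X ⊗[ℝ] Y}
    (ht : t ∈ LinearMap.range (Q.subtype.lTensor X)) : G t ∈ K := by
  obtain ⟨t, rfl⟩ := ht
  induction t using TensorProduct.induction_on with
  | zero => simp
  | add a b ha hb => rw [map_add, map_add]; exact add_mem ha hb
  | tmul a b => exact h a b b.2

theorem tmul_mem_range_lTensor {X Y : Type*} [AddCommGroup X] [Module ℝ X] [AddCommGroup Y]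
    [Module ℝ Y] {Q : Submodule ℝ Y} (x : X) {y : Y} (hy : y ∈ Q) :
    x ⊗ₜ[ℝ] y ∈ LinearMap.range (Q.subtype.lTensor X) := ⟨x ⊗ₜ ⟨y, hy⟩, rfl⟩

variable (𝒱) in
/-- The subspace of all `a` with `Δ a - 1 ⊗ a ∈ S(V) ⊗ Q`, as a monotone function of `Q`. -/
def conilStep : Submodule ℝ (Sym 𝒱) →o Submodule ℝ (Sym 𝒱) where
  toFun Q := (LinearMap.range (Q.subtype.lTensor (Sym 𝒱))).comap
    (symComul 𝒱 - TensorProduct.mk ℝ (Sym 𝒱) (Sym 𝒱) 1)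
  monotone' Q Q' h a ha := by
    exact mem_of_mem_range_lTensor (Q := Q) LinearMap.id
      (LinearMap.range (Q'.subtype.lTensor (Sym 𝒱)))
      (fun s q hq => tmul_mem_range_lTensor s (h hq)) ha

theorem mem_conilStep {Q : Submodule ℝ (Sym 𝒱)} {a : Sym 𝒱} : a ∈ conilStep 𝒱 Q ↔
    symComul 𝒱 a - 1 ⊗ₜ a ∈ LinearMap.range (Q.subtype.lTensor (Sym 𝒱)) := Iff.rfl

/-- Induction over the symmetric coalgebra, which is conilpotent. -/
theorem conil_induction (Q : Submodule ℝ (Sym 𝒱)) (h : ∀ a, symComul 𝒱 a - 1 ⊗ₜ a ∈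
    LinearMap.range (Q.subtype.lTensor (Sym 𝒱)) → a ∈ Q) (a : Sym 𝒱) : a ∈ Q := by
  -- The least fixed point of the step operator lies in every `Q` closed under it. So it suffices
  -- that `R` is everything, that is, that `R` contains `1` and is stable under left multiplication
  -- by homogeneous generators.
  let R : Submodule ℝ (Sym 𝒱) := OrderHom.lfp (conilStep 𝒱)
  have hR : conilStep 𝒱 R = R := OrderHom.map_lfp _
  have hRQ : R ≤ Q := OrderHom.lfp_le _ fun a ha => h a ha
  -- Stability is itself proved by minimality of `R`: let `R'` consist of those `a ∈ R` with `x a ∈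
  -- R` for all homogeneous generators `x`, and show that the step operator maps `R'` into itself.
  -- Then `R ≤ R'`.
  let R' : Submodule ℝ (Sym 𝒱) :=
    { carrier := {a | a ∈ R ∧ ∀ i x, x ∈ 𝒱 i → symι 𝒱 x * a ∈ R}
      add_mem' := fun {a b} ha hb => ⟨add_mem ha.1 hb.1, fun i x hx => by
        rw [mul_add]; exact add_mem (ha.2 i x hx) (hb.2 i x hx)⟩
      zero_mem' := ⟨zero_mem _, fun i x hx => by rw [mul_zero]; exact zero_mem _⟩
      smul_mem' := fun c a ha => ⟨Submodule.smul_mem _ c ha.1, fun i x hx => by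
        rw [mul_smul_comm]; exact Submodule.smul_mem _ c (ha.2 i x hx)⟩ }
  have hR' : R ≤ R' := by
    refine OrderHom.lfp_le _ fun a ha => ?_
    have haR : a ∈ R := hR ▸ (conilStep 𝒱).monotone' (fun b hb => hb.1 : R' ≤ R) ha
    refine ⟨haR, fun i x hx => ?_⟩
    rw [← hR, mem_conilStep, symComul_ι_mul 𝒱 hx]
    -- With `1 ⊗ a` split off from `Δ a`, the term `1 ⊗ x a` of `Δ (x a)` cancels against the one
    -- subtracted. What remains is `x ⊗ a` and, for each `s ⊗ q` in the rest with `q ∈ R'`, the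
    -- terms `x s ⊗ q` and `± s ⊗ x q`; all second factors lie in `R`.
    have e : symComul 𝒱 a = (symComul 𝒱 a - 1 ⊗ₜ a) + 1 ⊗ₜ a := (sub_add_cancel _ _).symm
    have hk : koszul (symDeg 𝒱) i (1 : Sym 𝒱) = 1 := by
      rw [koszul_apply _ i SetLike.GradedOne.one_mem, mul_zero, sgn_zero, one_smul]
    rw [e, map_add, map_add, TensorProduct.map_tmul, TensorProduct.map_tmul, hk]
    simp only [LinearMap.mulLeft_apply, LinearMap.id_apply, mul_one]
    rw [← add_assoc, add_sub_cancel_right]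
    refine add_mem (add_mem ?_ (tmul_mem_range_lTensor _ haR)) ?_
    · exact mem_of_mem_range_lTensor (Q := R') _ _
        (fun s q hq => tmul_mem_range_lTensor _ hq.1) ha
    · exact mem_of_mem_range_lTensor (Q := R') _ _
        (fun s q hq => tmul_mem_range_lTensor _ (hq.2 i x hx)) ha
  refine hRQ (word_induction (𝒱 := 𝒱) (Env.adjoin_ι 𝒱 0) R ?_ ?_ a)
  · rw [← hR, mem_conilStep, symComul_one, sub_self]
    exact zero_mem _
  · exact fun i x a hx ha => (hR' ha).2 i x hx

end Conilpotent

/-! ### Exponentials in the convolution algebra -/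

section ConvExp

open Filter WithConv

variable {V : Type*} [AddCommGroup V] [Module ℝ V] {𝒱 : ℤ → Submodule ℝ V}
  [DirectSum.Decomposition 𝒱] {B B' : Type*} [Ring B] [Algebra ℝ B] [Ring B'] [Algebra ℝ B']

theorem conv_mul_apply (f g : WithConv (Sym 𝒱 →ₗ[ℝ] B)) (a : Sym 𝒱) : (f * g).ofConv a =
    LinearMap.mul' ℝ B (TensorProduct.map f.ofConv g.ofConv (symComul 𝒱 a)) := rfl

theorem conv_one_apply (a : Sym 𝒱) :
    (1 : WithConv (Sym 𝒱 →ₗ[ℝ] B)).ofConv a = algebraMap ℝ B (symCounit 𝒱 a) := rfl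

/-- Local nilpotence of `f` under convolution. One has `f ^ (n + 1) = f * f ^ n`, evaluated on `Δ
a`. The term `1 ⊗ a` contributes nothing because `f(1) = 0`, and the second factors of the rest are
killed by `f ^ n` for large `n`, by conilpotent induction. -/
theorem conv_pow_eventually {f : WithConv (Sym 𝒱 →ₗ[ℝ] B)} (hf : f.ofConv 1 = 0) (a : Sym 𝒱) :
    ∀ᶠ n in atTop, (f ^ n).ofConv a = 0 := by
  refine conil_induction (eventuallyKer fun n => (f ^ n).ofConv) (fun a ha => ?_) a
  let G : ℕ → Sym 𝒱 ⊗[ℝ] Sym 𝒱 →ₗ[ℝ] B := fun n =>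
    LinearMap.mul' ℝ B ∘ₗ TensorProduct.map f.ofConv (f ^ n).ofConv
  have h : symComul 𝒱 a - 1 ⊗ₜ a ∈ eventuallyKer G :=
    mem_of_mem_range_lTensor LinearMap.id _ (fun s q hq => by
      change ∀ᶠ n in atTop, f.ofConv s * (f ^ n).ofConv q = 0
      filter_upwards [hq] with n hn
      rw [hn, mul_zero]) ha
  change ∀ᶠ n in atTop, (f ^ n).ofConv a = 0
  -- The recursion controls the exponent `n + 1`, so the claim is transported along the shift `n ↦ n
  -- + 1`, which preserves the filter at infinity.
  refine (eventually_map (m := fun n => n + 1)).2 ?_ |>.filter_mono (by rw [map_add_atTop_eq_nat])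
  filter_upwards [h] with n hn
  rw [map_sub, sub_eq_zero] at hn
  rw [pow_succ', conv_mul_apply]
  refine hn.trans ?_
  change f.ofConv 1 * (f ^ n).ofConv a = 0
  rw [hf, zero_mul]

/-- The `n`-th term of the exponential series in the convolution algebra. -/
def convExpTerm (f : WithConv (Sym 𝒱 →ₗ[ℝ] B)) (n : ℕ) : Sym 𝒱 →ₗ[ℝ] B :=
  ((n.factorial : ℝ)⁻¹ • f ^ n).ofConv

theorem convExpTerm_apply (f : WithConv (Sym 𝒱 →ₗ[ℝ] B)) (n : ℕ) (a : Sym 𝒱) :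
    convExpTerm f n a = (n.factorial : ℝ)⁻¹ • (f ^ n).ofConv a := rfl

theorem convExpTerm_eventually {f : WithConv (Sym 𝒱 →ₗ[ℝ] B)} (hf : f.ofConv 1 = 0)
    (a : Sym 𝒱) : ∀ᶠ n in atTop, convExpTerm f n a = 0 := by
  filter_upwards [conv_pow_eventually hf a] with n hn
  rw [convExpTerm_apply, hn, smul_zero]

/-- The exponential in the convolution algebra. -/
def convExp (f : WithConv (Sym 𝒱 →ₗ[ℝ] B)) (hf : f.ofConv 1 = 0) : Sym 𝒱 →ₗ[ℝ] B :=
  locSum (convExpTerm f) (convExpTerm_eventually hf)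

theorem comp_conv_pow (h : B →ₐ[ℝ] B') (f : WithConv (Sym 𝒱 →ₗ[ℝ] B)) (n : ℕ) :
    h.toLinearMap ∘ₗ (f ^ n).ofConv = (toConv (h.toLinearMap ∘ₗ f.ofConv) ^ n).ofConv := by
  induction n with
  | zero =>
    refine LinearMap.ext fun a => ?_
    exact h.commutes _
  | succ n ih => rw [pow_succ, pow_succ, LinearMap.algHom_comp_convMul_distrib, ih]

/-- Postcomposition with an algebra morphism is multiplicative for convolution, so it maps each term
of the exponential series to the corresponding term. The image `f'` is a separate variable, so that
it can be put in any convenient form, for instance `0`. -/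
theorem map_convExp (h : B →ₐ[ℝ] B') {f : WithConv (Sym 𝒱 →ₗ[ℝ] B)} (hf : f.ofConv 1 = 0)
    {f' : WithConv (Sym 𝒱 →ₗ[ℝ] B')} (hf' : f'.ofConv 1 = 0)
    (hff' : h.toLinearMap ∘ₗ f.ofConv = f'.ofConv) (a : Sym 𝒱) :
    h (convExp f hf a) = convExp f' hf' a := by
  have e : (fun n => h.toLinearMap ∘ₗ convExpTerm f n) = convExpTerm f' := by
    funext n
    refine LinearMap.ext fun a => ?_
    rw [LinearMap.comp_apply, convExpTerm_apply, map_smul, convExpTerm_apply,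
      ← LinearMap.comp_apply, comp_conv_pow, hff']
  have h1 := map_locSum (convExpTerm_eventually hf) h.toLinearMap
    (fun x => by
      filter_upwards [convExpTerm_eventually hf x] with n hn
      rw [LinearMap.comp_apply, hn, map_zero]) a
  refine h1.trans ?_
  simp only [e]
  rfl

/-- The functional equation of the exponential, `exp (f + g) = exp f * exp g` for commuting `f` and
`g`. It follows from the binomial theorem, since on a given element both sides are finite sums. -/
theorem convExp_add {f g : WithConv (Sym 𝒱 →ₗ[ℝ] B)} (hf : f.ofConv 1 = 0) (hg : g.ofConv 1 = 0)
    (hfg : (f + g).ofConv 1 = 0) (hc : Commute f g) (a : Sym 𝒱) :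
    convExp (f + g) hfg a = LinearMap.mul' ℝ B
      (TensorProduct.map (convExp f hf) (convExp g hg) (symComul 𝒱 a)) := by
  obtain ⟨N, h1, h2⟩ := (map_locSum_locSum (convExpTerm_eventually hf)
    (convExpTerm_eventually hg) (symComul 𝒱 a)).exists
  obtain ⟨M, hM⟩ := eventually_atTop.1 (convExpTerm_eventually hfg a)
  have key : ∀ n, convExpTerm (f + g) n a = ∑ p ∈ Finset.HasAntidiagonal.antidiagonal n,
      LinearMap.mul' ℝ B (TensorProduct.map (convExpTerm f p.1) (convExpTerm g p.2)
        (symComul 𝒱 a)) := by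
    intro n
    have e : (n.factorial : ℝ)⁻¹ • (f + g) ^ n = ∑ p ∈ Finset.HasAntidiagonal.antidiagonal n,
        ((p.1.factorial : ℝ)⁻¹ • f ^ p.1) * ((p.2.factorial : ℝ)⁻¹ • g ^ p.2) := by
      -- The binomial coefficient divided by `n!` is `1 / (p.1! p.2!)` when `p.1 + p.2 = n`.
      rw [hc.add_pow', Finset.smul_sum]
      refine Finset.sum_congr rfl fun p hp => ?_
      rw [Finset.HasAntidiagonal.mem_antidiagonal] at hp
      subst hp
      rw [smul_mul_smul_comm, ← Nat.cast_smul_eq_nsmul ℝ, smul_smul]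
      congr 1
      rw [Nat.cast_add_choose]
      have h3 : ((p.1 + p.2).factorial : ℝ) ≠ 0 := by positivity
      field_simp
    rw [convExpTerm, e, ofConv_sum, LinearMap.sum_apply]
    rfl
  -- Beyond `M` the series of `f + g` has stopped at `a`; the bound `2 * N` ensures that the
  -- antidiagonals cover the square on which the product of the two series lives.
  rw [convExp, locSum_eq (N := max M (2 * N)) _ fun n hn => hM n ((le_max_left _ _).trans hn),
    Finset.sum_congr rfl fun n _ => key n,
    sum_range_antidiagonal (N := N) (fun p hp => by rw [h2 p hp, map_zero]) (le_max_right _ _)]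
  refine Eq.trans ?_ (congrArg (LinearMap.mul' ℝ B) h1).symm
  rw [map_sum]

theorem convExp_zero (a : Sym 𝒱) :
    convExp (0 : WithConv (Sym 𝒱 →ₗ[ℝ] B)) (LinearMap.zero_apply _) a = algebraMap ℝ B (symCounit 𝒱 a) := by
  refine (locSum_eq (N := 1) (convExpTerm_eventually (LinearMap.zero_apply _))
    fun n hn => ?_).trans ?_
  rotate_left
  · rw [Finset.sum_range_one, convExpTerm_apply, pow_zero, Nat.factorial_zero, Nat.cast_one,
      inv_one, one_smul]
    rfl
  · rw [convExpTerm_apply, zero_pow (by omega), ofConv_zero, LinearMap.zero_apply, smul_zero]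

/-- The exponential of a primitive is group-like. Here `D` stands for a comultiplication, `inl` and
`inr` for the two inclusions into a graded tensor product, and `o` for its underlying tensors; `hD`
says that the values of `f` are primitive. Then `D ∘ exp f = exp (inl f + inr f) = exp (inl f) * exp
(inr f)`. -/
theorem map_convExp_eq_of_add {f : WithConv (Sym 𝒱 →ₗ[ℝ] B)} (hf : f.ofConv 1 = 0)
    (D inl inr : B →ₐ[ℝ] B') (o : B ⊗[ℝ] B →ₗ[ℝ] B')
    (ho : ∀ b c, o (b ⊗ₜ c) = inl b * inr c)
    (hD : ∀ x, D (f.ofConv x) = inl (f.ofConv x) + inr (f.ofConv x))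
    (hc : ∀ i j x y, x ∈ symDeg 𝒱 i → y ∈ symDeg 𝒱 j → inr (f.ofConv x) * inl (f.ofConv y) =
      sgn (i * j) • (inl (f.ofConv y) * inr (f.ofConv x))) (a : Sym 𝒱) :
    D (convExp f hf a) =
      o (TensorProduct.map (convExp f hf) (convExp f hf) (symComul 𝒱 a)) := by
  let g : WithConv (Sym 𝒱 →ₗ[ℝ] B') := toConv (inl.toLinearMap ∘ₗ f.ofConv)
  let h : WithConv (Sym 𝒱 →ₗ[ℝ] B') := toConv (inr.toLinearMap ∘ₗ f.ofConv)
  have hg : g.ofConv 1 = 0 := (congrArg inl hf).trans (map_zero inl)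
  have hh : h.ofConv 1 = 0 := (congrArg inr hf).trans (map_zero inr)
  have hgh : (g + h).ofConv 1 = 0 := by
    rw [ofConv_add, LinearMap.add_apply, hg, hh, add_zero]
  -- The values of `g` and `h` commute only up to the Koszul sign `(-1)^{ij}`. In the convolution
  -- algebra the sign disappears, because the coproduct is invariant under the signed flip.
  have hcomm : Commute g h := by
    refine WithConv.ext (LinearMap.ext fun a => ?_)
    have e : LinearMap.mul' ℝ B' ∘ₗ TensorProduct.map h.ofConv g.ofConv =
        (LinearMap.mul' ℝ B' ∘ₗ TensorProduct.map g.ofConv h.ofConv) ∘ₗ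
          gradedSwap (symDeg 𝒱) := by
      apply tensor_ext_deg (symDeg 𝒱) (symDeg 𝒱)
      intro i j x y hx hy
      rw [LinearMap.comp_apply _ (gradedSwap _), gradedSwap_tmul _ hx hy, map_smul]
      exact hc i j x y hx hy
    have := LinearMap.congr_fun e (symComul 𝒱 a)
    rw [LinearMap.comp_apply _ (gradedSwap _), symComul_cocomm] at this
    exact this.symm
  rw [map_convExp D hf hgh (LinearMap.ext hD), convExp_add hg hh hgh hcomm]
  generalize symComul 𝒱 a = t
  induction t using TensorProduct.induction_on with
  | zero => simp
  | add b c hb hc => simp only [map_add, hb, hc]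
  | tmul b c =>
    rw [TensorProduct.map_tmul, TensorProduct.map_tmul, ho, LinearMap.mul'_apply,
      map_convExp inl hf hg rfl, map_convExp inr hf hh rfl]

end ConvExp

/-! ### The Euler operator of the symmetric coalgebra -/

section Euler

variable {V W : Type*} [AddCommGroup V] [Module ℝ V] {𝒱 : ℤ → Submodule ℝ V}
  [DirectSum.Decomposition 𝒱] [AddCommGroup W] [Module ℝ W] {𝒲 : ℤ → Submodule ℝ W}
  [DirectSum.Decomposition 𝒲]

theorem symι_koszul_mul {i : ℤ} {x : W} (hx : x ∈ 𝒲 i) (w : W) :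
    symι 𝒲 (koszul 𝒲 i w) * symι 𝒲 x = symι 𝒲 x * symι 𝒲 w := by
  induction w using deg_induction 𝒲 with
  | h0 => simp
  | hadd a b ha hb => rw [map_add, map_add, add_mul, ha, hb, map_add, mul_add]
  | hd j w hw => rw [koszul_apply _ i hw, map_smul, smul_mul_assoc, symι_comm hx hw]

variable (𝒲) in
/-- The Euler operator, which multiplies each word by its length. -/
def symEuler : Sym 𝒲 →ₗ[ℝ] Sym 𝒲 := coder (symProj 𝒲)

theorem symEuler_one : symEuler 𝒲 1 = 0 := coder_one (symProj_one 𝒲)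

/-- Of the two parts of `Δ (x a)`, the one with `x` on the left contributes `x a`, as the projection
of `x b` is `ε(b) x`. In the other part `x` is moved to the front, and the sign this costs is the
one already present in the coproduct. -/
theorem symEuler_ι_mul {i : ℤ} {x : W} (hx : x ∈ 𝒲 i) (a : Sym 𝒲) :
    symEuler 𝒲 (symι 𝒲 x * a) = symι 𝒲 x * a + symι 𝒲 x * symEuler 𝒲 a := by
  have h1 : ∀ t, insertMap (symProj 𝒲) (TensorProduct.map (LinearMap.mulLeft ℝ (symι 𝒲 x))
      LinearMap.id t) = symι 𝒲 x * TensorProduct.lid ℝ _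
        ((symCounit 𝒲).toLinearMap.rTensor _ t) := by
    intro t
    induction t using TensorProduct.induction_on with
    | zero => simp
    | add b c hb hc => simp only [map_add, hb, hc, mul_add]
    | tmul b c => simp [insertMap_tmul, symProj_ι_mul]
  have h2 : ∀ t, insertMap (symProj 𝒲) (TensorProduct.map (koszul (symDeg 𝒲) i)
      (LinearMap.mulLeft ℝ (symι 𝒲 x)) t) = symι 𝒲 x * insertMap (symProj 𝒲) t := by
    intro t
    induction t using TensorProduct.induction_on with
    | zero => simp
    | add b c hb hc => simp only [map_add, hb, hc, mul_add]
    | tmul b c =>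
      rw [TensorProduct.map_tmul, insertMap_tmul, insertMap_tmul, symProj_koszul,
        LinearMap.mulLeft_apply, ← mul_assoc, ← mul_assoc, symι_koszul_mul hx]
  rw [symEuler, coder_apply, symComul_ι_mul 𝒲 hx, map_add, h1, h2, symCounit_rTensor,
    TensorProduct.lid_tmul, one_smul, coder_apply]

/-- A word of length `k` is an eigenvector of the Euler operator with eigenvalue `k`. Hence `b -
ε(b) 1` lies in a sum of eigenspaces with positive eigenvalues, which meets the kernel only in zero.
-/
theorem eq_smul_one_of_symEuler_eq_zero {b : Sym 𝒲} (hb : symEuler 𝒲 b = 0) :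
    b = symCounit 𝒲 b • 1 := by
  let M : Submodule ℝ (Sym 𝒲) := ⨆ k : ℕ, Module.End.eigenspace (symEuler 𝒲) (k + 1 : ℝ)
  have hM : ∀ {i : ℤ} {x : W}, x ∈ 𝒲 i → ∀ a ∈ M, symι 𝒲 x * a ∈ M := by
    intro i x hx a ha
    induction ha using Submodule.iSup_induction' with
    | zero => rw [mul_zero]; exact zero_mem _
    | add a b _ _ ha hb => rw [mul_add]; exact add_mem ha hb
    | mem k a ha =>
      refine Submodule.mem_iSup_of_mem (k + 1) (Module.End.mem_eigenspace_iff.2 ?_)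
      rw [symEuler_ι_mul hx, Module.End.mem_eigenspace_iff.1 ha, mul_smul_comm]
      push_cast
      module
  have h1 : ∀ a : Sym 𝒲, a - symCounit 𝒲 a • 1 ∈ M := by
    intro a
    refine word_induction (𝒱 := 𝒲) (Env.adjoin_ι 𝒲 0)
      (M.comap (LinearMap.id - (symCounit 𝒲).toLinearMap.smulRight 1)) ?_ ?_ a
    · change 1 - symCounit 𝒲 1 • 1 ∈ M
      rw [map_one, one_smul, sub_self]
      exact zero_mem _
    · intro i x a hx ha
      change a - symCounit 𝒲 a • 1 ∈ M at ha
      change symι 𝒲 x * a - symCounit 𝒲 (symι 𝒲 x * a) • 1 ∈ M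
      -- The word `x` has length one, so it belongs to the eigenspace with index `0` in `M`. The
      -- claim then follows from `x a = x (a - ε(a) 1) + ε(a) x`.
      have hx1 : symι 𝒲 x * 1 ∈ M := by
        refine Submodule.mem_iSup_of_mem 0 (Module.End.mem_eigenspace_iff.2 ?_)
        rw [symEuler_ι_mul hx, symEuler_one, Nat.cast_zero, zero_add, one_smul, mul_zero, add_zero]
      have := add_mem (hM hx _ ha) (Submodule.smul_mem _ (symCounit 𝒲 a) hx1)
      rw [map_mul, symCounit_ι, zero_mul, zero_smul, sub_zero]
      rwa [mul_sub, mul_smul_comm, sub_add_cancel] at this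
  have h2 : b - symCounit 𝒲 b • 1 ∈ Module.End.eigenspace (symEuler 𝒲) 0 := by
    rw [Module.End.mem_eigenspace_iff, map_sub, map_smul, hb, symEuler_one, smul_zero, sub_zero,
      zero_smul]
  have h3 : M ≤ ⨆ μ : ℝ, ⨆ (_ : μ ≠ 0), Module.End.eigenspace (symEuler 𝒲) μ :=
    iSup_le fun k => le_iSup₂_of_le (f := fun μ (_ : μ ≠ 0) => Module.End.eigenspace (symEuler 𝒲) μ)
      (k + 1 : ℝ) (by positivity) le_rfl
  exact sub_eq_zero.1 (Submodule.disjoint_def.1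
    (Module.End.eigenspaces_iSupIndep (symEuler 𝒲) 0) _ h2 (h3 (h1 b)))

/-- A linear map `X : S(V) → S(W)` with `E ∘ X = ψ * X` (convolution product), `ψ(1) = 0` and
`ε ∘ X = 0` vanishes. -/
theorem eq_zero_of_symEuler_comp {X ψ : Sym 𝒱 →ₗ[ℝ] Sym 𝒲} (hψ : ψ 1 = 0)
    (hε : ∀ a, symCounit 𝒲 (X a) = 0)
    (hE : ∀ a, symEuler 𝒲 (X a) =
      LinearMap.mul' ℝ (Sym 𝒲) (TensorProduct.map ψ X (symComul 𝒱 a))) (a : Sym 𝒱) : X a = 0 := by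
  refine conil_induction (LinearMap.ker X) (fun a ha => ?_) a
  -- By the induction hypothesis only the term `1 ⊗ a` of `Δ a` contributes to the convolution of
  -- `ψ` and `X`, and it gives `ψ(1) X(a) = 0`. So `X a` is killed by the Euler operator and is a
  -- constant, and a constant with co-unit zero vanishes.
  have h := mem_of_mem_range_lTensor (Q := LinearMap.ker X)
    (LinearMap.mul' ℝ (Sym 𝒲) ∘ₗ TensorProduct.map ψ X) ⊥ (fun s q hq => by
      change ψ s * X q = 0
      rw [LinearMap.mem_ker.1 hq, mul_zero]) ha
  have h' : LinearMap.mul' ℝ (Sym 𝒲) (TensorProduct.map ψ X (symComul 𝒱 a)) = ψ 1 * X a :=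
    sub_eq_zero.1 ((map_sub (LinearMap.mul' ℝ (Sym 𝒲) ∘ₗ TensorProduct.map ψ X) _ _).symm.trans h)
  rw [hψ, zero_mul, ← hE] at h'
  rw [LinearMap.mem_ker, eq_smul_one_of_symEuler_eq_zero h', hε, zero_smul]

end Euler

/-! ### The symmetric coalgebra is cofree -/

section CoLift

open Filter WithConv

variable {V W : Type*} [AddCommGroup V] [Module ℝ V] {𝒱 : ℤ → Submodule ℝ V}
  [DirectSum.Decomposition 𝒱] [AddCommGroup W] [Module ℝ W] {𝒲 : ℤ → Submodule ℝ W}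
  [DirectSum.Decomposition 𝒲]

theorem toConv_symι_comp_one {φ : Sym 𝒱 →ₗ[ℝ] W} (h1 : φ 1 = 0) :
    (toConv (symι 𝒲 ∘ₗ φ)).ofConv 1 = 0 := by
  change symι 𝒲 (φ 1) = 0
  rw [h1, map_zero]

variable (𝒲) in
/-- The morphism of coalgebras `S(V) → S(W)` with corestriction `φ : S(V) → W`, as the convolution
exponential of `φ`. -/
def coLift (φ : Sym 𝒱 →ₗ[ℝ] W) (h1 : φ 1 = 0) : Sym 𝒱 →ₗ[ℝ] Sym 𝒲 :=
  convExp (toConv (symι 𝒲 ∘ₗ φ)) (toConv_symι_comp_one h1)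

variable {φ : Sym 𝒱 →ₗ[ℝ] W} (h1 : φ 1 = 0)

theorem coLift_one : coLift 𝒲 φ h1 1 = 1 := by
  refine (locSum_eq (N := 1) (convExpTerm_eventually (toConv_symι_comp_one (𝒲 := 𝒲) h1))
    fun n hn => ?_).trans ?_
  · obtain ⟨n, rfl⟩ := Nat.exists_eq_add_of_le' hn
    rw [convExpTerm_apply, pow_succ', conv_mul_apply, symComul_one, TensorProduct.map_tmul,
      toConv_symι_comp_one h1, TensorProduct.zero_tmul, map_zero, smul_zero]
  · rw [Finset.sum_range_one, convExpTerm_apply, pow_zero, Nat.factorial_zero, Nat.cast_one,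
      inv_one, one_smul]
    rw [conv_one_apply, map_one, map_one]

/-- The co-unit is an algebra morphism and kills the values of `φ` in `W`, so it maps the
exponential of `φ` to the exponential of zero, which is the unit of the convolution algebra. -/
theorem symCounit_coLift (a : Sym 𝒱) : symCounit 𝒲 (coLift 𝒲 φ h1 a) = symCounit 𝒱 a := by
  refine (map_convExp (symCounit 𝒲) (toConv_symι_comp_one h1) (f' := 0) (LinearMap.zero_apply _)
    (LinearMap.ext fun x => symCounit_ι 𝒲 (φ x)) a).trans ?_
  exact convExp_zero a

/-- Only the linear term of the exponential series survives the projection to words of length one.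
The zeroth term is a constant. In `f ^ (n + 1) = f * f ^ n` the projection takes the co-unit of the
second factor, and `ε ∘ f ^ n = (ε ∘ f) ^ n` vanishes for `n ≥ 1`. -/
theorem symProj_coLift (a : Sym 𝒱) : symProj 𝒲 (coLift 𝒲 φ h1 a) = φ a := by
  set f : WithConv (Sym 𝒱 →ₗ[ℝ] Sym 𝒲) := toConv (symι 𝒲 ∘ₗ φ) with hf
  have key : ∀ n, symProj 𝒲 ((f ^ (n + 1)).ofConv a) = TensorProduct.rid ℝ W
      (TensorProduct.map φ ((symCounit 𝒲).toLinearMap ∘ₗ (f ^ n).ofConv) (symComul 𝒱 a)) := by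
    intro n
    rw [pow_succ', conv_mul_apply]
    generalize symComul 𝒱 a = t
    induction t using TensorProduct.induction_on with
    | zero => simp
    | add b c hb hc => simp only [map_add, hb, hc]
    | tmul b c => simp [hf, symProj_ι_mul]
  have h0 : toConv ((symCounit 𝒲).toLinearMap ∘ₗ f.ofConv) = 0 :=
    WithConv.ext (LinearMap.ext fun x => symCounit_ι 𝒲 (φ x))
  have hn : ∀ n, n ≠ 1 → symProj 𝒲 (convExpTerm f n a) = 0 := by
    intro n hn
    rw [convExpTerm_apply, map_smul]
    match n, hn with
    | 0, _ =>
      rw [pow_zero, conv_one_apply, Algebra.algebraMap_eq_smul_one, map_smul, symProj_one,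
        smul_zero, smul_zero]
    | n + 2, _ =>
      rw [key, comp_conv_pow, h0, zero_pow (Nat.succ_ne_zero n), ofConv_zero,
        TensorProduct.map_zero_right, LinearMap.zero_apply, map_zero, smul_zero]
  have h2 : symProj 𝒲 (convExpTerm f 1 a) = φ a := by
    rw [convExpTerm_apply, Nat.factorial_one, Nat.cast_one, inv_one, one_smul, pow_one]
    exact symProj_ι 𝒲 (φ a)
  obtain ⟨N, hN⟩ := eventually_atTop.1 (convExpTerm_eventually (toConv_symι_comp_one (𝒲 := 𝒲) h1) a)
  -- The range `N + 2` reaches past the last nonzero term and always contains the index `1`, even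
  -- when `N = 0`.
  have h3 : coLift 𝒲 φ h1 a = ∑ n ∈ Finset.range (N + 2), convExpTerm f n a :=
    locSum_eq (convExpTerm_eventually (toConv_symι_comp_one h1)) fun n hn => hN n (by omega)
  rw [h3, map_sum, Finset.sum_eq_single 1 (fun n _ h => hn n h), h2]
  intro h
  exact absurd (Finset.mem_range.2 (by omega)) h

variable (hφ : ∀ n a, a ∈ symDeg 𝒱 n → φ a ∈ 𝒲 n)
include hφ

/-- A map of degree zero has convolution powers of degree zero, and each homogeneous component of
the target is a subspace, hence closed under the finite sum. -/
theorem coLift_mem (n : ℤ) (a : Sym 𝒱) (ha : a ∈ symDeg 𝒱 n) :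
    coLift 𝒲 φ h1 a ∈ symDeg 𝒲 n := by
  refine locSum_mem (convExpTerm_eventually (toConv_symι_comp_one h1)) _ fun k => ?_
  rw [convExpTerm_apply]
  refine Submodule.smul_mem _ _ ?_
  induction k generalizing n a with
  | zero =>
    rw [pow_zero, conv_one_apply, Algebra.algebraMap_eq_smul_one]
    rcases eq_or_ne n 0 with rfl | hn
    · exact Submodule.smul_mem _ _ SetLike.GradedOne.one_mem
    · rw [symCounit_of_ne 𝒱 n a ha hn, zero_smul]
      exact zero_mem _
  | succ k ih =>
    rw [pow_succ', conv_mul_apply]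
    refine map_mem_of_tensorDeg _ (LinearMap.mul' ℝ (Sym 𝒲) ∘ₗ TensorProduct.map _ _)
      (fun i j x y h hx hy => ?_) (symComul_mem 𝒱 n a ha)
    rw [← h]
    exact SetLike.GradedMul.mul_mem (gen_mem (hφ i x hx)) (ih j y hy)

/-- The values of `φ` are generators of `S(W)`, hence primitive, so their exponential is compatible
with the coproducts. -/
theorem symComul_coLift (a : Sym 𝒱) : symComul 𝒲 (coLift 𝒲 φ h1 a) =
    TensorProduct.map (coLift 𝒲 φ h1) (coLift 𝒲 φ h1) (symComul 𝒱 a) := by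
  -- The coproduct is multiplicative only for the signed product on `S(W) ⊗ S(W)`, so the comparison
  -- is made in the graded tensor product.
  refine (GradedTensorProduct.of ℝ (symDeg 𝒲) (symDeg 𝒲)).injective ?_
  refine map_convExp_eq_of_add (toConv_symι_comp_one (𝒲 := 𝒲) h1) (symComulAlg 𝒲)
    (GradedTensorProduct.includeLeft (symDeg 𝒲) (symDeg 𝒲))
    (GradedTensorProduct.includeRight (symDeg 𝒲) (symDeg 𝒲))
    (GradedTensorProduct.of ℝ (symDeg 𝒲) (symDeg 𝒲)).toLinearMap
    (fun b c => (GradedTensorProduct.tmul_one_mul_one_tmul _ _ b c).symm)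
    (fun x => (Env.lift_ι _ _ (φ x)).trans
      (map_add (GradedTensorProduct.of ℝ (symDeg 𝒲) (symDeg 𝒲)) (symι 𝒲 (φ x) ⊗ₜ 1)
        (1 ⊗ₜ symι 𝒲 (φ x)))) (fun i j x y hx hy => ?_) a
  have hx' : symι 𝒲 (φ x) ∈ symDeg 𝒲 i := gen_mem (hφ i x hx)
  have hy' : symι 𝒲 (φ y) ∈ symDeg 𝒲 j := gen_mem (hφ j y hy)
  have h1 : (1 : Sym 𝒲) ∈ symDeg 𝒲 0 := SetLike.GradedOne.one_mem
  -- The sign in the graded tensor product is determined by the degrees of `φ x` and `φ y`, which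
  -- equal those of `x` and `y` because `φ` has degree zero.
  change GradedTensorProduct.tmul ℝ (1 : Sym 𝒲) (symι 𝒲 (φ x)) *
      GradedTensorProduct.tmul ℝ (symι 𝒲 (φ y)) (1 : Sym 𝒲) =
    sgn (i * j) • (GradedTensorProduct.tmul ℝ (symι 𝒲 (φ y)) (1 : Sym 𝒲) *
      GradedTensorProduct.tmul ℝ (1 : Sym 𝒲) (symι 𝒲 (φ x)))
  rw [gradedTensor_mul _ _ _ _ _ hx' hy', gradedTensor_mul _ _ _ _ _ h1 h1, one_mul, mul_one,
    one_mul, mul_one, mul_zero, sgn_zero, one_smul]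

end CoLift

/-! ### Morphisms of symmetric coalgebras are determined by their corestrictions -/

section Corestriction

variable {V W : Type*} [AddCommGroup V] [Module ℝ V] {𝒱 : ℤ → Submodule ℝ V}
  [DirectSum.Decomposition 𝒱] [AddCommGroup W] [Module ℝ W] {𝒲 : ℤ → Submodule ℝ W}
  [DirectSum.Decomposition 𝒲]

theorem symComul_parity (x : Sym 𝒱) : symComul 𝒱 (parity (symDeg 𝒱) x) =
    TensorProduct.map (parity (symDeg 𝒱)) (parity (symDeg 𝒱)) (symComul 𝒱 x) := by
  have h := symComul_koszul 𝒱 1 x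
  have e : koszul (symDeg 𝒱) 1 = parity (symDeg 𝒱) := if_neg (by decide)
  rwa [e] at h

variable {Φ Ψ : Sym 𝒱 →ₗ[ℝ] Sym 𝒲}

/-- The Euler operator is the convolution product of the projection to generators with the identity,
and precomposition with a coalgebra morphism distributes over convolution. -/
theorem symEuler_comp (hΦ : ∀ a, symComul 𝒲 (Φ a) = TensorProduct.map Φ Φ (symComul 𝒱 a))
    (a : Sym 𝒱) : symEuler 𝒲 (Φ a) = LinearMap.mul' ℝ (Sym 𝒲)
      (TensorProduct.map (symι 𝒲 ∘ₗ symProj 𝒲 ∘ₗ Φ) Φ (symComul 𝒱 a)) := by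
  rw [symEuler, coder_apply, hΦ, insertMap, LinearMap.comp_apply, ← LinearMap.comp_apply
    (TensorProduct.map _ _), ← TensorProduct.map_comp]
  rfl

/-- With equal corestrictions, `symEuler_comp` gives `E Φ = ψ * Φ` and `E Ψ = ψ * Ψ` with the same
`ψ`. The difference then satisfies the linear equation of `eq_zero_of_symEuler_comp`. -/
theorem eq_of_symProj_eq (hΦ1 : Φ 1 = 1) (hΦε : ∀ a, symCounit 𝒲 (Φ a) = symCounit 𝒱 a)
    (hΨε : ∀ a, symCounit 𝒲 (Ψ a) = symCounit 𝒱 a)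
    (hΦ : ∀ a, symComul 𝒲 (Φ a) = TensorProduct.map Φ Φ (symComul 𝒱 a))
    (hΨ : ∀ a, symComul 𝒲 (Ψ a) = TensorProduct.map Ψ Ψ (symComul 𝒱 a))
    (h : ∀ a, symProj 𝒲 (Φ a) = symProj 𝒲 (Ψ a)) : Φ = Ψ := by
  refine sub_eq_zero.1 (LinearMap.ext fun a => ?_)
  refine eq_zero_of_symEuler_comp (ψ := symι 𝒲 ∘ₗ symProj 𝒲 ∘ₗ Φ) ?_ (fun a => ?_)
    (fun a => ?_) a
  · simp [hΦ1, symProj_one]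
  · rw [LinearMap.sub_apply, map_sub, hΦε, hΨε, sub_self]
  · have e : symProj 𝒲 ∘ₗ Ψ = symProj 𝒲 ∘ₗ Φ := LinearMap.ext fun a => (h a).symm
    have e2 : TensorProduct.map (symι 𝒲 ∘ₗ symProj 𝒲 ∘ₗ Φ) (Φ - Ψ) =
        TensorProduct.map (symι 𝒲 ∘ₗ symProj 𝒲 ∘ₗ Φ) Φ -
          TensorProduct.map (symι 𝒲 ∘ₗ symProj 𝒲 ∘ₗ Φ) Ψ :=
      map_sub (TensorProduct.mapBilinear (RingHom.id ℝ) _ _ _ _ _) Φ Ψ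
    rw [LinearMap.sub_apply, map_sub, symEuler_comp hΦ, symEuler_comp hΨ, e, e2,
      LinearMap.sub_apply, map_sub]

/-- A morphism of coalgebras is compatible with coderivations if its corestriction is. -/
theorem map_coder_of_symProj {l : Sym 𝒱 →ₗ[ℝ] V} {l' : Sym 𝒲 →ₗ[ℝ] W}
    (hl : ∀ n x, x ∈ symDeg 𝒱 n → l x ∈ 𝒱 (n + 1)) (hl' : ∀ n x, x ∈ symDeg 𝒲 n → l' x ∈ 𝒲 (n + 1))
    (hΦ1 : Φ 1 = 1) (hΦε : ∀ a, symCounit 𝒲 (Φ a) = symCounit 𝒱 a)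
    (hΦ : ∀ a, symComul 𝒲 (Φ a) = TensorProduct.map Φ Φ (symComul 𝒱 a))
    (hΦd : ∀ n x, x ∈ symDeg 𝒱 n → Φ x ∈ symDeg 𝒲 n)
    (h : ∀ a, symProj 𝒲 (Φ (coder l a)) = l' (Φ a)) (a : Sym 𝒱) :
    Φ (coder l a) = coder l' (Φ a) := by
  -- The defect `X` is an odd coderivation along `Φ`: one has `Δ X = (X ⊗ Φ + Φ P ⊗ X) Δ`, with `P`
  -- the degree involution. The hypothesis on corestrictions says that `X` has no component in words
  -- of length one.
  let X : Sym 𝒱 →ₗ[ℝ] Sym 𝒲 := Φ ∘ₗ coder l - coder l' ∘ₗ Φ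
  have hpX : symProj 𝒲 ∘ₗ X = 0 := LinearMap.ext fun a => by
    change symProj 𝒲 (Φ (coder l a) - coder l' (Φ a)) = 0
    rw [map_sub, h, symProj_coder, sub_self]
  refine sub_eq_zero.1 (eq_zero_of_symEuler_comp (X := X)
    -- The degree involution in `ψ` comes from the second term of `Δ X`; the first term drops out of
    -- the Euler operator because `X` projects to zero.
    (ψ := symι 𝒲 ∘ₗ symProj 𝒲 ∘ₗ Φ ∘ₗ parity (symDeg 𝒱)) ?_ (fun a => ?_) (fun a => ?_) a)
  · simp [parity_one, hΦ1, symProj_one]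
  · change symCounit 𝒲 (Φ (coder l a) - coder l' (Φ a)) = 0
    rw [map_sub, hΦε, symCounit_coder, symCounit_coder, sub_self]
  · have hΔ : ∀ t : Sym 𝒱 ⊗[ℝ] Sym 𝒱,
        TensorProduct.map Φ Φ (TensorProduct.map (coder l) LinearMap.id t +
          TensorProduct.map (parity (symDeg 𝒱)) (coder l) t) -
        (TensorProduct.map (coder l') LinearMap.id (TensorProduct.map Φ Φ t) +
          TensorProduct.map (parity (symDeg 𝒲)) (coder l') (TensorProduct.map Φ Φ t)) =
        TensorProduct.map X Φ t + TensorProduct.map (Φ ∘ₗ parity (symDeg 𝒱)) X t := by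
      intro t
      induction t using TensorProduct.induction_on with
      | zero => simp
      | add b c hb hc =>
        simp only [map_add] at hb hc ⊢
        rw [add_add_add_comm (TensorProduct.map X Φ b), ← hb, ← hc]
        abel
      | tmul b c =>
        simp only [map_add, TensorProduct.map_tmul, LinearMap.id_apply, X, LinearMap.sub_apply,
          LinearMap.comp_apply, TensorProduct.sub_tmul, TensorProduct.tmul_sub,
          map_parity Φ hΦd]
        abel
    have e : symComul 𝒲 (X a) = TensorProduct.map X Φ (symComul 𝒱 a) +
        TensorProduct.map (Φ ∘ₗ parity (symDeg 𝒱)) X (symComul 𝒱 a) := by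
      rw [← hΔ, ← symComul_coder hl, ← hΦ, ← hΦ, ← symComul_coder hl', ← map_sub]
      rfl
    rw [symEuler, coder_apply, e, map_add]
    generalize symComul 𝒱 a = t
    have h1 : insertMap (symProj 𝒲) ∘ₗ TensorProduct.map X Φ = 0 := by
      rw [insertMap, LinearMap.comp_assoc, ← TensorProduct.map_comp, LinearMap.comp_assoc, hpX,
        LinearMap.comp_zero, TensorProduct.map_zero_left, LinearMap.comp_zero]
    have h2 := LinearMap.congr_fun h1 t
    rw [LinearMap.comp_apply, LinearMap.zero_apply] at h2
    rw [h2, zero_add, insertMap, LinearMap.comp_apply, ← LinearMap.comp_apply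
      (TensorProduct.map _ _), ← TensorProduct.map_comp]
    rfl

end Corestriction

/-! ### `L∞`-morphisms into a differential graded algebra -/

section IntoSigma

variable (A : DGA.{u})

/-- The multiplication of a differential graded algebra. -/
def sigmaMul : (SigmaDG.obj A).carrier ⊗[ℝ] (SigmaDG.obj A).carrier →ₗ[ℝ]
    (SigmaDG.obj A).carrier := LinearMap.mul' ℝ A.carrier

/-- On a tensor that is symmetric for the suspended grading, the two products in the graded
commutator contribute equally, so half of the bracket is the associative product. The degree
involution is the sign `(-1)^{|s x|}` in the binary structure map. -/
theorem suspBracket_eq_sigmaMul (t : (SigmaDG.obj A).carrier ⊗[ℝ] (SigmaDG.obj A).carrier)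
    (ht : gradedSwap (susp (SigmaDG.obj A).deg) t = t) :
    (1 / 2 : ℝ) • suspBracket (SigmaDG.obj A) t =
      sigmaMul A (TensorProduct.map (parity (susp (SigmaDG.obj A).deg)) LinearMap.id t) := by
  -- Before any symmetry is imposed, the suspended commutator is the signed product precomposed with
  -- the identity plus the flip. The minus sign of the commutator is absorbed in the shift of
  -- degrees by one.
  have h : suspBracket (SigmaDG.obj A) =
      (sigmaMul A ∘ₗ TensorProduct.map (parity (susp (SigmaDG.obj A).deg)) LinearMap.id) ∘ₗ
        (LinearMap.id + gradedSwap (susp (SigmaDG.obj A).deg)) := by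
    apply tensor_ext_deg (susp (SigmaDG.obj A).deg) (susp (SigmaDG.obj A).deg)
    intro i j x y hx hy
    have hm : ∀ {k : ℤ} {x : (SigmaDG.obj A).carrier}, x ∈ susp (SigmaDG.obj A).deg k → ∀ y,
        (sigmaMul A ∘ₗ TensorProduct.map (parity (susp (SigmaDG.obj A).deg)) LinearMap.id)
          (x ⊗ₜ y) = sgn k • sigmaMul A (x ⊗ₜ y) := by
      intro k x hx y
      rw [LinearMap.comp_apply, TensorProduct.map_tmul, parity_apply _ hx, LinearMap.id_apply,
        ← TensorProduct.smul_tmul', map_smul]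
    have hb : (SigmaDG.obj A).bracket x y =
        sigmaMul A (x ⊗ₜ y) - sgn ((i + 1) * (j + 1)) • sigmaMul A (y ⊗ₜ x) :=
      commutator_apply A.deg (x := x) (y := y) hx hy
    rw [suspBracket_tmul _ hx, LinearMap.comp_apply _ (LinearMap.id + _), LinearMap.add_apply,
      LinearMap.id_apply, gradedSwap_tmul _ hx hy, map_add, map_smul, hm hx, hm hy, hb]
    simp only [add_mul, mul_add, one_mul, mul_one, sgn_add, sgn_one]
    rcases sgn_eq i with ⟨-, h⟩ | ⟨-, h⟩ <;> rcases sgn_eq j with ⟨-, h'⟩ | ⟨-, h'⟩ <;>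
      rw [h, h'] <;> module
  rw [h, LinearMap.comp_apply, LinearMap.add_apply, LinearMap.id_apply, ht,
    LinearMap.comp_apply, ← two_smul ℝ t, map_smul, map_smul]
  module

/-- Cocommutativity of the coproduct makes `suspBracket_eq_sigmaMul` applicable, so the structure
map of `Σ∞ A` can be written with the associative product. -/
theorem iotaL_sigma (x : Sym (susp (SigmaDG.obj A).deg)) : iotaL (SigmaDG.obj A) x =
    sigmaMul A (TensorProduct.map
      (parity (susp (SigmaDG.obj A).deg) ∘ₗ symProj (susp (SigmaDG.obj A).deg))
      (symProj (susp (SigmaDG.obj A).deg)) (symComul (susp (SigmaDG.obj A).deg) x)) -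
    (SigmaDG.obj A).d (symProj (susp (SigmaDG.obj A).deg) x) := by
  rw [iotaL_apply, suspBracket_eq_sigmaMul A _ (swap_symProj _ x), ← LinearMap.comp_apply
    (TensorProduct.map _ _), ← TensorProduct.map_comp, LinearMap.id_comp]

/-! ### The corestriction equation and the Maurer–Cartan equation -/

variable {A} {g : LInfty.{u}}

/-- A linear map `φ : S(s g) → s A` of degree `0` with `φ(1) = 0` is the corestriction of an
`L∞`-morphism if and only if it satisfies this equation. -/
def IsCorestriction (φ : Sym (susp g.deg) →ₗ[ℝ] (SigmaDG.obj A).carrier) : Prop :=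
  ∀ a, φ (coder g.l a) = sigmaMul A (TensorProduct.map (φ ∘ₗ parity (symDeg (susp g.deg))) φ
    (symComul (susp g.deg) a)) - (SigmaDG.obj A).d (φ a)

/-- The structure map of `Σ∞ A` has only unary and binary parts, both expressed through the
projection to words of length one. Along a coalgebra morphism it therefore depends only on the
corestriction, which makes the compatibility with differentials an equation for that corestriction
alone. -/
theorem iotaL_comp {Φ : Sym (susp g.deg) →ₗ[ℝ] Sym (susp (SigmaDG.obj A).deg)}
    (hΦ : ∀ a, symComul _ (Φ a) = TensorProduct.map Φ Φ (symComul _ a))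
    (hΦd : ∀ n x, x ∈ symDeg (susp g.deg) n → Φ x ∈ symDeg (susp (SigmaDG.obj A).deg) n)
    (a : Sym (susp g.deg)) : iotaL (SigmaDG.obj A) (Φ a) =
      sigmaMul A (TensorProduct.map ((symProj _ ∘ₗ Φ) ∘ₗ parity (symDeg (susp g.deg)))
        (symProj _ ∘ₗ Φ) (symComul (susp g.deg) a)) - (SigmaDG.obj A).d (symProj _ (Φ a)) := by
  have e : (symProj (susp (SigmaDG.obj A).deg) ∘ₗ Φ) ∘ₗ parity (symDeg (susp g.deg)) =
      (parity (susp (SigmaDG.obj A).deg) ∘ₗ symProj (susp (SigmaDG.obj A).deg)) ∘ₗ Φ :=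
    LinearMap.ext fun x => map_parity (symProj (susp (SigmaDG.obj A).deg) ∘ₗ Φ)
      (fun n x hx => symProj_mem _ n _ (hΦd n x hx)) x
  rw [iotaL_sigma, hΦ, e, TensorProduct.map_comp]
  rfl

theorem coder_parity (x : Sym (susp g.deg)) : coder g.l (parity (symDeg (susp g.deg)) x) =
    -parity (symDeg (susp g.deg)) (coder g.l x) :=
  map_parity_succ (coder g.l) (coder_mem g.l_mem) x

/-- The coproduct has degree zero, so the degree involution of `a` acts on both tensor factors; on
the first it cancels the one already there. The net effect is to move the sign from the first factor
to the second. -/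
theorem map_map_parity {X Y : Type*} [AddCommGroup X] [Module ℝ X] [AddCommGroup Y] [Module ℝ Y]
    (α : Sym (susp g.deg) →ₗ[ℝ] X) (β : Sym (susp g.deg) →ₗ[ℝ] Y) (a : Sym (susp g.deg)) :
    TensorProduct.map (α ∘ₗ parity (symDeg (susp g.deg))) β
      (symComul (susp g.deg) (parity (symDeg (susp g.deg)) a)) =
    TensorProduct.map α (β ∘ₗ parity (symDeg (susp g.deg))) (symComul (susp g.deg) a) := by
  rw [symComul_parity, ← LinearMap.comp_apply (TensorProduct.map _ _), ← TensorProduct.map_comp]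
  have e : (α ∘ₗ parity (symDeg (susp g.deg))) ∘ₗ parity (symDeg (susp g.deg)) = α :=
    LinearMap.ext fun x => congrArg α (parity_parity _ x)
  rw [e]

/-- The twisting cochain of the corestriction of an `L∞`-morphism. -/
def cochainOfCorestriction (φ : Sym (susp g.deg) →ₗ[ℝ] (SigmaDG.obj A).carrier) (h1 : φ 1 = 0)
    (hφ : ∀ n x, x ∈ symDeg (susp g.deg) n → φ x ∈ susp (SigmaDG.obj A).deg n)
    (h : IsCorestriction φ) : TwistingCochain (CEObj g) A where
  -- The degree involution anticommutes with the coderivation and so corrects the relative sign of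
  -- the two linear terms. The overall minus sign leaves the linear terms unaffected, but changes
  -- the sign of the quadratic term relative to them, as the Maurer–Cartan equation requires.
  toLinearMap := -(φ ∘ₗ parity (symDeg (susp g.deg)))
  map_coaug := by
    change -(φ (parity (symDeg (susp g.deg)) 1)) = 0
    rw [parity_one, h1, neg_zero]
  map_mem n x hx := neg_mem (hφ n _ (parity_mem _ hx))
  maurerCartan := fun (x : Sym (susp g.deg)) => by
    -- The equation is taken at the signed argument, so that `φ` occurs in its linear terms in the
    -- combination that defines the cochain.
    have e := h (parity (symDeg (susp g.deg)) x)
    rw [map_map_parity, coder_parity, map_neg] at e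
    have e1 : (-(φ ∘ₗ parity (symDeg (susp g.deg)))) ∘ₗ parity (symDeg (susp g.deg)) = -φ :=
      LinearMap.ext fun x => congrArg (fun y => -φ y) (parity_parity _ x)
    have e2 : TensorProduct.map (-φ) (-(φ ∘ₗ parity (symDeg (susp g.deg))))
        (symComul (susp g.deg) x) =
        TensorProduct.map φ (φ ∘ₗ parity (symDeg (susp g.deg))) (symComul (susp g.deg) x) := by
      generalize symComul (susp g.deg) x = t
      induction t using TensorProduct.induction_on with
      | zero => simp
      | add b c hb hc => simp only [map_add, hb, hc]
      | tmul b c => simp [TensorProduct.neg_tmul, TensorProduct.tmul_neg]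
    change (SigmaDG.obj A).d (-φ (parity (symDeg (susp g.deg)) x)) =
      -φ (parity (symDeg (susp g.deg)) (coder g.l x)) - sigmaMul A (TensorProduct.map
        ((-(φ ∘ₗ parity (symDeg (susp g.deg)))) ∘ₗ parity (symDeg (susp g.deg)))
        (-(φ ∘ₗ parity (symDeg (susp g.deg)))) (symComul (susp g.deg) x))
    rw [e1, e2, map_neg, e]
    abel

/-- The corestriction of the `L∞`-morphism determined by a twisting cochain. -/
def corestriction (τ : TwistingCochain (CEObj g) A) :
    Sym (susp g.deg) →ₗ[ℝ] (SigmaDG.obj A).carrier :=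
  -- The same formula as for `cochainOfCorestriction`: the degree involution squares to the
  -- identity, so the substitution is its own inverse.
  -(show Sym (susp g.deg) →ₗ[ℝ] (SigmaDG.obj A).carrier from τ.toLinearMap) ∘ₗ
    parity (symDeg (susp g.deg))

theorem corestriction_apply (τ : TwistingCochain (CEObj g) A) (x : Sym (susp g.deg)) :
    corestriction τ x = -τ.toLinearMap (parity (symDeg (susp g.deg)) x) := rfl

theorem corestriction_one (τ : TwistingCochain (CEObj g) A) : corestriction τ 1 = 0 := by
  rw [corestriction_apply, parity_one]
  exact neg_eq_zero.2 τ.map_coaug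

theorem corestriction_mem (τ : TwistingCochain (CEObj g) A) (n : ℤ) (x : Sym (susp g.deg))
    (hx : x ∈ symDeg (susp g.deg) n) : corestriction τ x ∈ susp (SigmaDG.obj A).deg n :=
  neg_mem (τ.map_mem n _ (parity_mem _ hx))

/-- The Maurer–Cartan equation at the signed argument, with the same sign bookkeeping as in
`cochainOfCorestriction` read backwards. -/
theorem isCorestriction_corestriction (τ : TwistingCochain (CEObj g) A) :
    IsCorestriction (corestriction τ) := by
  intro a
  let σ : Sym (susp g.deg) →ₗ[ℝ] (SigmaDG.obj A).carrier := τ.toLinearMap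
  have e : (SigmaDG.obj A).d (σ (parity (symDeg (susp g.deg)) a)) =
      σ (coder g.l (parity (symDeg (susp g.deg)) a)) - sigmaMul A (TensorProduct.map
        (σ ∘ₗ parity (symDeg (susp g.deg))) σ
        (symComul (susp g.deg) (parity (symDeg (susp g.deg)) a))) :=
    τ.maurerCartan (parity (symDeg (susp g.deg)) a)
  rw [map_map_parity, coder_parity, map_neg] at e
  have e1 : corestriction τ ∘ₗ parity (symDeg (susp g.deg)) = -σ :=
    LinearMap.ext fun x => congrArg (fun y => -σ y) (parity_parity _ x)
  have e2 : TensorProduct.map (-σ) (corestriction τ) (symComul (susp g.deg) a) =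
      TensorProduct.map σ (σ ∘ₗ parity (symDeg (susp g.deg))) (symComul (susp g.deg) a) := by
    generalize symComul (susp g.deg) a = t
    induction t using TensorProduct.induction_on with
    | zero => simp
    | add b c hb hc => simp only [map_add, hb, hc]
    | tmul b c =>
      change (-σ b) ⊗ₜ[ℝ] (-σ (parity (symDeg (susp g.deg)) c)) = _
      rw [TensorProduct.neg_tmul, TensorProduct.tmul_neg, neg_neg]
      rfl
  rw [e1, e2]
  change -σ (parity (symDeg (susp g.deg)) (coder g.l a)) =
    _ - (SigmaDG.obj A).d (-σ (parity (symDeg (susp g.deg)) a))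
  rw [map_neg, e]
  abel

/-! ### `L∞`-morphisms to `Σ∞ A` and their twisting cochains -/

/-- The linear map underlying an `L∞`-morphism into a differential graded algebra. -/
def linOfHom (f : g ⟶ SigmaInf.obj A) :
    Sym (susp g.deg) →ₗ[ℝ] Sym (susp (SigmaDG.obj A).deg) :=
  DGCCa.Hom.toCoalgHom f |>.toLinearMap

theorem linOfHom_one (f : g ⟶ SigmaInf.obj A) : linOfHom f 1 = 1 := DGCCa.Hom.map_coaug f

theorem linOfHom_counit (f : g ⟶ SigmaInf.obj A) (a : Sym (susp g.deg)) :
    symCounit _ (linOfHom f a) = symCounit _ a := DGCCa.Hom.counit_apply f a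

theorem linOfHom_comul (f : g ⟶ SigmaInf.obj A) (a : Sym (susp g.deg)) :
    symComul _ (linOfHom f a) = TensorProduct.map (linOfHom f) (linOfHom f) (symComul _ a) :=
  DGCCa.Hom.comul_apply f a

theorem linOfHom_mem (f : g ⟶ SigmaInf.obj A) (n : ℤ) (x : Sym (susp g.deg))
    (hx : x ∈ symDeg (susp g.deg) n) : linOfHom f x ∈ symDeg (susp (SigmaDG.obj A).deg) n :=
  DGCCa.Hom.map_deg f n x hx

theorem linOfHom_coder (f : g ⟶ SigmaInf.obj A) (a : Sym (susp g.deg)) :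
    linOfHom f (coder g.l a) = coder (iotaL (SigmaDG.obj A)) (linOfHom f a) :=
  DGCCa.Hom.map_d f a

theorem linOfHom_injective {f f' : g ⟶ SigmaInf.obj A} (h : linOfHom f = linOfHom f') : f = f' :=
  DGCCa.Hom.ext (CoalgHom.ext fun x => LinearMap.congr_fun h x)

/-- The compatibility of `f` with the coderivations is projected to words of length one; there the
coderivation of the target becomes its structure map, evaluated by `iotaL_comp`. -/
theorem isCorestriction_linOfHom (f : g ⟶ SigmaInf.obj A) :
    IsCorestriction (symProj _ ∘ₗ linOfHom f) := fun a => by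
  refine Eq.trans ?_ (iotaL_comp (linOfHom_comul f) (linOfHom_mem f) a)
  rw [LinearMap.comp_apply, linOfHom_coder, symProj_coder]

/-- The twisting cochain of an `L∞`-morphism into a differential graded algebra. -/
def cochainOfLInf (f : g ⟶ SigmaInf.obj A) : TwistingCochain (CEObj g) A :=
  cochainOfCorestriction (symProj _ ∘ₗ linOfHom f)
    (by rw [LinearMap.comp_apply, linOfHom_one, symProj_one])
    (fun n x hx => symProj_mem _ n _ (linOfHom_mem f n x hx)) (isCorestriction_linOfHom f)

theorem cochainOfLInf_apply (f : g ⟶ SigmaInf.obj A) (x : Sym (susp g.deg)) :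
    (cochainOfLInf f).toLinearMap x =
      -symProj _ (linOfHom f (parity (symDeg (susp g.deg)) x)) := rfl

/-- The morphism of coalgebras determined by a twisting cochain. -/
def cochainCoLift (τ : TwistingCochain (CEObj g) A) :
    Sym (susp g.deg) →ₗ[ℝ] Sym (susp (SigmaDG.obj A).deg) :=
  coLift (susp (SigmaDG.obj A).deg) (corestriction τ) (corestriction_one τ)

theorem symProj_cochainCoLift (τ : TwistingCochain (CEObj g) A) (a : Sym (susp g.deg)) :
    symProj _ (cochainCoLift τ a) = corestriction τ a := symProj_coLift _ a

theorem cochainCoLift_one (τ : TwistingCochain (CEObj g) A) : cochainCoLift τ 1 = 1 :=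
  coLift_one _

theorem cochainCoLift_counit (τ : TwistingCochain (CEObj g) A) (a : Sym (susp g.deg)) :
    symCounit _ (cochainCoLift τ a) = symCounit _ a :=
  symCounit_coLift _ a

theorem cochainCoLift_mem (τ : TwistingCochain (CEObj g) A) (n : ℤ) (a : Sym (susp g.deg))
    (ha : a ∈ symDeg (susp g.deg) n) :
    cochainCoLift τ a ∈ symDeg (susp (SigmaDG.obj A).deg) n :=
  coLift_mem _ (corestriction_mem τ) n a ha

theorem cochainCoLift_comul (τ : TwistingCochain (CEObj g) A) (a : Sym (susp g.deg)) :
    symComul _ (cochainCoLift τ a) =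
      TensorProduct.map (cochainCoLift τ) (cochainCoLift τ) (symComul _ a) :=
  symComul_coLift _ (corestriction_mem τ) a

/-- By `map_coder_of_symProj` only the corestrictions have to be compared, and their equality is the
equation `IsCorestriction` satisfied by `corestriction τ`. -/
theorem cochainCoLift_coder (τ : TwistingCochain (CEObj g) A) (a : Sym (susp g.deg)) :
    cochainCoLift τ (coder g.l a) = coder (iotaL (SigmaDG.obj A)) (cochainCoLift τ a) := by
  refine map_coder_of_symProj g.l_mem (iotaL_mem (SigmaDG.obj A)) (cochainCoLift_one τ)
    (cochainCoLift_counit τ) (cochainCoLift_comul τ) (cochainCoLift_mem τ) (fun a => ?_) a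
  have e : symProj (susp (SigmaDG.obj A).deg) ∘ₗ cochainCoLift τ = corestriction τ :=
    LinearMap.ext (symProj_cochainCoLift τ)
  have h := iotaL_comp (Φ := cochainCoLift τ)
    (cochainCoLift_comul τ) (cochainCoLift_mem τ) a
  rw [e, symProj_cochainCoLift, ← isCorestriction_corestriction τ a] at h
  exact (symProj_cochainCoLift τ _).trans h.symm

/-- The `L∞`-morphism determined by a twisting cochain. -/
def lInfOfCochain (τ : TwistingCochain (CEObj g) A) : g ⟶ SigmaInf.obj A :=
  DGCCa.Hom.mk (C := CEObj g) (D := CEObj (iotaObj (SigmaDG.obj A)))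
    (toCoalgHom :=
      { toLinearMap := cochainCoLift τ
        counit_comp := LinearMap.ext (cochainCoLift_counit τ)
        map_comp_comul := LinearMap.ext fun x =>
          (cochainCoLift_comul τ x).symm })
    (map_deg := cochainCoLift_mem τ)
    (map_d := cochainCoLift_coder τ)
    (map_coaug := cochainCoLift_one τ)

theorem linOfHom_lInfOfCochain (τ : TwistingCochain (CEObj g) A) :
    linOfHom (lInfOfCochain τ) = cochainCoLift τ := rfl

variable (g A) in
/-- `L∞`-morphisms into a differential graded algebra are the same thing as twisting cochains. -/
def lInfHomEquiv : (g ⟶ SigmaInf.obj A) ≃ TwistingCochain (CEObj g) A where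
  toFun := cochainOfLInf
  invFun := lInfOfCochain
  left_inv f := linOfHom_injective <| by
    -- Cofreeness: both maps are co-unital, co-augmented coalgebra morphisms, so comparing
    -- corestrictions suffices, and these agree because the sign substitution is an involution.
    refine eq_of_symProj_eq (linOfHom_one _) (linOfHom_counit _) (linOfHom_counit _)
      (linOfHom_comul _) (linOfHom_comul _) fun a => ?_
    rw [linOfHom_lInfOfCochain, symProj_cochainCoLift, corestriction_apply]
    refine (congrArg Neg.neg (cochainOfLInf_apply f _)).trans ?_
    rw [parity_parity]
    exact neg_neg (symProj (susp (SigmaDG.obj A).deg) (linOfHom f a))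
  right_inv τ := by
    refine TwistingCochain.ext (LinearMap.ext fun (x : Sym (susp g.deg)) => ?_)
    refine (cochainOfLInf_apply (lInfOfCochain τ) x).trans ?_
    rw [linOfHom_lInfOfCochain, symProj_cochainCoLift, corestriction_apply, parity_parity]
    exact neg_neg (τ.toLinearMap x)

/-- Naturality in the `L∞`-algebra. A morphism of coalgebras preserves degrees, so it commutes with
the sign in the twisting cochain, and precomposition passes through. -/
theorem cochainOfLInf_comp {g' : LInfty.{u}} (k : g' ⟶ g) (f : g ⟶ SigmaInf.obj A)
    (x : Sym (susp g'.deg)) : (cochainOfLInf (k ≫ f)).toLinearMap x =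
      (cochainOfLInf f).toLinearMap (DGCCa.Hom.toCoalgHom k x) := by
  refine (cochainOfLInf_apply (k ≫ f) x).trans
    (Eq.trans ?_ (cochainOfLInf_apply f (DGCCa.Hom.toCoalgHom k x)).symm)
  have h := map_parity (𝒱 := symDeg (susp g'.deg)) (𝒲 := symDeg (susp g.deg))
    (DGCCa.Hom.toCoalgHom k).toLinearMap (DGCCa.Hom.map_deg k) x
  exact congrArg (fun y => -symProj (susp (SigmaDG.obj A).deg) (linOfHom f y)) h

/-- Naturality in the algebra. The morphism induced by `k` has no higher components, so projecting
to words of length one turns it into `k` itself. -/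
theorem cochainOfLInf_map {B : DGA.{u}} (f : g ⟶ SigmaInf.obj A) (k : A ⟶ B)
    (x : Sym (susp g.deg)) : (cochainOfLInf (f ≫ SigmaInf.map k)).toLinearMap x =
      k.toAlgHom ((cochainOfLInf f).toLinearMap x) := by
  refine (cochainOfLInf_apply (f ≫ SigmaInf.map k) x).trans ?_
  refine Eq.trans ?_ (map_neg k.toAlgHom _).symm
  exact congrArg Neg.neg (symProj_symMap _ (map_susp (SigmaDG.map k))
    (linOfHom f (parity (symDeg (susp g.deg)) x)))

end IntoSigma

/-! ### The adjunction -/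

/-- The bijection of the adjunction. -/
def uInfHomEquiv (g : LInfty.{u}) (A : DGA.{u}) : (UInf.obj g ⟶ A) ≃ (g ⟶ SigmaInf.obj A) :=
  (envHomEquiv (CEObj g) A).trans (lInfHomEquiv A g).symm

theorem cochainOfLInf_uInfHomEquiv {g : LInfty.{u}} {A : DGA.{u}} (F : UInf.obj g ⟶ A) :
    cochainOfLInf (uInfHomEquiv g A F) = cochainOfHom (C := CEObj g) F :=
  (lInfHomEquiv A g).apply_symm_apply _

theorem cochainOfHom_uInfHomEquiv_symm {g : LInfty.{u}} {A : DGA.{u}} (f : g ⟶ SigmaInf.obj A) :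
    cochainOfHom (C := CEObj g) ((uInfHomEquiv g A).symm f) = cochainOfLInf f :=
  (envHomEquiv (CEObj g) A).apply_symm_apply (cochainOfLInf f)

/-- The adjunction between `U∞` and `Σ∞`. -/
def uInfAdjunction : UInf.{u} ⊣ SigmaInf.{u} := Adjunction.mkOfHomEquiv
  { homEquiv := uInfHomEquiv
    homEquiv_naturality_left_symm := fun {g' g A} k f => by
      -- Naturality is tested after passing to twisting cochains. On both sides the morphism `k`
      -- acts there by precomposition, even though neither bijection is given by a simple formula on
      -- morphisms.
      refine (envHomEquiv (CEObj g') A).injective (TwistingCochain.ext (LinearMap.ext fun x => ?_))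
      refine (congrArg (fun τ => τ.toLinearMap x) (cochainOfHom_uInfHomEquiv_symm (k ≫ f))).trans ?_
      refine (cochainOfLInf_comp k f x).trans ?_
      rw [← cochainOfHom_uInfHomEquiv_symm f]
      exact (cochainOfHom_map (C := CEObj g) (D := CEObj g') k _ x).symm
    homEquiv_naturality_right := fun {g A B} F k => by
      -- In the algebra variable, both sides become postcomposition of the twisting cochain with
      -- `k`.
      refine (lInfHomEquiv B g).injective (TwistingCochain.ext (LinearMap.ext fun x => ?_))
      refine (congrArg (fun τ => τ.toLinearMap x) (cochainOfLInf_uInfHomEquiv (F ≫ k))).trans ?_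
      refine Eq.trans ?_ (cochainOfLInf_map (uInfHomEquiv g A F) k x).symm
      rw [cochainOfLInf_uInfHomEquiv F]
      exact cochainOfHom_comp (C := CEObj g) F k x }

end

end LInf

theorem mainTheorem6 : Nonempty (LInf.UInf.{u} ⊣ LInf.SigmaInf.{u}) :=
  ⟨LInf.uInfAdjunction⟩
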